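/- Let $n\ge 1$ and let $\lambda=(\lambda_{ij})_{0\le i,j<n}$ be a complex alternating matrix ($\lambda_{ij}=-\lambda_{ji}$) that is normalized ($\sum_j\lambda_{ij}=0$ for all $i$) and has rank $n-1$. Let $\mathsf B_\lambda$ be $\mathbb C[x_0,\dots,x_{n-1}]$ with the Poisson bracket $\{x_i,x_j\}=\lambda_{ij}x_ix_j$. Let $b$ be the biresidue matrix of $\lambda$, that is, the unique normalized alternating matrix which is inverse to $\lambda$ on $\Delta=\{z\in\mathbb C^n:\sum_i z_i=0\}$. An edge joining $i\ne j$ is called smoothable if $b_{ij}\ne0$ and there is a (necessarily unique) weight $\boldsymbol\theta\in\mathbb Z^n$ with $\theta_i=\theta_j=-1$ and $\theta_k=(b_{jk}+b_{ki})/b_{ij}\in\mathbb Z_{\ge0}$ for all $k\ne i,j$; then $\boldsymbol\theta$ is its smoothable weight. Let $I$ be a set of smoothable edges that contains no cycle, with smoothable weights $\boldsymbol\theta_e$, $e\in I$, and for $m\ge0$ let $\Theta_m$ be the set of all sums $\boldsymbol\theta_{e_1}+\dots+\boldsymbol\theta_{e_m}$ with $e_1,\dots,e_m\in I$ (so $\Theta_0=\{0\}$).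 Let $\mathcal F_p\subseteq\mathbb C[x_0,\dots,x_{n-1}]$ be the span of the monomials $x^{\mathbf w}$ with $\mathbf w\in\Theta_m+\mathbb Z_{\ge0}^n$ for some $m\ge p$, and let $\mathrm e_a$ be the standard basis vectors of $\mathbb Z^n$. For constants $\gamma=(\gamma_e)_{e\in I}$, an integer $N\ge1$ and coefficients $c=(c_{ba}^{k\ell})$ such that $c_{ba}^{k\ell}=\gamma_e$ whenever $a<b$, $k\le\ell$, $e\in I$ and $-\mathrm e_a-\mathrm e_b+\mathrm e_k+\mathrm e_\ell=\boldsymbol\theta_e$, consider the formula $$\{x_a,x_b\}=\lambda_{ab}\,x_ax_b+\sum_{m=1}^N\varepsilon^m\Bigg(\sum_{\substack{k\le\ell\\-\mathrm e_a-\mathrm e_b+\mathrm e_k+\mathrm e_\ell\in\Theta_m}}c_{ba}^{k\ell}\,x_kx_\ell\Bigg),\qquad a<b.\tag{$*$}$$ 1. (Existence.) For all non-zero constants $\gamma_e$, $e\in I$, there are $N$ and $c$ as above such that $(*)$ defines a $\mathbb C[\varepsilon]$-linear Poisson bracket on $\mathbb C[\varepsilon][x_0,\dots,x_{n-1}]$,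 and a Poisson bracket on $\mathbb C[x_0,\dots,x_{n-1}]$ for each $\varepsilon\in\mathbb C$. It is a filtered deformation of $\mathsf B_\lambda$: if $\{f,g\}=\sum_m\varepsilon^m\mu_m(f,g)$ for $f,g\in\mathbb C[x_0,\dots,x_{n-1}]$, then $\mu_0$ is the bracket of $\mathsf B_\lambda$ and $\mu_m(\mathcal F_p,\mathcal F_q)\subseteq\mathcal F_{p+q+m}$ for all $m,p,q\ge0$. 2. (Uniqueness.) Any two Poisson brackets on $\mathbb C[\varepsilon][x_0,\dots,x_{n-1}]$ of the form $(*)$ with the same non-zero constants $\gamma_e$ (but possibly different $N$ and $c$) are intertwined by the $\mathbb C[\varepsilon]$-algebra automorphism induced by a filtered unipotent linear automorphism $$x_a\mapsto x_a+\sum_{m=1}^M\varepsilon^m\sum_{d:\ \mathrm e_d-\mathrm e_a\in\Theta_m}\alpha_{ad}\,x_d,\qquad \alpha_{ad}\in\mathbb C.$$ 3. (Independence of $\varepsilon$ and $\gamma$.) Any two Poisson brackets on $\mathbb C[x_0,\dots,x_{n-1}]$ of the form $(*)$, with parameters $\varepsilon,\varepsilon'\in\mathbb C\setminus\{0\}$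 and non-zero constants $(\gamma_e)$, $(\gamma'_e)$ (and any $N,N'$ and $c,c'$), are intertwined by the algebra automorphism induced by a filtered linear automorphism, that is, an invertible linear substitution sending each $x_a$ to a linear combination of those $x_d$ with $\mathrm e_d-\mathrm e_a\in\bigcup_{m\ge0}\Theta_m$. -/

import Mathlib

open scoped Polynomial

namespace TorusDeform

noncomputable section

/-! ### Poisson algebras -/

/-- A Poisson bracket on the commutative `R`-algebra `A`: an `R`-bilinear alternating bracket
satisfying the Jacobi identity and the Leibniz rule. -/
structure PoissonBracket (R A : Type*) [CommRing R] [CommRing A] [Algebra R A] where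
  bracket : A →ₗ[R] A →ₗ[R] A
  bracket_self : ∀ f, bracket f f = 0
  jacobi : ∀ f g h,
    bracket f (bracket g h) + bracket g (bracket h f) + bracket h (bracket f g) = 0
  leibniz : ∀ f g h, bracket f (g * h) = bracket f g * h + g * bracket f h

/-- The Euler derivation `x_i ∂_i` of the polynomial ring. -/
def euler {n : ℕ} (i : Fin n) :
    Derivation ℂ (MvPolynomial (Fin n) ℂ) (MvPolynomial (Fin n) ℂ) :=
  (MvPolynomial.X i : MvPolynomial (Fin n) ℂ) • MvPolynomial.pderiv i

theorem euler_X {n : ℕ} (i j : Fin n) :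
    euler i (MvPolynomial.X j) = if i = j then (MvPolynomial.X j : MvPolynomial (Fin n) ℂ) else 0 := by
  classical
  by_cases h : i = j
  · subst h; simp [euler]
  · simp [euler, h, MvPolynomial.pderiv_X, Ne.symm h]

theorem euler_comm {n : ℕ} (i j : Fin n) (f : MvPolynomial (Fin n) ℂ) :
    euler i (euler j f) = euler j (euler i f) := by
  have h : ⁅euler i, euler j⁆ =
      (0 : Derivation ℂ (MvPolynomial (Fin n) ℂ) (MvPolynomial (Fin n) ℂ)) := by
    apply MvPolynomial.derivation_ext
    intro k
    rw [Derivation.commutator_apply, euler_X, euler_X]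
    split_ifs with h1 h2 h2 <;> simp [euler_X, h1, h2]
  have h2 := congrArg (fun D => D f) h
  simp only [Derivation.commutator_apply, Derivation.zero_apply] at h2
  exact sub_eq_zero.mp h2

/-- The bilinear map `{f,g} = ∑ᵢⱼ λᵢⱼ xᵢ xⱼ ∂ᵢf ∂ⱼg`. -/
def toricBilin {n : ℕ} (lam : Matrix (Fin n) (Fin n) ℂ) :
    MvPolynomial (Fin n) ℂ →ₗ[ℂ] MvPolynomial (Fin n) ℂ →ₗ[ℂ] MvPolynomial (Fin n) ℂ :=
  LinearMap.mk₂ ℂ (fun f g => ∑ i, ∑ j, lam i j • (euler i f * euler j g))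
    (by intro f f' g; simp [add_mul, Finset.sum_add_distrib])
    (by intro c f g; simp only [Derivation.map_smul, smul_mul_assoc, Finset.smul_sum, smul_comm c])
    (by intro f g g'; simp [mul_add, Finset.sum_add_distrib])
    (by intro c f g; simp only [Derivation.map_smul, mul_smul_comm, Finset.smul_sum, smul_comm c])

theorem toricBilin_apply {n : ℕ} (lam : Matrix (Fin n) (Fin n) ℂ) (f g : MvPolynomial (Fin n) ℂ) :
    toricBilin lam f g = ∑ i, ∑ j, lam i j • (euler i f * euler j g) := rfl

theorem toricBilin_swap {n : ℕ} (lam : Matrix (Fin n) (Fin n) ℂ) (h : lam.transpose = -lam)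
    (f g : MvPolynomial (Fin n) ℂ) : toricBilin lam f g = -toricBilin lam g f := by
  rw [toricBilin_apply, toricBilin_apply, Finset.sum_comm, ← Finset.sum_neg_distrib]
  refine Finset.sum_congr rfl fun j _ => ?_
  rw [← Finset.sum_neg_distrib]
  refine Finset.sum_congr rfl fun i _ => ?_
  have : lam i j = -lam j i := by
    have := congrFun (congrFun h j) i
    simpa using this
  rw [this, neg_smul, mul_comm]

theorem toricBilin_nested {n : ℕ} (lam : Matrix (Fin n) (Fin n) ℂ)
    (f g h : MvPolynomial (Fin n) ℂ) :
    toricBilin lam f (toricBilin lam g h) =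
      (∑ i, ∑ j, ∑ k, ∑ l, (lam i j * lam k l) •
        (euler i f * euler j (euler k g) * euler l h)) +
      ∑ i, ∑ j, ∑ k, ∑ l, (lam i j * lam k l) •
        (euler i f * euler k g * euler j (euler l h)) := by
  simp only [← Finset.sum_add_distrib]
  rw [toricBilin_apply]
  refine Finset.sum_congr rfl fun i _ => Finset.sum_congr rfl fun j _ => ?_
  rw [toricBilin_apply, map_sum, Finset.mul_sum, Finset.smul_sum]
  refine Finset.sum_congr rfl fun k _ => ?_
  rw [map_sum, Finset.mul_sum, Finset.smul_sum]
  refine Finset.sum_congr rfl fun l _ => ?_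
  rw [Derivation.map_smul, Derivation.leibniz, smul_eq_mul, smul_eq_mul, mul_smul_comm, smul_smul,
    ← smul_add]
  congr 1
  ring

theorem sum_reindex {n : ℕ} {M : Type*} [AddCommMonoid M]
    (F : Fin n → Fin n → Fin n → Fin n → M) :
    ∑ i, ∑ j, ∑ k, ∑ l, F i j k l = ∑ i, ∑ j, ∑ k, ∑ l, F k l j i := by
  calc ∑ i, ∑ j, ∑ k, ∑ l, F i j k l
      = ∑ p : (Fin n × Fin n), ∑ q : (Fin n × Fin n), F p.1 p.2 q.1 q.2 := by
        simp only [Fintype.sum_prod_type]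
    _ = ∑ q : (Fin n × Fin n), ∑ p : (Fin n × Fin n), F p.1 p.2 q.1 q.2 := Finset.sum_comm
    _ = ∑ j, ∑ i, ∑ k, ∑ l, F k l j i := by simp only [Fintype.sum_prod_type]
    _ = ∑ i, ∑ j, ∑ k, ∑ l, F k l j i := Finset.sum_comm

theorem toricBilin_cancel {n : ℕ} (lam : Matrix (Fin n) (Fin n) ℂ) (hl : lam.transpose = -lam)
    (f g h : MvPolynomial (Fin n) ℂ) :
    (∑ i, ∑ j, ∑ k, ∑ l, (lam i j * lam k l) •
        (euler i g * euler j (euler k h) * euler l f)) +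
      ∑ i, ∑ j, ∑ k, ∑ l, (lam i j * lam k l) •
        (euler i f * euler k g * euler j (euler l h)) = 0 := by
  rw [sum_reindex fun i j k l => (lam i j * lam k l) •
        (euler i g * euler j (euler k h) * euler l f), ← Finset.sum_add_distrib]
  refine Finset.sum_eq_zero fun i _ => ?_
  rw [← Finset.sum_add_distrib]
  refine Finset.sum_eq_zero fun j _ => ?_
  rw [← Finset.sum_add_distrib]
  refine Finset.sum_eq_zero fun k _ => ?_
  rw [← Finset.sum_add_distrib]
  refine Finset.sum_eq_zero fun l _ => ?_
  have hij : lam j i = -lam i j := by simpa using congrFun (congrFun hl i) j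
  have hs : lam k l * lam j i = -(lam i j * lam k l) := by rw [hij]; ring
  rw [hs, euler_comm l j, neg_smul]
  generalize euler j (euler l h) = x
  generalize euler k g = y
  generalize euler i f = z
  rw [show y * x * z = z * y * x by ring, neg_add_cancel]

/-- The toric (log canonical) Poisson algebra `B_λ`: the polynomial ring with `{xᵢ,xⱼ} = λᵢⱼ xᵢ xⱼ`. -/
def toricPoisson {n : ℕ} (lam : Matrix (Fin n) (Fin n) ℂ) (h : lam.transpose = -lam) :
    PoissonBracket ℂ (MvPolynomial (Fin n) ℂ) where
  bracket := toricBilin lam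
  bracket_self f := by
    have := toricBilin_swap lam h f f
    exact self_eq_neg.mp this
  jacobi f g k := by
    change toricBilin lam _ (toricBilin lam _ _) + toricBilin lam _ (toricBilin lam _ _) +
      toricBilin lam _ (toricBilin lam _ _) = 0
    rw [toricBilin_nested, toricBilin_nested, toricBilin_nested]
    linear_combination toricBilin_cancel lam h f g k + toricBilin_cancel lam h g k f +
      toricBilin_cancel lam h k f g
  leibniz f g k := by
    simp only [toricBilin_apply, Derivation.leibniz, smul_eq_mul, Finset.sum_mul, Finset.mul_sum,
      ← Finset.sum_add_distrib]
    refine Finset.sum_congr rfl fun i _ => Finset.sum_congr rfl fun j _ => ?_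
    simp only [smul_mul_assoc, mul_smul_comm, ← smul_add]
    congr 1
    ring

theorem toricPoisson_X {n : ℕ} (lam : Matrix (Fin n) (Fin n) ℂ) (h : lam.transpose = -lam)
    (i j : Fin n) :
    (toricPoisson lam h).bracket (MvPolynomial.X i) (MvPolynomial.X j) =
      MvPolynomial.C (lam i j) * MvPolynomial.X i * MvPolynomial.X j := by
  change toricBilin lam _ _ = _
  simp [toricBilin_apply, euler_X, MvPolynomial.smul_eq_C_mul, mul_assoc]

/-! ### Biresidue matrix and smoothable edges -/

/-- `β` is the biresidue matrix of the normalized alternating matrix `lam`: the normalized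
alternating matrix inverse to `lam` on the hyperplane `Δ` of vectors with coordinate sum zero. -/
structure IsBiresidueMatrix {n : ℕ} (lam β : Matrix (Fin n) (Fin n) ℂ) : Prop where
  alternating : β.transpose = -β
  normalized : ∀ i, ∑ j, β i j = 0
  left_inv : ∀ z : Fin n → ℂ, ∑ i, z i = 0 → β.mulVec (lam.mulVec z) = z
  right_inv : ∀ z : Fin n → ℂ, ∑ i, z i = 0 → lam.mulVec (β.mulVec z) = z

theorem sum_mulVec_eq_zero {n : ℕ} {A : Matrix (Fin n) (Fin n) ℂ} (ha : A.transpose = -A)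
    (hn : ∀ i, ∑ j, A i j = 0) (z : Fin n → ℂ) : ∑ i, A.mulVec z i = 0 := by
  have h : ∀ j, ∑ i, A i j = 0 := by
    intro j
    have : ∀ i, A i j = -A j i := fun i => by simpa using congrFun (congrFun ha j) i
    simp [this, hn]
  simp only [Matrix.mulVec, dotProduct]
  rw [Finset.sum_comm]
  simp [← Finset.sum_mul, h]

theorem mulVec_const {n : ℕ} {A : Matrix (Fin n) (Fin n) ℂ}
    (hn : ∀ i, ∑ j, A i j = 0) (c : ℂ) : A.mulVec (fun _ => c) = 0 := by
  ext i
  simp [Matrix.mulVec, dotProduct, ← Finset.sum_mul, hn]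

/-- A normalized alternating matrix of corank one has exactly one biresidue matrix. -/
theorem existsUnique_isBiresidueMatrix {n : ℕ} (lam : Matrix (Fin n) (Fin n) ℂ)
    (halt : lam.transpose = -lam) (hnorm : ∀ i, ∑ j, lam i j = 0) (hrank : lam.rank + 1 = n) :
    ∃! β, IsBiresidueMatrix lam β := by
  have hn0 : (n : ℂ) ≠ 0 := by
    have : n ≠ 0 := by omega
    exact_mod_cast this
  -- the kernel of `lam` consists of the constant vectors
  have hker : ∀ z : Fin n → ℂ, ∑ i, z i = 0 → lam.mulVec z = 0 → z = 0 := by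
    intro z hz hlz
    have h1 : Module.finrank ℂ (LinearMap.ker lam.mulVecLin) = 1 := by
      have := LinearMap.finrank_range_add_finrank_ker lam.mulVecLin
      rw [Module.finrank_fin_fun] at this
      have h2 : Module.finrank ℂ (LinearMap.range lam.mulVecLin) = lam.rank := rfl
      omega
    have hone : (fun _ => 1 : Fin n → ℂ) ∈ LinearMap.ker lam.mulVecLin := by
      simpa using mulVec_const hnorm 1
    have hzk : z ∈ LinearMap.ker lam.mulVecLin := by simpa using hlz
    have hne : (⟨_, hone⟩ : LinearMap.ker lam.mulVecLin) ≠ 0 := by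
      intro h
      have h' := congrFun (congrArg Subtype.val h) ⟨0, by omega⟩
      simp at h'
    obtain ⟨c, hc⟩ := (finrank_eq_one_iff_of_nonzero' _ hne).mp h1 ⟨z, hzk⟩
    have hc' : ∀ i, z i = c := by
      intro i
      have := congrFun (congrArg Subtype.val hc) i
      simpa using this.symm
    have : (n : ℂ) * c = 0 := by simpa [hc'] using hz
    have hc0 : c = 0 := by
      rcases mul_eq_zero.mp this with h | h
      · exact absurd h hn0
      · exact h
    ext i
    simp [hc', hc0]
  set J : Matrix (Fin n) (Fin n) ℂ := Matrix.of fun _ _ => 1 with hJ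
  have hJv : ∀ z : Fin n → ℂ, J.mulVec z = fun _ => ∑ i, z i := by
    intro z; ext i; simp [hJ, Matrix.mulVec, dotProduct]
  have hJJ : J * J = (n : ℂ) • J := by
    ext i j; simp [hJ, Matrix.mul_apply]
  have hJt : J.transpose = J := by ext i j; simp [hJ]
  have hlJ : lam * J = 0 := by
    ext i j; simp [hJ, Matrix.mul_apply, hnorm]
  have hJl : J * lam = 0 := by
    have := congrArg Matrix.transpose hlJ
    rw [Matrix.transpose_mul, hJt, halt] at this
    simpa using this
  have hunit : IsUnit (lam + J) := by
    rw [← Matrix.mulVec_injective_iff_isUnit]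
    intro x y hxy
    have h0 : (lam + J).mulVec (x - y) = 0 := by
      rw [Matrix.mulVec_sub]; exact sub_eq_zero.mpr hxy
    rw [Matrix.add_mulVec, hJv] at h0
    have hs : ∑ i, (x - y) i = 0 := by
      have := congrArg (fun v => ∑ i, v i) h0
      simp only [Pi.add_apply, Finset.sum_add_distrib, sum_mulVec_eq_zero halt hnorm] at this
      simp only [Finset.sum_const, Finset.card_univ, Fintype.card_fin, nsmul_eq_mul, zero_add,
        Pi.zero_apply, mul_zero] at this
      rcases mul_eq_zero.mp this with h | h
      · exact absurd h hn0
      · exact h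
    have hl : lam.mulVec (x - y) = 0 := by
      rw [hs] at h0
      ext i
      simpa using congrFun h0 i
    exact sub_eq_zero.mp (hker _ hs hl)
  have hdet : IsUnit (lam + J).det := (Matrix.isUnit_iff_isUnit_det _).mp hunit
  have hM1 : (lam + J)⁻¹ * (lam + J) = 1 := Matrix.nonsing_inv_mul _ hdet
  have hM2 : (lam + J) * (lam + J)⁻¹ = 1 := Matrix.mul_nonsing_inv _ hdet
  -- `(lam + J)⁻¹ J = n⁻¹ J` and `J (lam + J)⁻¹ = n⁻¹ J`
  have hMJ : (lam + J)⁻¹ * J = (n : ℂ)⁻¹ • J := by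
    have : (lam + J) * J = (n : ℂ) • J := by rw [add_mul, hlJ, hJJ, zero_add]
    calc (lam + J)⁻¹ * J = (n : ℂ)⁻¹ • ((lam + J)⁻¹ * ((n : ℂ) • J)) := by
          rw [Matrix.mul_smul, smul_smul, inv_mul_cancel₀ hn0, one_smul]
      _ = (n : ℂ)⁻¹ • J := by rw [← this, ← mul_assoc, hM1, one_mul]
  have hJM : J * (lam + J)⁻¹ = (n : ℂ)⁻¹ • J := by
    have : J * (lam + J) = (n : ℂ) • J := by rw [mul_add, hJl, hJJ, zero_add]
    calc J * (lam + J)⁻¹ = (n : ℂ)⁻¹ • (((n : ℂ) • J) * (lam + J)⁻¹) := by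
          rw [Matrix.smul_mul, smul_smul, inv_mul_cancel₀ hn0, one_smul]
      _ = (n : ℂ)⁻¹ • J := by rw [← this, mul_assoc, hM2, mul_one]
  set β : Matrix (Fin n) (Fin n) ℂ := (lam + J)⁻¹ - ((n : ℂ)⁻¹ * (n : ℂ)⁻¹) • J with hβ
  have hβl : β * lam = 1 - (n : ℂ)⁻¹ • J := by
    have : (lam + J)⁻¹ * lam = 1 - (n : ℂ)⁻¹ • J := by
      rw [← hMJ, ← hM1, mul_add, add_sub_cancel_right]
    rw [hβ, sub_mul, Matrix.smul_mul, hJl, smul_zero, sub_zero, this]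
  have hlβ : lam * β = 1 - (n : ℂ)⁻¹ • J := by
    have : lam * (lam + J)⁻¹ = 1 - (n : ℂ)⁻¹ • J := by
      rw [← hJM, ← hM2, add_mul, add_sub_cancel_right]
    rw [hβ, mul_sub, Matrix.mul_smul, hlJ, smul_zero, sub_zero, this]
  have hβJ : β * J = 0 := by
    rw [hβ, sub_mul, hMJ, Matrix.smul_mul, hJJ, smul_smul, mul_assoc, inv_mul_cancel₀ hn0, mul_one,
      sub_self]
  have hJβ : J * β = 0 := by
    rw [hβ, mul_sub, hJM, Matrix.mul_smul, hJJ, smul_smul, mul_assoc, inv_mul_cancel₀ hn0, mul_one,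
      sub_self]
  have hβn : ∀ i, ∑ j, β i j = 0 := by
    intro i
    have := congrFun (congrFun hβJ i) i
    simpa [hJ, Matrix.mul_apply] using this
  have hβa : β.transpose = -β := by
    have h1 : β.transpose * lam.transpose = 1 - (n : ℂ)⁻¹ • J := by
      rw [← Matrix.transpose_mul, hlβ, Matrix.transpose_sub, Matrix.transpose_smul, hJt,
        Matrix.transpose_one]
    have hβtJ : β.transpose * J = 0 := by
      have := congrArg Matrix.transpose hJβ
      rwa [Matrix.transpose_mul, hJt, Matrix.transpose_zero] at this
    rw [halt, mul_neg] at h1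
    calc β.transpose = β.transpose * (lam * β + (n : ℂ)⁻¹ • J) := by
          rw [hlβ, sub_add_cancel, mul_one]
      _ = -(-(β.transpose * lam) * β) := by
          rw [mul_add, Matrix.mul_smul, hβtJ, smul_zero, add_zero, neg_mul, neg_neg, mul_assoc]
      _ = -β := by
          rw [h1, sub_mul, one_mul, Matrix.smul_mul, hJβ, smul_zero, sub_zero]
  have hproj : ∀ z : Fin n → ℂ, ∑ i, z i = 0 → (1 - (n : ℂ)⁻¹ • J).mulVec z = z := by
    intro z hz
    rw [Matrix.sub_mulVec, Matrix.one_mulVec, Matrix.smul_mulVec, hJv, hz]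
    ext i; simp
  refine ⟨β, ⟨hβa, hβn, fun z hz => ?_, fun z hz => ?_⟩, ?_⟩
  · rw [Matrix.mulVec_mulVec, hβl, hproj z hz]
  · rw [Matrix.mulVec_mulVec, hlβ, hproj z hz]
  · intro β' h'
    have key : ∀ z : Fin n → ℂ, β'.mulVec z = β.mulVec z := by
      intro z
      set c : ℂ := (n : ℂ)⁻¹ * ∑ i, z i with hc
      have hz : z = (fun i => z i - c) + (fun _ => c) := by ext i; simp
      have hs : ∑ i, (z i - c) = 0 := by
        simp [hc, hn0]
      rw [hz, Matrix.mulVec_add, Matrix.mulVec_add, mulVec_const h'.normalized, mulVec_const hβn]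
      congr 1
      have h2 : lam.mulVec (β.mulVec fun i => z i - c) = fun i => z i - c := by
        rw [Matrix.mulVec_mulVec, hlβ, hproj _ hs]
      calc β'.mulVec (fun i => z i - c)
          = β'.mulVec (lam.mulVec (β.mulVec fun i => z i - c)) := by rw [h2]
        _ = _ := h'.left_inv _ (sum_mulVec_eq_zero hβa hβn _)
    ext i j
    have := congrFun (key (Pi.single j 1)) i
    simpa using this

/-- `w` is the smoothable weight of the edge joining `i` and `j`. -/
def IsSmoothableWeight {n : ℕ} (β : Matrix (Fin n) (Fin n) ℂ) (i j : Fin n) (w : Fin n → ℤ) :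
    Prop :=
  i ≠ j ∧ w i = -1 ∧ w j = -1 ∧ β i j ≠ 0 ∧
    ∀ k, k ≠ i → k ≠ j → 0 ≤ w k ∧ (β j k + β k i) / β i j = (w k : ℂ)

/-- The edge joining `i` and `j` is smoothable. -/
def IsSmoothableEdge {n : ℕ} (β : Matrix (Fin n) (Fin n) ℂ) (i j : Fin n) : Prop :=
  ∃ w, IsSmoothableWeight β i j w

/-- `Θ_m`: all sums of `m` smoothable weights (with repetitions) of edges of `G`. -/
def Theta {n : ℕ} (β : Matrix (Fin n) (Fin n) ℂ) (G : SimpleGraph (Fin n)) (m : ℕ) :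
    Set (Fin n → ℤ) :=
  {w | ∃ θ : Fin m → (Fin n → ℤ),
    (∀ s, ∃ i j, G.Adj i j ∧ IsSmoothableWeight β i j (θ s)) ∧ w = ∑ s, θ s}

/-- The standard basis vector `e_a` of `ℤⁿ`. -/
def unitWeight {n : ℕ} (a : Fin n) : Fin n → ℤ := Pi.single a 1

/-- The weight `-e_a - e_b + e_k + e_l`. -/
def quadWeight {n : ℕ} (a b k l : Fin n) : Fin n → ℤ :=
  -unitWeight a - unitWeight b + unitWeight k + unitWeight l

/-! ### The filtration and filtered deformations -/

/-- The filtration of the polynomial ring: `F_p` is spanned by the monomials `x^s` with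
`s ∈ Θ_m + ℤ_{≥0}ⁿ` for some `m ≥ p`. -/
def smoothableFiltration {n : ℕ} (β : Matrix (Fin n) (Fin n) ℂ) (G : SimpleGraph (Fin n)) (p : ℕ) :
    Submodule ℂ (MvPolynomial (Fin n) ℂ) :=
  Submodule.span ℂ {f | ∃ s : Fin n →₀ ℕ, (∃ m, p ≤ m ∧ ∃ θ ∈ Theta β G m, ∀ i, θ i ≤ (s i : ℤ)) ∧
    f = MvPolynomial.monomial s 1}

/-- The coefficient of `ε^m` of a polynomial in `x` with coefficients in `ℂ[ε]`. -/
def epsCoeff {n : ℕ} (m : ℕ) (f : MvPolynomial (Fin n) ℂ[X]) : MvPolynomial (Fin n) ℂ :=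
  ∑ s ∈ f.support, MvPolynomial.monomial s ((MvPolynomial.coeff s f).coeff m)

/-- The `ℂ[ε]`-linear Poisson bracket `P` is a filtered deformation of `P₀`: writing
`P(f, g) = ∑ₘ εᵐ μₘ(f, g)` for `f, g ∈ ℂ[x]`, one has `μ₀ = P₀` and `μₘ(F_p, F_q) ⊆ F_{p+q+m}`. -/
structure IsFilteredDeformation {n : ℕ} (F : ℕ → Submodule ℂ (MvPolynomial (Fin n) ℂ))
    (P₀ : PoissonBracket ℂ (MvPolynomial (Fin n) ℂ))
    (P : PoissonBracket ℂ[X] (MvPolynomial (Fin n) ℂ[X])) : Prop where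
  specializes : ∀ f g : MvPolynomial (Fin n) ℂ,
    epsCoeff 0 (P.bracket (MvPolynomial.map Polynomial.C f) (MvPolynomial.map Polynomial.C g)) =
      P₀.bracket f g
  filtered : ∀ (p q m : ℕ) (f g : MvPolynomial (Fin n) ℂ), f ∈ F p → g ∈ F q →
    epsCoeff m (P.bracket (MvPolynomial.map Polynomial.C f) (MvPolynomial.map Polynomial.C g)) ∈
      F (p + q + m)

/-- The coefficient family `c` takes the prescribed value `γ` on the smoothable weights of the
edges of `G`. Here `c b a k l` stands for `c_{ba}^{kl}`. -/
def HasLeadingCoeffs {n : ℕ} (β : Matrix (Fin n) (Fin n) ℂ) (G : SimpleGraph (Fin n))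
    (γ : Sym2 (Fin n) → ℂ) (c : Fin n → Fin n → Fin n → Fin n → ℂ) : Prop :=
  ∀ i j θ, G.Adj i j → IsSmoothableWeight β i j θ →
    ∀ a b k l, a < b → k ≤ l → quadWeight a b k l = θ → c b a k l = γ s(i, j)

open Classical in
/-- The Poisson bracket `P` over the `ℂ`-algebra `R` is given on generators, for `a < b`, by
`{x_a, x_b} = λ_ab x_a x_b + ∑_{m=1}^N ε^m ∑_{k ≤ l, -e_a-e_b+e_k+e_l ∈ Θ_m} c_{ba}^{kl} x_k x_l`. -/
def IsDeformedBracket {n : ℕ} {R : Type*} [CommRing R] [Algebra ℂ R]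
    (lam β : Matrix (Fin n) (Fin n) ℂ) (G : SimpleGraph (Fin n))
    (N : ℕ) (c : Fin n → Fin n → Fin n → Fin n → ℂ) (ε : R)
    (P : PoissonBracket R (MvPolynomial (Fin n) R)) : Prop :=
  ∀ a b : Fin n, a < b →
    P.bracket (MvPolynomial.X a) (MvPolynomial.X b) =
      MvPolynomial.C (algebraMap ℂ R (lam a b)) * MvPolynomial.X a * MvPolynomial.X b +
      ∑ m ∈ Finset.Icc 1 N, MvPolynomial.C (ε ^ m) *
        ∑ k, ∑ l, if k ≤ l ∧ quadWeight a b k l ∈ Theta β G m then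
          MvPolynomial.C (algebraMap ℂ R (c b a k l)) * MvPolynomial.X k * MvPolynomial.X l
        else 0

/-! ### Filtered linear automorphisms -/

/-- The algebra automorphism `φ` intertwines the Poisson brackets `P` and `P'`. -/
def Intertwines {R A : Type*} [CommRing R] [CommRing A] [Algebra R A] (φ : A ≃ₐ[R] A)
    (P P' : PoissonBracket R A) : Prop :=
  ∀ f g, φ (P.bracket f g) = P'.bracket (φ f) (φ g)

/-- `φ` is induced by a filtered linear automorphism of the space of linear coordinates over `ℂ`:
`x_a` is sent to a combination of those `x_d` with `e_d - e_a ∈ ⋃ₘ Θ_m` (where `Θ_0 = {0}`). -/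
def IsFilteredLinear {n : ℕ} (β : Matrix (Fin n) (Fin n) ℂ) (G : SimpleGraph (Fin n))
    (φ : MvPolynomial (Fin n) ℂ ≃ₐ[ℂ] MvPolynomial (Fin n) ℂ) : Prop :=
  ∃ α : Matrix (Fin n) (Fin n) ℂ,
    (∀ a, φ (MvPolynomial.X a) = ∑ d, MvPolynomial.C (α a d) * MvPolynomial.X d) ∧
    ∀ a d, α a d ≠ 0 → ∃ m, unitWeight d - unitWeight a ∈ Theta β G m

open Classical in
/-- `φ` is induced by a `ℂ[ε]`-linear filtered unipotent automorphism:
`x_a ↦ x_a + ∑_{m=1}^M ε^m ∑_{d : e_d - e_a ∈ Θ_m} α_{ad} x_d`. -/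
def IsFilteredUnipotent {n : ℕ} (β : Matrix (Fin n) (Fin n) ℂ) (G : SimpleGraph (Fin n))
    (φ : MvPolynomial (Fin n) ℂ[X] ≃ₐ[ℂ[X]] MvPolynomial (Fin n) ℂ[X]) : Prop :=
  ∃ (M : ℕ) (α : Matrix (Fin n) (Fin n) ℂ), ∀ a,
    φ (MvPolynomial.X a) = MvPolynomial.X a +
      ∑ m ∈ Finset.Icc 1 M, MvPolynomial.C ((Polynomial.X : ℂ[X]) ^ m) *
        ∑ d, if unitWeight d - unitWeight a ∈ Theta β G m then
          MvPolynomial.C (Polynomial.C (α a d)) * MvPolynomial.X d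
        else 0

end

end TorusDeform

open TorusDeform

open TorusDeform

namespace TorusDeform

/-! ### Weights of smoothable edges -/

section Weights

variable {n : ℕ} {lam β : Matrix (Fin n) (Fin n) ℂ} {G : SimpleGraph (Fin n)}

/-! Everything is graded by integral weights. A biderivation of weight `W` has `{x_a, x_b} = q_ab
x^(W + e_a + e_b)`, and on weight `W` the differential given by the toric bracket is the exterior
product with the vector `λW`. Contraction with an index `k` such that `(λW)_k ≠ 0` is a homotopy for
it. If all entries of `W` are at least `-1` and `W_k ≠ -1`, this contraction creates no negative
exponent, so the homotopy stays within polynomials. The proof is therefore a question about the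
supports of the vectors `λW`, `W ∈ Θ_m`.

The smoothable weight of the edge `ij` is `θ = β((e_i - e_j)/β_ij)`, hence `λθ = (e_i - e_j)/β_ij`,
and `λ` carries a sum of smoothable weights to a flow along the edges in use. Three facts follow.

Grading: in a forest every edge is a bridge, so the vectors `(e_i - e_j)/β_ij` are linearly
independent. Some linear functional equals `m` on `Θ_m` (`exists_degree_functional`), so the `Θ_m`
are disjoint and a weight has at most one order. In bounded degree only finitely many orders occur
(`exists_order_bound`).

First order: the terms at a weight `θ` of an edge `ij` only involve `{x_i, x_j}`, and `λθ` is
supported on `i, j`, so they are closed (`cyclic_sum_eq_zero`).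

Higher orders: for `m ≥ 2` and `W ∈ Θ_m` with entries at least `-1`, at most three of them equal to
`-1`, the flow `λW` is nonzero at some `k` with `W_k ≠ -1` (`exists_mulVec_ne_zero_of_mem_Theta`).
Bivectors and trivectors of order at least two are thus acyclic. The reason is combinatorial:
smoothable edges meet at most two at a vertex, so the edges in use form paths. A flow supported on
three vertices with entry `-1` would force an entry `≤ -2`, at a repeated edge or at an inner vertex
of a path.

Existence then proceeds order by order. The leading part of the Jacobiator is closed
(`zcoeff_jac_cocycle`), hence exact, and a correction of the same order removes it
(`exists_jacobi_step`); finitely many steps suffice. Uniqueness is the same argument one degree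
lower: the leading difference of two Poisson brackets is closed, hence is the differential of a
linear vector field, and a unipotent substitution removes it (`exists_conj_step`). For different
parameters, linear independence of the `θ_e` provides a diagonal scaling that matches the first
order terms (`exists_scaling`), and uniqueness applies with filtration parameter `1`. -/

theorem IsBiresidueMatrix.apply_swap (hβ : IsBiresidueMatrix lam β) (i j : Fin n) :
    β i j = -β j i := by
  simpa using congrFun (congrFun hβ.alternating j) i

theorem IsBiresidueMatrix.apply_self (hβ : IsBiresidueMatrix lam β) (i : Fin n) : β i i = 0 :=
  self_eq_neg.mp (hβ.apply_swap i i)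

/-- The vector `(e_i - e_j) / β_ij`, which `β` sends to the smoothable weight of the edge. -/
noncomputable def edgeVector (β : Matrix (Fin n) (Fin n) ℂ) (i j : Fin n) : Fin n → ℂ :=
  fun v => ((if v = i then 1 else 0) - (if v = j then 1 else 0)) / β i j

theorem sum_mul_edgeVector (f : Fin n → ℂ) (i j : Fin n) :
    ∑ v, f v * edgeVector β i j v = (f i - f j) / β i j := by
  simp [edgeVector, mul_div_assoc', mul_sub, ← Finset.sum_div]

theorem sum_edgeVector (i j : Fin n) : ∑ v, edgeVector β i j v = 0 := by
  have := sum_mul_edgeVector (β := β) (fun _ => 1) i j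
  simpa using this

/-- The quotient that defines the entries off the edge also gives `-1` at both endpoints, because
`β` has zero diagonal. -/
theorem IsSmoothableWeight.apply_eq (hβ : IsBiresidueMatrix lam β) {i j : Fin n} {w : Fin n → ℤ}
    (h : IsSmoothableWeight β i j w) (k : Fin n) : (w k : ℂ) = (β k i - β k j) / β i j := by
  obtain ⟨_, hi, hj, hb, hk⟩ := h
  by_cases h1 : k = i
  · subst h1
    rw [hi, hβ.apply_self, zero_sub, neg_div, div_self hb]; simp
  · by_cases h2 : k = j
    · subst h2
      rw [hj, hβ.apply_self, sub_zero, hβ.apply_swap k i, neg_div, div_self hb]; simp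
    · rw [← (hk k h1 h2).2, hβ.apply_swap k j]; ring

theorem IsSmoothableWeight.eq_mulVec (hβ : IsBiresidueMatrix lam β) {i j : Fin n} {w : Fin n → ℤ}
    (h : IsSmoothableWeight β i j w) : (fun k => (w k : ℂ)) = β.mulVec (edgeVector β i j) := by
  ext k
  rw [Matrix.mulVec, dotProduct, sum_mul_edgeVector, h.apply_eq hβ]

/-- `λ` inverts `β` on vectors of sum zero. The point is that `λw` is supported on the two endpoints
of the edge. -/
theorem IsSmoothableWeight.mulVec_eq (hβ : IsBiresidueMatrix lam β) {i j : Fin n} {w : Fin n → ℤ}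
    (h : IsSmoothableWeight β i j w) :
    lam.mulVec (fun k => (w k : ℂ)) = edgeVector β i j := by
  rw [h.eq_mulVec hβ, hβ.right_inv _ (sum_edgeVector i j)]

theorem IsSmoothableWeight.sum_eq_zero (hβ : IsBiresidueMatrix lam β) {i j : Fin n}
    {w : Fin n → ℤ} (h : IsSmoothableWeight β i j w) : ∑ k, w k = 0 := by
  have : ((∑ k, w k : ℤ) : ℂ) = 0 := by
    push_cast
    have h1 := h.eq_mulVec hβ
    have h2 := sum_mulVec_eq_zero hβ.alternating hβ.normalized (edgeVector β i j)
    rw [← h1] at h2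
    exact h2
  exact_mod_cast this

theorem IsSmoothableWeight.nonneg {i j k : Fin n} {w : Fin n → ℤ}
    (h : IsSmoothableWeight β i j w) (h1 : k ≠ i) (h2 : k ≠ j) : 0 ≤ w k :=
  (h.2.2.2.2 k h1 h2).1

theorem IsSmoothableWeight.symm (hβ : IsBiresidueMatrix lam β) {i j : Fin n} {w : Fin n → ℤ}
    (h : IsSmoothableWeight β i j w) : IsSmoothableWeight β j i w := by
  refine ⟨h.1.symm, h.2.2.1, h.2.1, ?_, fun k h1 h2 => ⟨h.nonneg h2 h1, ?_⟩⟩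
  · rw [hβ.apply_swap]; exact neg_ne_zero.mpr h.2.2.2.1
  · rw [h.apply_eq hβ k, hβ.apply_swap j i, hβ.apply_swap i k, div_neg, ← neg_div]
    congr 1; ring

/-! ### Cutting a forest along an edge -/

/-- The vertices joined to `i` by a walk. -/
def reachSet {V : Type*} (H : SimpleGraph V) (i : V) : Set V := {v | H.Reachable i v}

theorem mem_reachSet_iff_of_adj {V : Type*} {H : SimpleGraph V} {i v w : V} (h : H.Adj v w) :
    v ∈ reachSet H i ↔ w ∈ reachSet H i :=
  ⟨fun hv => SimpleGraph.Reachable.trans hv h.reachable,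
    fun hw => SimpleGraph.Reachable.trans hw h.symm.reachable⟩

/-- An edge of a forest is a bridge. The indicator function of one side of the cut is constant along
every other edge, and jumps across the edge itself; the factor `β i j` normalizes the jump. Skew
symmetry of `β` makes the value independent of the orientation. -/
theorem exists_dual_edgeVector (hβ : IsBiresidueMatrix lam β) (hG : G.IsAcyclic)
    (hb : ∀ i j, G.Adj i j → β i j ≠ 0) (e : Sym2 (Fin n)) (he : e ∈ G.edgeSet) :
    ∃ σ : Fin n → ℂ, ∀ p q, G.Adj p q →
      ∑ v, σ v * edgeVector β p q v = if s(p, q) = e then 1 else 0 := by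
  classical
  induction e using Sym2.ind with | _ i j
  rw [SimpleGraph.mem_edgeSet] at he
  have hbr : j ∉ reachSet (G.deleteEdges {s(i, j)}) i :=
    SimpleGraph.isBridge_iff.mp (SimpleGraph.isAcyclic_iff_forall_adj_isBridge.mp hG he)
  have hi : i ∈ reachSet (G.deleteEdges {s(i, j)}) i := SimpleGraph.Reachable.refl i
  refine ⟨fun v => β i j * if v ∈ reachSet (G.deleteEdges {s(i, j)}) i then 1 else 0,
    fun p q hpq => ?_⟩
  rw [sum_mul_edgeVector]
  have hbij := hb i j he
  by_cases h : s(p, q) = s(i, j)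
  · rw [if_pos h]
    rcases Sym2.eq_iff.mp h with ⟨rfl, rfl⟩ | ⟨rfl, rfl⟩
    · simp [hi, hbr, hbij]
    · simp [hi, hbr, hβ.apply_swap p q, hbij]
  · rw [if_neg h]
    have hadj : (G.deleteEdges {s(i, j)}).Adj p q := by
      rw [SimpleGraph.deleteEdges_adj]
      exact ⟨hpq, h⟩
    simp [mem_reachSet_iff_of_adj hadj]

/-- The smoothable weights of the edges of a forest are linearly independent: linear functionals
take arbitrary prescribed values on them. -/
theorem exists_dual_smoothableWeight (hβ : IsBiresidueMatrix lam β) (hG : G.IsAcyclic)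
    (hb : ∀ i j, G.Adj i j → β i j ≠ 0) (ρ : Sym2 (Fin n) → ℂ) :
    ∃ τ : Fin n → ℂ, ∀ p q w, G.Adj p q → IsSmoothableWeight β p q w →
      ∑ a, τ a * w a = ρ s(p, q) := by
  classical
  choose! σ hσ using exists_dual_edgeVector hβ hG hb
  -- The functional is `σ ∘ λ`, where `σ` combines the functionals dual to the edge vectors: `λ`
  -- turns weights into edge vectors.
  refine ⟨fun a => ∑ v, (∑ e ∈ G.edgeFinset, ρ e * σ e v) * lam v a, fun p q w hpq hw => ?_⟩
  have h1 : ∑ a, (∑ v, (∑ e ∈ G.edgeFinset, ρ e * σ e v) * lam v a) * (w a : ℂ) =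
      ∑ v, (∑ e ∈ G.edgeFinset, ρ e * σ e v) * lam.mulVec (fun k => (w k : ℂ)) v := by
    simp only [Matrix.mulVec, dotProduct, Finset.sum_mul, Finset.mul_sum]
    rw [Finset.sum_comm]
    simp only [mul_assoc]
  rw [h1, hw.mulVec_eq hβ]
  simp only [Finset.sum_mul]
  rw [Finset.sum_comm]
  have h2 : ∀ e ∈ G.edgeFinset, ∑ v, ρ e * σ e v * edgeVector β p q v =
      if s(p, q) = e then ρ e else 0 := by
    intro e he
    simp only [mul_assoc, ← Finset.mul_sum]
    rw [hσ e (SimpleGraph.mem_edgeFinset.mp he) p q hpq]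
    simp
  rw [Finset.sum_congr rfl h2]
  simp [hpq]

/-! ### The sets `Θ_m` and their order -/

theorem Theta_zero : Theta β G 0 = {0} := by
  ext w
  constructor
  · rintro ⟨θ, _, rfl⟩
    simp
  · rintro rfl
    exact ⟨Fin.elim0, fun s => s.elim0, by simp⟩

theorem mem_Theta_one {w : Fin n → ℤ} :
    w ∈ Theta β G 1 ↔ ∃ i j, G.Adj i j ∧ IsSmoothableWeight β i j w := by
  constructor
  · rintro ⟨θ, h, rfl⟩
    simpa using h 0
  · intro h
    exact ⟨fun _ => w, fun _ => h, by simp⟩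

theorem Theta_add_mem {p q : ℕ} {v w : Fin n → ℤ} (hv : v ∈ Theta β G p) (hw : w ∈ Theta β G q) :
    v + w ∈ Theta β G (p + q) := by
  obtain ⟨θ, h, rfl⟩ := hv
  obtain ⟨θ', h', rfl⟩ := hw
  refine ⟨Fin.append θ θ', fun s => ?_, by simp [Fin.sum_univ_add]⟩
  refine Fin.addCases (fun i => ?_) (fun i => ?_) s
  · simpa using h i
  · simpa using h' i

theorem sum_eq_zero_of_mem_Theta (hβ : IsBiresidueMatrix lam β) {m : ℕ} {w : Fin n → ℤ}
    (hw : w ∈ Theta β G m) : ∑ k, w k = 0 := by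
  obtain ⟨θ, h, rfl⟩ := hw
  simp only [Finset.sum_apply]
  rw [Finset.sum_comm]
  refine Finset.sum_eq_zero fun s _ => ?_
  obtain ⟨i, j, _, hs⟩ := h s
  exact hs.sum_eq_zero hβ

/-- Prescribing the value `1` on every smoothable weight counts the summands, so the order of a
weight does not depend on its decomposition. -/
theorem exists_degree_functional (hβ : IsBiresidueMatrix lam β) (hG : G.IsAcyclic)
    (hb : ∀ i j, G.Adj i j → β i j ≠ 0) :
    ∃ τ : Fin n → ℂ, ∀ m w, w ∈ Theta β G m → ∑ a, τ a * w a = m := by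
  obtain ⟨τ, hτ⟩ := exists_dual_smoothableWeight hβ hG hb fun _ => 1
  refine ⟨τ, ?_⟩
  rintro m _ ⟨θ, h, rfl⟩
  simp only [Finset.sum_apply, Int.cast_sum, Finset.mul_sum]
  rw [Finset.sum_comm]
  have : ∀ s ∈ Finset.univ, ∑ a, τ a * (θ s a : ℂ) = 1 := by
    intro s _
    obtain ⟨i, j, hij, hs⟩ := h s
    exact hτ i j _ hij hs
  rw [Finset.sum_congr rfl this]
  simp

theorem Theta_disjoint (hβ : IsBiresidueMatrix lam β) (hG : G.IsAcyclic)
    (hb : ∀ i j, G.Adj i j → β i j ≠ 0) {m m' : ℕ} {w : Fin n → ℤ} (h : w ∈ Theta β G m)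
    (h' : w ∈ Theta β G m') : m = m' := by
  obtain ⟨τ, hτ⟩ := exists_degree_functional hβ hG hb
  have := (hτ m w h).symm.trans (hτ m' w h')
  exact_mod_cast this

end Weights

/-! ### Sums of smoothable weights with few entries equal to `-1` -/

/-- Handshake lemma for a vertex set that only one edge leaves. -/
theorem odd_card_filter_odd_degree {V : Type*} [Fintype V] [DecidableEq V] (F : SimpleGraph V)
    [DecidableRel F.Adj] (C : Finset V) {i j : V} (hi : i ∈ C) (hj : j ∉ C) (hij : F.Adj i j)
    (hC : ∀ v ∈ C, ∀ l, F.Adj v l → l ∈ C ∨ (v = i ∧ l = j)) :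
    Odd (C.filter fun v => Odd (F.degree v)).card := by
  classical
  -- `K` keeps the edges that touch `C`. Degrees on `C` are unchanged, and outside `C` only `j` has
  -- an edge, of degree one. So `j` is one odd vertex in the handshake lemma for `K`.
  let K : SimpleGraph V :=
    { Adj := fun v l => F.Adj v l ∧ (v ∈ C ∨ l ∈ C)
      symm := ⟨fun v l h => ⟨h.1.symm, h.2.symm⟩⟩
      loopless := ⟨fun v h => F.loopless.irrefl v h.1⟩ }
  have hdeg : ∀ v ∈ C, K.degree v = F.degree v := by
    intro v hv
    rw [← SimpleGraph.card_neighborFinset_eq_degree, ← SimpleGraph.card_neighborFinset_eq_degree]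
    congr 1
    ext l
    simp [K, hv]
  have hdj : K.degree j = 1 := by
    rw [← SimpleGraph.card_neighborFinset_eq_degree, Finset.card_eq_one]
    refine ⟨i, ?_⟩
    ext l
    simp only [SimpleGraph.mem_neighborFinset, Finset.mem_singleton, K]
    constructor
    · rintro ⟨h, h' | h'⟩
      · exact absurd h' hj
      · rcases hC l h' j h.symm with h2 | h2
        · exact absurd h2 hj
        · exact h2.1
    · rintro rfl
      exact ⟨hij.symm, Or.inr hi⟩
  have hd0 : ∀ v, v ∉ C → v ≠ j → K.degree v = 0 := by
    intro v hv hvj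
    rw [← SimpleGraph.card_neighborFinset_eq_degree, Finset.card_eq_zero]
    ext l
    simp only [SimpleGraph.mem_neighborFinset, Finset.notMem_empty, iff_false, K]
    rintro ⟨h, h' | h'⟩
    · exact hv h'
    · rcases hC l h' v h.symm with h2 | h2
      · exact hv h2
      · exact hvj h2.2
  have hev := K.even_card_odd_degree_vertices
  have heq : (Finset.univ.filter fun v => Odd (K.degree v)) =
      insert j (C.filter fun v => Odd (F.degree v)) := by
    ext v
    by_cases hv : v ∈ C
    · have : v ≠ j := fun h => hj (h ▸ hv)
      simp [hv, hdeg v hv, this]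
    · by_cases hvj : v = j
      · subst hvj; simp [hdj]
      · simp [hv, hvj, hd0 v hv hvj]
  rw [heq, Finset.card_insert_of_notMem (by simp [hj])] at hev
  rcases Nat.even_or_odd (C.filter fun v => Odd (F.degree v)).card with h | h
  · exact absurd hev (by rw [Nat.even_add_one]; exact not_not.mpr h)
  · exact h

/-- The graph with all edges at the vertex `j` removed. -/
def isolate {V : Type*} (F : SimpleGraph V) (j : V) : SimpleGraph V where
  Adj v l := F.Adj v l ∧ v ≠ j ∧ l ≠ j
  symm := ⟨fun _ _ h => ⟨h.1.symm, h.2.2, h.2.1⟩⟩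
  loopless := ⟨fun v h => F.loopless.irrefl v h.1⟩

theorem notMem_reachSet_isolate {V : Type*} (F : SimpleGraph V) {i j : V} (hij : i ≠ j) :
    j ∉ reachSet (isolate F j) i := by
  intro h
  obtain ⟨w⟩ := h.symm
  cases w with
  | nil => exact hij rfl
  | cons h _ => exact h.2.1 rfl

/-- A walk from `i` to `k` avoiding `j`, followed by the edge `kj`, would bypass the bridge `ij`. -/
theorem notMem_reachSet_isolate_of_adj {V : Type*} {F : SimpleGraph V} (hF : F.IsAcyclic)
    {i j k : V} (hi : F.Adj j i) (hk : F.Adj j k) (hik : i ≠ k) :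
    k ∉ reachSet (isolate F j) i := by
  intro h
  have hbr := SimpleGraph.isBridge_iff.mp
    (SimpleGraph.isAcyclic_iff_forall_adj_isBridge.mp hF hi.symm)
  refine hbr ?_
  have hle : isolate F j ≤ F.deleteEdges {s(i, j)} := by
    intro v l hvl
    rw [SimpleGraph.deleteEdges_adj]
    refine ⟨hvl.1, fun h' => ?_⟩
    rcases Sym2.eq_iff.mp h' with ⟨_, h2⟩ | ⟨h2, _⟩
    · exact hvl.2.2 h2
    · exact hvl.2.1 h2
  have hkj : (F.deleteEdges {s(i, j)}).Adj k j := by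
    rw [SimpleGraph.deleteEdges_adj]
    refine ⟨hk.symm, fun h' => ?_⟩
    rcases Sym2.eq_iff.mp h' with ⟨h2, _⟩ | ⟨h2, _⟩
    · exact hik h2.symm
    · exact hk.ne h2.symm
  exact (SimpleGraph.Reachable.mono hle h).trans hkj.reachable

/-- The branch at `i` is left only through the edge `ij`: a second edge from the branch to `j` would
close a cycle. -/
theorem mem_reachSet_isolate_or {V : Type*} {F : SimpleGraph V} (hF : F.IsAcyclic)
    {i j : V} (hi : F.Adj j i) {v l : V} (hv : v ∈ reachSet (isolate F j) i) (hvl : F.Adj v l) :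
    l ∈ reachSet (isolate F j) i ∨ (v = i ∧ l = j) := by
  have hvj : v ≠ j := fun h => notMem_reachSet_isolate F hi.ne.symm (h ▸ hv)
  by_cases hlj : l = j
  · right
    refine ⟨?_, hlj⟩
    by_contra hne
    subst hlj
    exact notMem_reachSet_isolate_of_adj hF hi hvl.symm (Ne.symm hne) hv
  · left
    exact (mem_reachSet_iff_of_adj (show (isolate F j).Adj v l from ⟨hvl, hvj, hlj⟩)).mp hv

/-! ### Flows along families of smoothable edges -/

section Vanishing

variable {n m : ℕ} {lam β : Matrix (Fin n) (Fin n) ℂ} {G : SimpleGraph (Fin n)}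

theorem edgeVector_eq_zero {i j v : Fin n} (hi : v ≠ i) (hj : v ≠ j) : edgeVector β i j v = 0 := by
  simp [edgeVector, hi, hj]

/-- The sum of the vectors `(e_p - e_q) / β_pq` over a finite family of edges. -/
noncomputable def flow (β : Matrix (Fin n) (Fin n) ℂ) (p q : Fin m → Fin n) (A : Finset (Fin m)) :
    Fin n → ℂ := fun v => ∑ s ∈ A, edgeVector β (p s) (q s) v

theorem mulVec_flow (hβ : IsBiresidueMatrix lam β) {p q : Fin m → Fin n}
    {θ : Fin m → Fin n → ℤ} (hθ : ∀ s, IsSmoothableWeight β (p s) (q s) (θ s))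
    (A : Finset (Fin m)) (k : Fin n) :
    (((∑ s ∈ A, θ s) k : ℤ) : ℂ) = ∑ v, β k v * flow β p q A v := by
  simp only [Finset.sum_apply, Int.cast_sum, flow, Finset.mul_sum]
  rw [Finset.sum_comm]
  refine Finset.sum_congr rfl fun s _ => ?_
  exact congrFun ((hθ s).eq_mulVec hβ) k

theorem sum_flow {p q : Fin m → Fin n} (A : Finset (Fin m)) : ∑ v, flow β p q A v = 0 := by
  simp only [flow]
  rw [Finset.sum_comm]
  exact Finset.sum_eq_zero fun s _ => sum_edgeVector _ _

theorem flow_eq_mulVec (hβ : IsBiresidueMatrix lam β) {p q : Fin m → Fin n}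
    {θ : Fin m → Fin n → ℤ} (hθ : ∀ s, IsSmoothableWeight β (p s) (q s) (θ s))
    (A : Finset (Fin m)) :
    lam.mulVec (fun k => (((∑ s ∈ A, θ s) k : ℤ) : ℂ)) = flow β p q A := by
  have : (fun k => (((∑ s ∈ A, θ s) k : ℤ) : ℂ)) = β.mulVec (flow β p q A) := by
    ext k; exact mulVec_flow hβ hθ A k
  rw [this, hβ.right_inv _ (sum_flow A)]

theorem flow_eq_zero {p q : Fin m → Fin n} {A : Finset (Fin m)} {v : Fin n}
    (h : ∀ s ∈ A, v ≠ p s ∧ v ≠ q s) : flow β p q A v = 0 :=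
  Finset.sum_eq_zero fun s hs => edgeVector_eq_zero (h s hs).1 (h s hs).2

/-- The flow out of a vertex set which only one edge leaves does not vanish. -/
theorem exists_flow_ne_zero (hβ : IsBiresidueMatrix lam β) {p q : Fin m → Fin n}
    {C : Finset (Fin n)} {i j : Fin n} (hb : β i j ≠ 0) (hi : i ∈ C) (hj : j ∉ C)
    (hex : ∃ s, s(p s, q s) = s(i, j))
    (hC : ∀ s, s(p s, q s) = s(i, j) ∨ (p s ∈ C ↔ q s ∈ C)) :
    ∃ a ∈ C, flow β p q Finset.univ a ≠ 0 := by
  classical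
  -- Sum the flow over `C`. Edges that do not cross the boundary contribute zero, and each copy of
  -- `ij` contributes `1 / β i j` in either orientation, so nothing cancels.
  refine Finset.exists_ne_zero_of_sum_ne_zero ?_
  simp only [flow]
  rw [Finset.sum_comm]
  have key : ∀ s ∈ Finset.univ, ∑ v ∈ C, edgeVector β (p s) (q s) v =
      if s(p s, q s) = s(i, j) then 1 / β i j else 0 := by
    intro s _
    have h1 : ∑ v ∈ C, edgeVector β (p s) (q s) v =
        ((if p s ∈ C then 1 else 0) - (if q s ∈ C then 1 else 0)) / β (p s) (q s) := by
      rw [← sum_mul_edgeVector (fun v => if v ∈ C then 1 else 0)]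
      simp
    rw [h1]
    by_cases h : s(p s, q s) = s(i, j)
    · rw [if_pos h]
      rcases Sym2.eq_iff.mp h with ⟨h1, h2⟩ | ⟨h1, h2⟩
      · simp [h1, h2, hi, hj]
      · simp [h1, h2, hi, hj, hβ.apply_swap j i]
    · rw [if_neg h]
      simp [(hC s).resolve_left h]
  rw [Finset.sum_congr rfl key, ← Finset.sum_filter, Finset.sum_const, nsmul_eq_mul]
  obtain ⟨s, hs⟩ := hex
  have : (Finset.univ.filter fun s => s(p s, q s) = s(i, j)).card ≠ 0 :=
    Finset.card_ne_zero_of_mem (Finset.mem_filter.mpr ⟨Finset.mem_univ s, hs⟩)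
  exact mul_ne_zero (by exact_mod_cast this) (one_div_ne_zero hb)

/-- Two smoothable edges with a common vertex have positively proportional biresidues. -/
theorem smoothable_adjacent (hβ : IsBiresidueMatrix lam β) {i j k : Fin n} (hik : i ≠ k)
    {w w' : Fin n → ℤ} (h : IsSmoothableWeight β i j w) (h' : IsSmoothableWeight β j k w') :
    ∃ r : ℝ, 0 < r ∧ β i j = r * β j k := by
  have e1 := h.apply_eq hβ k
  have e2 := h'.apply_eq hβ i
  have n1 := h.nonneg hik.symm h'.1.symm
  have n2 := h'.nonneg h.1 hik
  have hij := h.2.2.2.1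
  have hjk := h'.2.2.2.1
  rw [eq_div_iff hij, hβ.apply_swap k i, hβ.apply_swap k j] at e1
  rw [eq_div_iff hjk] at e2
  -- Eliminating `β i k` from the two relations gives `(1 + w k) β_ij = (1 + w' i) β_jk`, and both
  -- factors are positive.
  have hpos1 : (0 : ℝ) < 1 + w k := by
    have : (0 : ℝ) ≤ w k := by exact_mod_cast n1
    linarith
  have hpos2 : (0 : ℝ) < 1 + w' i := by
    have : (0 : ℝ) ≤ w' i := by exact_mod_cast n2
    linarith
  refine ⟨(1 + w' i) / (1 + w k), by positivity, ?_⟩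
  have hne : (1 + (w k : ℂ)) ≠ 0 := by
    have := hpos1.ne'
    exact_mod_cast this
  push_cast
  field_simp
  linear_combination e1 - e2

/-- A vertex meets at most two smoothable edges. -/
theorem not_three_smoothable (hβ : IsBiresidueMatrix lam β) {j i k l : Fin n} (hik : i ≠ k)
    (hil : i ≠ l) (hkl : k ≠ l) (hi : IsSmoothableEdge β i j) (hk : IsSmoothableEdge β k j)
    (hl : IsSmoothableEdge β l j) : False := by
  obtain ⟨w1, h1⟩ := hi
  obtain ⟨w2, h2⟩ := hk
  obtain ⟨w3, h3⟩ := hl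
  obtain ⟨r, hr, e1⟩ := smoothable_adjacent hβ hik h1 (h2.symm hβ)
  obtain ⟨r', hr', e2⟩ := smoothable_adjacent hβ hkl h2 (h3.symm hβ)
  obtain ⟨r'', hr'', e3⟩ := smoothable_adjacent hβ hil.symm h3 (h1.symm hβ)
  -- Going around the three edges changes the sign three times: `β_ij = -(r r' r'') β_ij` with `r r'
  -- r'' > 0`.
  rw [hβ.apply_swap j] at e1 e2 e3
  have h0 := h1.2.2.2.1
  have : β i j * ((r * r' * r'' : ℝ) + 1 : ℂ) = 0 := by
    push_cast
    linear_combination e1 - r * e2 + r * r' * e3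
  rcases mul_eq_zero.mp this with h | h
  · exact h0 h
  · have h' : (r * r' * r'' + 1 : ℝ) = 0 := by exact_mod_cast h
    have : 0 < r * r' * r'' := by positivity
    linarith

/-- If the flow of the edges meeting `C` is concentrated at `a ∈ C` and the gate `j`, then the
weight of these edges has the same entry at `a` and at `j`. -/
theorem weight_eq_of_flow (hβ : IsBiresidueMatrix lam β) {p q : Fin m → Fin n}
    {θ : Fin m → Fin n → ℤ} (hθ : ∀ s, IsSmoothableWeight β (p s) (q s) (θ s))
    {A : Finset (Fin m)} {a j : Fin n} (haj : a ≠ j)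
    (hflow : ∀ v, v ≠ a → v ≠ j → flow β p q A v = 0) :
    (∑ s ∈ A, θ s) a = (∑ s ∈ A, θ s) j := by
  have hsum : ∀ f : Fin n → ℂ, ∑ v, f v * flow β p q A v =
      f a * flow β p q A a + f j * flow β p q A j := by
    intro f
    rw [← Finset.sum_subset (Finset.subset_univ {a, j}), Finset.sum_pair haj]
    intro v _ hv
    simp only [Finset.mem_insert, Finset.mem_singleton, not_or] at hv
    rw [hflow v hv.1 hv.2, mul_zero]
  -- The total flow is zero, so the flows at `a` and at `j` are opposite; as `β` is skew, `β_aj`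
  -- times the flow at `j` equals `β_ja` times the flow at `a`.
  have h0 := hsum fun _ => 1
  simp only [one_mul, sum_flow] at h0
  have : (((∑ s ∈ A, θ s) a : ℤ) : ℂ) = ((∑ s ∈ A, θ s) j : ℤ) := by
    rw [mulVec_flow hβ hθ, mulVec_flow hβ hθ, hsum, hsum, hβ.apply_self, hβ.apply_self,
      hβ.apply_swap j a]
    linear_combination (-β a j) * h0
  exact_mod_cast this

/-- The flow cannot vanish, because the degree functional takes the value `|D|` on the corresponding
weight. It cannot sit at a single vertex, because its total is zero. -/
theorem exists_two_flow_ne_zero (hβ : IsBiresidueMatrix lam β) (hG : G.IsAcyclic)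
    {p q : Fin m → Fin n} {θ : Fin m → Fin n → ℤ} (hadj : ∀ s, G.Adj (p s) (q s))
    (hb : ∀ i j, G.Adj i j → β i j ≠ 0)
    (hθ : ∀ s, IsSmoothableWeight β (p s) (q s) (θ s)) {D : Finset (Fin m)} (hD : D.Nonempty) :
    ∃ v w, v ≠ w ∧ flow β p q D v ≠ 0 ∧ flow β p q D w ≠ 0 := by
  have h1 : ∃ v, flow β p q D v ≠ 0 := by
    by_contra! h
    obtain ⟨τ, hτ⟩ := exists_dual_smoothableWeight hβ hG hb fun _ => 1
    have hW : ∀ k, (((∑ s ∈ D, θ s) k : ℤ) : ℂ) = 0 := by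
      intro k
      rw [mulVec_flow hβ hθ]
      simp [h]
    have : ∑ a, τ a * (((∑ s ∈ D, θ s) a : ℤ) : ℂ) = D.card := by
      simp only [Finset.sum_apply, Int.cast_sum, Finset.mul_sum]
      rw [Finset.sum_comm, Finset.sum_congr rfl fun s _ => hτ _ _ _ (hadj s) (hθ s)]
      simp
    simp only [hW, mul_zero, Finset.sum_const_zero] at this
    exact hD.card_pos.ne' (by exact_mod_cast this.symm)
  obtain ⟨v, hv⟩ := h1
  by_contra! h
  have h2 : ∑ w, flow β p q D w = flow β p q D v := by
    refine Finset.sum_eq_single v (fun w _ hw => ?_) (by simp)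
    exact h v w hw.symm hv
  rw [sum_flow] at h2
  exact hv h2.symm

end Vanishing

/-! ### Acyclicity in orders at least two -/

section Vanishing

variable {n m : ℕ} {lam β : Matrix (Fin n) (Fin n) ℂ} {G : SimpleGraph (Fin n)}

/-- The edges in use form a forest with vertex degrees at most two, and every leaf carries flow,
hence has entry `-1`. If all edges are disjoint or equal, the bound three leaves only one edge,
repeated `m` times, whose endpoints have entry `-m`. Otherwise cut at a vertex `j` of degree two.
Each of the two branches contains exactly one vertex with flow, and there are no further edges. In
the weight of a branch this vertex has the same entry as `j`, so each branch contributes at most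
`-1` at `j`, and the entry at `j` is at most `-2`. -/
theorem smoothable_sum_flow_false (hβ : IsBiresidueMatrix lam β) (hG : G.IsAcyclic)
    (hsm : ∀ i j, G.Adj i j → IsSmoothableEdge β i j) (hm : 2 ≤ m)
    {p q : Fin m → Fin n} {θ : Fin m → Fin n → ℤ} (hadj : ∀ s, G.Adj (p s) (q s))
    (hθ : ∀ s, IsSmoothableWeight β (p s) (q s) (θ s))
    (hge : ∀ a, -1 ≤ (∑ s, θ s) a)
    (hcard : (Finset.univ.filter fun a => (∑ s, θ s) a = -1).card ≤ 3)
    (hu : ∀ v, flow β p q Finset.univ v ≠ 0 → (∑ s, θ s) v = -1) : False := by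
  classical
  set S := Finset.univ.filter fun a => (∑ s, θ s) a = -1 with hS
  have hbG : ∀ i j, G.Adj i j → β i j ≠ 0 := fun i j h => by
    obtain ⟨w, hw⟩ := hsm i j h
    exact hw.2.2.2.1
  have huS : ∀ v, flow β p q Finset.univ v ≠ 0 → v ∈ S := fun v hv =>
    Finset.mem_filter.mpr ⟨Finset.mem_univ v, hu v hv⟩
  -- All counting below runs through this: four distinct vertices with entry `-1` are too many.
  have hfour : ∀ a b c d : Fin n, a ∈ S → b ∈ S → c ∈ S → d ∈ S → a ≠ b → a ≠ c → a ≠ d →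
      b ≠ c → b ≠ d → c ≠ d → False := by
    intro a b c d ha hb hc hd h1 h2 h3 h4 h5 h6
    have hsub : ({a, b, c, d} : Finset (Fin n)) ⊆ S := by
      intro x hx
      simp only [Finset.mem_insert, Finset.mem_singleton] at hx
      rcases hx with rfl | rfl | rfl | rfl <;> assumption
    have hc4 : ({a, b, c, d} : Finset (Fin n)).card = 4 := by
      rw [Finset.card_insert_of_notMem (by simp [h1, h2, h3]),
        Finset.card_insert_of_notMem (by simp [h4, h5]), Finset.card_pair h6]
    have := Finset.card_le_card hsub
    omega
  -- the graph of the edges in use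
  let F : SimpleGraph (Fin n) :=
    { Adj := fun v l => ∃ s, s(p s, q s) = s(v, l)
      symm := ⟨fun v l ⟨s, hs⟩ => ⟨s, hs.trans Sym2.eq_swap⟩⟩
      loopless := ⟨fun v ⟨s, hs⟩ => (hadj s).ne (by
        rcases Sym2.eq_iff.mp hs with ⟨h1, h2⟩ | ⟨h1, h2⟩ <;> exact h1.trans h2.symm)⟩ }
  have hFG : F ≤ G := by
    rintro v l ⟨s, hs⟩
    have := hadj s
    rwa [← SimpleGraph.mem_edgeSet, hs] at this
  have hF : F.IsAcyclic := hG.anti hFG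
  have hpq : ∀ s, F.Adj (p s) (q s) := fun s => ⟨s, rfl⟩
  have hthree : ∀ {j i k l}, F.Adj j i → F.Adj j k → i ≠ k → F.Adj j l → l = i ∨ l = k := by
    intro j i k l hi hk hik hl
    by_contra! h
    exact not_three_smoothable hβ hik h.1.symm h.2.symm (hsm _ _ (hFG hi.symm))
      (hsm _ _ (hFG hk.symm)) (hsm _ _ (hFG hl.symm))
  -- All edges at a leaf are copies of one edge, so their contributions are equal and do not cancel.
  have hleaf : ∀ {v l}, F.Adj v l → (∀ l', F.Adj v l' → l' = l) →
      flow β p q Finset.univ v ≠ 0 := by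
    intro v l hvl h
    obtain ⟨a, ha, ha'⟩ := exists_flow_ne_zero hβ (C := {v}) (hbG v l (hFG hvl))
      (Finset.mem_singleton_self v) (by simpa using hvl.ne.symm) hvl (fun s => by
        by_cases h1 : p s = v
        · left; rw [← h _ (h1 ▸ hpq s), h1]
        · by_cases h2 : q s = v
          · left; rw [← h _ (h2 ▸ (hpq s).symm), h2, Sym2.eq_swap]
          · right; simp [h1, h2])
    rwa [Finset.mem_singleton.mp ha] at ha'
  have hpos : ∀ (A : Finset (Fin m)) v, (∀ s ∈ A, v ≠ p s ∧ v ≠ q s) → 0 ≤ (∑ s ∈ A, θ s) v := by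
    intro A v h
    rw [Finset.sum_apply]
    exact Finset.sum_nonneg fun s hs => (hθ s).nonneg (h s hs).1 (h s hs).2
  by_cases hdeg : ∃ j i k, F.Adj j i ∧ F.Adj j k ∧ i ≠ k
  swap
  · -- the edges in use are pairwise equal or disjoint
    have hdeg' : ∀ {j i k}, F.Adj j i → F.Adj j k → i = k := by
      intro j i k hi hk
      by_contra hne
      exact hdeg ⟨j, i, k, hi, hk, hne⟩
    have hpS : ∀ s, p s ∈ S := fun s => huS _ (hleaf (hpq s) fun l' h => hdeg' h (hpq s))
    have hqS : ∀ s, q s ∈ S := fun s =>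
      huS _ (hleaf (hpq s).symm fun l' h => hdeg' h (hpq s).symm)
    let s0 : Fin m := ⟨0, by omega⟩
    have hall : ∀ s, p s0 = p s ∨ p s0 = q s := by
      intro s
      by_contra! h
      refine hfour (p s0) (q s0) (p s) (q s) (hpS _) (hqS _) (hpS _) (hqS _) (hpq s0).ne h.1 h.2
        (fun h' => ?_) (fun h' => ?_) (hpq s).ne
      · exact h.2 (hdeg' (hpq s0).symm (h' ▸ hpq s))
      · exact h.1 (hdeg' (hpq s0).symm (h' ▸ (hpq s).symm))
    have hval : (∑ s, θ s) (p s0) = -m := by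
      rw [Finset.sum_apply, Finset.sum_congr rfl (g := fun _ => (-1 : ℤ))]
      · simp
      · intro s _
        rcases hall s with h | h
        · rw [h]; exact (hθ s).2.1
        · rw [h]; exact (hθ s).2.2.1
    have := hge (p s0)
    omega
  · -- choose a vertex on two edges, in `S` if possible
    obtain ⟨j, i, k, hi, hk, hik, hjS⟩ : ∃ j i k, F.Adj j i ∧ F.Adj j k ∧ i ≠ k ∧
        (j ∈ S ∨ ∀ j' ∈ S, ∀ i' k', F.Adj j' i' → F.Adj j' k' → i' = k') := by
      by_cases h : ∃ j ∈ S, ∃ i k, F.Adj j i ∧ F.Adj j k ∧ i ≠ k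
      · obtain ⟨j, hj, i, k, h1, h2, h3⟩ := h
        exact ⟨j, i, k, h1, h2, h3, Or.inl hj⟩
      · obtain ⟨j, i, k, h1, h2, h3⟩ := hdeg
        refine ⟨j, i, k, h1, h2, h3, Or.inr fun j' hj' i' k' hi' hk' => ?_⟩
        by_contra hne
        exact h ⟨j', hj', i', k', hi', hk', hne⟩
    let C : Fin n → Finset (Fin n) := fun i =>
      Finset.univ.filter fun v => v ∈ reachSet (isolate F j) i
    have hCmem : ∀ i v, v ∈ C i ↔ v ∈ reachSet (isolate F j) i := by intro i v; simp [C]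
    have hself : ∀ i, i ∈ C i := fun i => (hCmem i i).mpr (SimpleGraph.Reachable.refl i)
    have hjC : ∀ {i}, F.Adj j i → j ∉ C i := fun {i} h => by
      rw [hCmem]; exact notMem_reachSet_isolate F h.ne.symm
    have hout : ∀ {i}, F.Adj j i → ∀ v ∈ C i, ∀ l, F.Adj v l → l ∈ C i ∨ (v = i ∧ l = j) := by
      intro i hi v hv l hvl
      rw [hCmem] at hv ⊢
      exact mem_reachSet_isolate_or hF hi hv hvl
    have hdisj : ∀ {i k}, F.Adj j i → F.Adj j k → i ≠ k → ∀ v ∈ C i, v ∉ C k := by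
      intro i k hi hk hik v hv hv'
      rw [hCmem] at hv hv'
      exact notMem_reachSet_isolate_of_adj hF hi hk hik
        (SimpleGraph.Reachable.trans hv (SimpleGraph.Reachable.symm hv'))
    have hex : ∀ {i}, F.Adj j i → ∃ a ∈ C i, flow β p q Finset.univ a ≠ 0 := by
      intro i hi
      refine exists_flow_ne_zero hβ (hbG i j (hFG hi.symm)) (hself i) (hjC hi) hi.symm fun s => ?_
      by_cases h : s(p s, q s) = s(i, j)
      · exact Or.inl h
      · right
        constructor
        · intro h1
          rcases hout hi _ h1 _ (hpq s) with h2 | ⟨h2, h3⟩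
          · exact h2
          · exact absurd (by rw [h2, h3]) h
        · intro h1
          rcases hout hi _ h1 _ (hpq s).symm with h2 | ⟨h2, h3⟩
          · exact h2
          · exact absurd (by rw [h2, h3, Sym2.eq_swap]) h
    -- Two flow vertices in this branch and one in the other are already three elements of `S`. If
    -- `j ∈ S`, it is a fourth. If not, `S` contains no vertex of degree two, so the vertices of odd
    -- degree in this branch are exactly `a` and `a'`, whereas a branch with a single outgoing edge
    -- has an odd number of them.
    have huniq : ∀ {i k}, F.Adj j i → F.Adj j k → i ≠ k → ∀ a ∈ C i, ∀ a' ∈ C i,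
        flow β p q Finset.univ a ≠ 0 → flow β p q Finset.univ a' ≠ 0 → a = a' := by
      intro i k hi hk hik a ha a' ha' hua hua'
      by_contra hne
      obtain ⟨c, hc, huc⟩ := hex hk
      have hac : a ≠ c := fun h => hdisj hi hk hik a ha (h ▸ hc)
      have hac' : a' ≠ c := fun h => hdisj hi hk hik a' ha' (h ▸ hc)
      rcases hjS with hjS | hjS
      · exact hfour a a' c j (huS _ hua) (huS _ hua') (huS _ huc) hjS hne hac
          (fun h => hjC hi (h ▸ ha)) hac' (fun h => hjC hi (h ▸ ha')) (fun h => hjC hk (h ▸ hc))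
      · have hodd := odd_card_filter_odd_degree F (C i) (hself i) (hjC hi) hi.symm (hout hi)
        have heq : ((C i).filter fun v => Odd (F.degree v)) = {a, a'} := by
          ext v
          simp only [Finset.mem_filter, Finset.mem_insert, Finset.mem_singleton]
          have hleafdeg : ∀ v, flow β p q Finset.univ v ≠ 0 → F.degree v = 1 := by
            intro v hv
            have hnb : ∃ l, F.Adj v l := by
              by_contra! h
              refine hv (flow_eq_zero fun s _ => ⟨fun h' => ?_, fun h' => ?_⟩)
              · exact h _ (h' ▸ hpq s)
              · exact h _ (h' ▸ (hpq s).symm)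
            obtain ⟨l, hl⟩ := hnb
            rw [← SimpleGraph.card_neighborFinset_eq_degree, Finset.card_eq_one]
            refine ⟨l, ?_⟩
            ext l'
            simp only [SimpleGraph.mem_neighborFinset, Finset.mem_singleton]
            exact ⟨fun h => hjS v (huS v hv) _ _ h hl, fun h => h ▸ hl⟩
          constructor
          · rintro ⟨hv, hvo⟩
            have hnb : ∃ l, F.Adj v l := by
              have : 0 < F.degree v := hvo.pos
              rwa [SimpleGraph.degree_pos_iff_exists_adj] at this
            obtain ⟨l, hl⟩ := hnb
            have huv : flow β p q Finset.univ v ≠ 0 := by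
              refine hleaf hl fun l' hl' => ?_
              by_contra hne'
              have hd2 : F.degree v = 2 := by
                rw [← SimpleGraph.card_neighborFinset_eq_degree, Finset.card_eq_two]
                refine ⟨l, l', Ne.symm hne', ?_⟩
                ext x
                simp only [SimpleGraph.mem_neighborFinset, Finset.mem_insert,
                  Finset.mem_singleton]
                refine ⟨fun h => hthree hl hl' (Ne.symm hne') h, ?_⟩
                rintro (rfl | rfl) <;> assumption
              rw [hd2] at hvo
              exact absurd hvo (by decide)
            by_contra! h
            exact hfour a a' c v (huS _ hua) (huS _ hua') (huS _ huc) (huS _ huv) hne hac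
              h.1.symm hac' h.2.symm (fun h' => hdisj hi hk hik v hv (h' ▸ hc))
          · rintro (rfl | rfl)
            · exact ⟨ha, by rw [hleafdeg _ hua]; decide⟩
            · exact ⟨ha', by rw [hleafdeg _ hua']; decide⟩
        rw [heq, Finset.card_pair hne] at hodd
        exact absurd hodd (by decide)
    obtain ⟨a, ha, hua⟩ := hex hi
    obtain ⟨c, hc, huc⟩ := hex hk
    have hac : a ≠ c := fun h => hdisj hi hk hik a ha (h ▸ hc)
    let A : Fin n → Finset (Fin m) := fun i => Finset.univ.filter fun s => p s ∈ C i ∨ q s ∈ C i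
    have hA : ∀ i s, s ∈ A i ↔ p s ∈ C i ∨ q s ∈ C i := by intro i s; simp [A]
    have hAdisj : Disjoint (A i) (A k) := by
      rw [Finset.disjoint_left]
      intro s hs hs'
      rw [hA] at hs hs'
      rcases hs with hs | hs <;> rcases hs' with hs' | hs'
      · exact hdisj hi hk hik _ hs hs'
      · rcases hout hi _ hs _ (hpq s) with h | h
        · exact hdisj hi hk hik _ h hs'
        · exact hjC hk (h.2 ▸ hs')
      · rcases hout hi _ hs _ (hpq s).symm with h | h
        · exact hdisj hi hk hik _ h hs'
        · exact hjC hk (h.2 ▸ hs')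
      · exact hdisj hi hk hik _ hs hs'
    have hAin : ∀ {i}, F.Adj j i → ∀ v, v ∉ C i → v ≠ j → flow β p q (A i) v = 0 := by
      intro i hi v hv hvj
      refine flow_eq_zero fun s hs => ?_
      rw [hA] at hs
      rcases hs with hs | hs
      · refine ⟨fun h => hv (h ▸ hs), fun h => ?_⟩
        rcases hout hi _ hs _ (hpq s) with h' | h'
        · exact hv (h ▸ h')
        · exact hvj (h.trans h'.2)
      · refine ⟨fun h => ?_, fun h => hv (h ▸ hs)⟩
        rcases hout hi _ hs _ (hpq s).symm with h' | h'
        · exact hv (h ▸ h')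
        · exact hvj (h.trans h'.2)
    have hAout : ∀ {i}, ∀ v ∈ C i, flow β p q (A i) v = flow β p q Finset.univ v := by
      intro i v hv
      refine Finset.sum_subset (Finset.subset_univ _) fun s _ hs => ?_
      rw [hA, not_or] at hs
      exact edgeVector_eq_zero (fun h => hs.1 (h ▸ hv)) (fun h => hs.2 (h ▸ hv))
    -- no further edges
    have hcover : ∀ s, s ∈ A i ∪ A k := by
      by_contra! hD
      have hDne : (Finset.univ \ (A i ∪ A k)).Nonempty := by
        obtain ⟨s, hs⟩ := hD
        exact ⟨s, by simpa using hs⟩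
      -- The remaining edges avoid both branches and `j`, so their two flow vertices keep their flow
      -- in the total and, with `a` and `c`, make four elements of `S`.
      obtain ⟨v, w, hvw, hv, hw⟩ := exists_two_flow_ne_zero hβ hG hadj hbG hθ hDne
      have hDprop : ∀ s ∈ Finset.univ \ (A i ∪ A k), p s ∉ C i ∧ q s ∉ C i ∧ p s ∉ C k ∧
          q s ∉ C k ∧ p s ≠ j ∧ q s ≠ j := by
        intro s hs
        simp only [Finset.mem_sdiff, Finset.mem_univ, true_and, Finset.mem_union, hA,
          not_or] at hs
        obtain ⟨⟨h1, h2⟩, h3, h4⟩ := hs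
        refine ⟨h1, h2, h3, h4, fun h => ?_, fun h => ?_⟩
        · rcases hthree hi hk hik (h ▸ hpq s) with h' | h'
          · exact h2 (h' ▸ hself _)
          · exact h4 (h' ▸ hself _)
        · rcases hthree hi hk hik (h ▸ (hpq s).symm) with h' | h'
          · exact h1 (h' ▸ hself _)
          · exact h3 (h' ▸ hself _)
      have hDv : ∀ v, flow β p q (Finset.univ \ (A i ∪ A k)) v ≠ 0 →
          v ∉ C i ∧ v ∉ C k ∧ v ∈ S := by
        intro v hv
        have hvi : v ∉ C i := fun h => hv (flow_eq_zero fun s hs => by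
          have := hDprop s hs
          exact ⟨fun h' => this.1 (h' ▸ h), fun h' => this.2.1 (h' ▸ h)⟩)
        have hvk : v ∉ C k := fun h => hv (flow_eq_zero fun s hs => by
          have := hDprop s hs
          exact ⟨fun h' => this.2.2.1 (h' ▸ h), fun h' => this.2.2.2.1 (h' ▸ h)⟩)
        have hvj : v ≠ j := fun h => hv (flow_eq_zero fun s hs => by
          have := hDprop s hs
          exact ⟨fun h' => this.2.2.2.2.1 (h'.symm.trans h),
            fun h' => this.2.2.2.2.2 (h'.symm.trans h)⟩)
        refine ⟨hvi, hvk, huS v ?_⟩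
        have hsplit : flow β p q Finset.univ v = flow β p q (Finset.univ \ (A i ∪ A k)) v +
            (flow β p q (A i) v + flow β p q (A k) v) := by
          simp only [flow]
          rw [← Finset.sum_union hAdisj, Finset.sum_sdiff (Finset.subset_univ _)]
        rw [hsplit, hAin hi v hvi hvj, hAin hk v hvk hvj, add_zero, add_zero]
        exact hv
      obtain ⟨hv1, hv2, hv3⟩ := hDv v hv
      obtain ⟨hw1, hw2, hw3⟩ := hDv w hw
      exact hfour a c v w (huS _ hua) (huS _ huc) hv3 hw3 hac (fun h => hv1 (h ▸ ha))
        (fun h => hw1 (h ▸ ha)) (fun h => hv2 (h ▸ hc)) (fun h => hw2 (h ▸ hc)) hvw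
    have hsplit : ∀ v, (∑ s, θ s) v = (∑ s ∈ A i, θ s) v + (∑ s ∈ A k, θ s) v := by
      intro v
      rw [← Pi.add_apply, ← Finset.sum_union hAdisj,
        Finset.eq_univ_iff_forall.mpr hcover]
    have hside : ∀ {i k}, F.Adj j i → F.Adj j k → i ≠ k → ∀ a ∈ C i,
        flow β p q Finset.univ a ≠ 0 → (∑ s ∈ A i, θ s) a = (∑ s ∈ A i, θ s) j := by
      intro i k hi hk hik a ha hua
      refine weight_eq_of_flow hβ hθ (fun h => hjC hi (h ▸ ha)) fun v hva hvj => ?_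
      by_cases hv : v ∈ C i
      · rw [hAout v hv]
        by_contra h
        exact hva (huniq hi hk hik v hv a ha h hua)
      · exact hAin hi v hv hvj
    have hnon : ∀ {i k}, F.Adj j i → F.Adj j k → i ≠ k → ∀ a ∈ C i,
        0 ≤ (∑ s ∈ A k, θ s) a := by
      intro i k hi hk hik a ha
      refine hpos _ _ fun s hs => ?_
      rw [hA] at hs
      have haj : a ≠ j := fun h => hjC hi (h ▸ ha)
      have hak := hdisj hi hk hik a ha
      rcases hs with hs | hs
      · refine ⟨fun h => hak (h ▸ hs), fun h => ?_⟩
        rcases hout hk _ hs _ (hpq s) with h' | h'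
        · exact hak (h ▸ h')
        · exact haj (h.trans h'.2)
      · refine ⟨fun h => ?_, fun h => hak (h ▸ hs)⟩
        rcases hout hk _ hs _ (hpq s).symm with h' | h'
        · exact hak (h ▸ h')
        · exact haj (h.trans h'.2)
    -- At `a` the total is `-1` and the other branch contributes at least `0`, so the branch of `i`
    -- contributes at most `-1` at `a`, hence also at `j`. The same holds for `c` and `k`, against
    -- an entry at least `-1` at `j`.
    have e1 := hside hi hk hik a ha hua
    have e2 := hside hk hi hik.symm c hc huc
    have e3 := hnon hi hk hik a ha
    have e4 := hnon hk hi hik.symm c hc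
    have e5 := hu a hua
    have e6 := hu c huc
    have e7 := hge j
    rw [hsplit] at e5 e6 e7
    omega

/-- For `m ≥ 2` the toric differential is acyclic on the bivectors and trivectors whose weight
lies in `Θ_m`. -/
theorem exists_mulVec_ne_zero_of_mem_Theta (hβ : IsBiresidueMatrix lam β) (hG : G.IsAcyclic)
    (hsm : ∀ i j, G.Adj i j → IsSmoothableEdge β i j) (hm : 2 ≤ m) {W : Fin n → ℤ}
    (hW : W ∈ Theta β G m) (hge : ∀ a, -1 ≤ W a)
    (hcard : (Finset.univ.filter fun a => W a = -1).card ≤ 3) :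
    ∃ k, W k ≠ -1 ∧ lam.mulVec (fun a => (W a : ℂ)) k ≠ 0 := by
  obtain ⟨θ, h, rfl⟩ := hW
  choose p q hadj hθ using h
  by_contra! hcon
  refine smoothable_sum_flow_false hβ hG hsm hm hadj hθ hge hcard fun v hv => ?_
  by_contra h
  refine hv ?_
  have h1 := hcon v h
  rw [← congrFun (flow_eq_mulVec hβ hθ Finset.univ) v]
  exact h1

end Vanishing

/-! ### The weight filtration of the polynomial ring -/

/-- Pairwise disjoint sets of weights of total degree zero, compatible with addition. -/
structure OrderedWeights (n : ℕ) where
  carrier : ℕ → Set (Fin n → ℤ)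
  zero_mem : 0 ∈ carrier 0
  add_mem : ∀ {p q v w}, v ∈ carrier p → w ∈ carrier q → v + w ∈ carrier (p + q)
  sum_eq_zero : ∀ {m w}, w ∈ carrier m → ∑ k, w k = 0
  disjoint : ∀ {m m' w}, w ∈ carrier m → w ∈ carrier m' → m = m'

/-! ### Exponents and coefficients at integral weights -/

section Exponents

open MvPolynomial

variable {n : ℕ} {R : Type*} [CommRing R]

/-- The exponent vector of a monomial as an integral weight. -/
def expo (s : Fin n →₀ ℕ) : Fin n → ℤ := fun i => s i

theorem expo_add (s t : Fin n →₀ ℕ) : expo (s + t) = expo s + expo t := by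
  ext i; simp [expo]

theorem expo_single (a : Fin n) : expo (Finsupp.single a 1) = unitWeight a := by
  ext i; simp [expo, unitWeight, Finsupp.single_apply, Pi.single_apply, eq_comm]

theorem expo_zero : expo (0 : Fin n →₀ ℕ) = 0 := by
  ext i; simp [expo]

theorem expo_injective : Function.Injective (expo (n := n)) := by
  intro s t h
  ext i
  have := congrFun h i
  simpa [expo] using this

theorem unitWeight_nonneg (a : Fin n) : 0 ≤ unitWeight a := by
  intro i
  simp only [unitWeight, Pi.single_apply, Pi.zero_apply]
  split_ifs <;> simp

theorem sum_unitWeight (a : Fin n) : ∑ i, unitWeight a i = 1 := by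
  simp [unitWeight]

theorem abs_le_of_sum_le {s u : Fin n → ℤ} {b : ℤ} (hs : 0 ≤ s) (hu : 0 ≤ u)
    (hsb : ∑ i, s i ≤ b) (hub : ∑ i, u i ≤ b) (i : Fin n) : |s i - u i| ≤ b := by
  have h1 : s i ≤ b := (Finset.single_le_sum (fun i _ => hs i) (Finset.mem_univ i)).trans hsb
  have h2 : u i ≤ b := (Finset.single_le_sum (fun i _ => hu i) (Finset.mem_univ i)).trans hub
  have h3 : 0 ≤ s i := hs i
  have h4 : 0 ≤ u i := hu i
  rw [abs_le]
  constructor <;> linarith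

/-- A polynomial ring derivation is determined by its values on the variables. -/
theorem derivation_eq_sum (D : Derivation R (MvPolynomial (Fin n) R) (MvPolynomial (Fin n) R))
    (f : MvPolynomial (Fin n) R) : D f = ∑ e, pderiv e f * D (X e) := by
  classical
  have happ : ∀ g, (∑ e, D (X e) • pderiv e : Derivation R (MvPolynomial (Fin n) R) (MvPolynomial (Fin n) R)) g =
      ∑ e, pderiv e g * D (X e) := by
    intro g
    have := congrFun (map_sum (Derivation.coeFnAddMonoidHom (R := R) (A := MvPolynomial (Fin n) R)
      (M := MvPolynomial (Fin n) R))
      (fun e => (D (X e) • pderiv e : Derivation R (MvPolynomial (Fin n) R) (MvPolynomial (Fin n) R))) Finset.univ) g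
    rw [Finset.sum_apply] at this
    refine this.trans (Finset.sum_congr rfl fun e _ => ?_)
    exact mul_comm _ _
  have h : D = ∑ e, D (X e) • pderiv e := by
    refine MvPolynomial.derivation_ext fun i => ?_
    rw [happ]
    simp [pderiv_X, Pi.single_apply]
  conv_lhs => rw [h]
  exact happ f

/-- The nonnegative part of an integral weight as an exponent vector. -/
noncomputable def toExpo (w : Fin n → ℤ) : Fin n →₀ ℕ := Finsupp.equivFunOnFinite.symm fun i => (w i).toNat

theorem expo_toExpo {w : Fin n → ℤ} (h : 0 ≤ w) : expo (toExpo w) = w := by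
  ext i
  simpa [expo, toExpo] using h i

theorem toExpo_expo (s : Fin n →₀ ℕ) : toExpo (expo s) = s := by
  ext i; simp [toExpo, expo]

theorem expo_nonneg (s : Fin n →₀ ℕ) : 0 ≤ expo s := fun i => by simp [expo]

open Classical in
/-- The coefficient at an integral weight, zero unless the weight is nonnegative. -/
noncomputable def zcoeff (w : Fin n → ℤ) : MvPolynomial (Fin n) R →ₗ[R] R :=
  if 0 ≤ w then lcoeff R (toExpo w) else 0

theorem zcoeff_expo (s : Fin n →₀ ℕ) (f : MvPolynomial (Fin n) R) :
    zcoeff (expo s) f = coeff s f := by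
  rw [zcoeff, if_pos (expo_nonneg s), toExpo_expo]; rfl

theorem zcoeff_of_not_nonneg {w : Fin n → ℤ} (h : ¬ 0 ≤ w) (f : MvPolynomial (Fin n) R) :
    zcoeff w f = 0 := by
  rw [zcoeff, if_neg h]; rfl

theorem nonneg_of_zcoeff_ne_zero {w : Fin n → ℤ} {f : MvPolynomial (Fin n) R}
    (h : zcoeff w f ≠ 0) : 0 ≤ w := by
  by_contra hw
  exact h (zcoeff_of_not_nonneg hw f)

/-- Allowing negative entries makes this shift valid without a divisibility condition: both sides
vanish when `w - unitWeight a` has a negative entry. -/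
theorem zcoeff_X_mul (w : Fin n → ℤ) (a : Fin n) (f : MvPolynomial (Fin n) R) :
    zcoeff w (X a * f) = zcoeff (w - unitWeight a) f := by
  classical
  by_cases h : 0 ≤ w - unitWeight a
  · have h2 : w = expo (toExpo (w - unitWeight a) + Finsupp.single a 1) := by
      rw [expo_add, expo_toExpo h, expo_single, sub_add_cancel]
    rw [← expo_toExpo h, zcoeff_expo]
    conv_lhs => rw [h2]
    rw [zcoeff_expo, add_comm, coeff_X_mul]
  · rw [zcoeff_of_not_nonneg h]
    by_cases h' : 0 ≤ w
    · rw [← expo_toExpo h', zcoeff_expo, coeff_X_mul', if_neg]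
      intro hs
      refine h fun i => ?_
      have h1 : 0 ≤ w i := h' i
      simp only [Pi.sub_apply, Pi.zero_apply, unitWeight, Pi.single_apply]
      split_ifs with hi
      · subst hi
        rw [Finsupp.mem_support_iff] at hs
        simp only [toExpo, Finsupp.equivFunOnFinite_symm_apply_apply, ne_eq] at hs
        omega
      · simpa using h1
    · rw [zcoeff_of_not_nonneg h']

/-- Euler fields are diagonal on monomials. At the boundary `w a = 0` the derivative has no term to
contribute, and the factor `w a` accounts for it. -/
theorem zcoeff_X_mul_pderiv (w : Fin n → ℤ) (a : Fin n) (f : MvPolynomial (Fin n) R) :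
    zcoeff w (X a * pderiv a f) = (w a : R) * zcoeff w f := by
  classical
  rw [zcoeff_X_mul]
  by_cases h : 0 ≤ w - unitWeight a
  · have h2 : w = expo (toExpo (w - unitWeight a) + Finsupp.single a 1) := by
      rw [expo_add, expo_toExpo h, expo_single, sub_add_cancel]
    have h3 : w a = (toExpo (w - unitWeight a)) a + 1 := by
      conv_lhs => rw [h2]
      simp [expo]
    have h4 : zcoeff w f = coeff (toExpo (w - unitWeight a) + Finsupp.single a 1) f := by
      conv_lhs => rw [h2]
      rw [zcoeff_expo]
    rw [h4, h3, ← expo_toExpo h, zcoeff_expo, coeff_pderiv, toExpo_expo]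
    push_cast
    ring
  · rw [zcoeff_of_not_nonneg h]
    by_cases h' : 0 ≤ w
    · have h0 : w a = 0 := by
        by_contra hne
        refine h fun i => ?_
        have h1 : 0 ≤ w i := h' i
        simp only [Pi.sub_apply, Pi.zero_apply, unitWeight, Pi.single_apply]
        split_ifs with hi
        · subst hi; omega
        · simpa using h1
      simp [h0]
    · rw [zcoeff_of_not_nonneg h', mul_zero]

end Exponents

/-! ### The filtration by order, with a parameter `ε` -/

section Filtration

open MvPolynomial

variable {n : ℕ} {R : Type*} [CommRing R] [Algebra ℂ R] (T : OrderedWeights n) (ε : R)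

/-- The span of the powers `ε^m`, `m ≥ p`, such that `w` has order `m`. -/
def epsSpan (p : ℕ) (w : Fin n → ℤ) : Submodule ℂ R :=
  Submodule.span ℂ {r | ∃ m, p ≤ m ∧ w ∈ T.carrier m ∧ r = ε ^ m}

theorem epsSpan_mono {p q : ℕ} (h : p ≤ q) (w : Fin n → ℤ) : epsSpan T ε q w ≤ epsSpan T ε p w :=
  Submodule.span_mono fun _ ⟨m, h1, h2⟩ => ⟨m, h.trans h1, h2⟩

theorem pow_mem_epsSpan {p m : ℕ} {w : Fin n → ℤ} (h : p ≤ m) (hw : w ∈ T.carrier m) :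
    ε ^ m ∈ epsSpan T ε p w :=
  Submodule.subset_span ⟨m, h, hw, rfl⟩

theorem one_mem_epsSpan : (1 : R) ∈ epsSpan T ε 0 0 := by
  simpa using pow_mem_epsSpan T ε le_rfl T.zero_mem

variable {T ε}

theorem exists_of_mem_epsSpan {p : ℕ} {w : Fin n → ℤ} {r : R} (h : r ∈ epsSpan T ε p w)
    (hr : r ≠ 0) : ∃ m, p ≤ m ∧ w ∈ T.carrier m := by
  by_contra! hcon
  have : {r | ∃ m, p ≤ m ∧ w ∈ T.carrier m ∧ r = ε ^ m} = ∅ := by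
    ext r
    simp only [Set.mem_ofPred_eq, Set.mem_empty_iff_false, iff_false]
    rintro ⟨m, h1, h2, _⟩
    exact hcon m h1 h2
  rw [epsSpan, this, Submodule.span_empty] at h
  exact hr (by simpa using h)

theorem eq_zero_of_mem_epsSpan {p m : ℕ} {w : Fin n → ℤ} {r : R} (h : r ∈ epsSpan T ε p w)
    (hw : w ∈ T.carrier m) (hm : m < p) : r = 0 := by
  by_contra hr
  obtain ⟨m', h1, h2⟩ := exists_of_mem_epsSpan h hr
  have := T.disjoint hw h2
  omega

/-- The sets of weights are disjoint, so only one power of `ε` is available at a given weight. The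
order is read off from the weight and not from the power, which is why `ε = 1` is also allowed. -/
theorem exists_smul_of_mem_epsSpan {p m : ℕ} {w : Fin n → ℤ} {r : R} (h : r ∈ epsSpan T ε p w)
    (hw : w ∈ T.carrier m) : ∃ c : ℂ, r = c • ε ^ m := by
  have hle : epsSpan T ε p w ≤ Submodule.span ℂ {ε ^ m} := by
    refine Submodule.span_mono ?_
    rintro r ⟨m', _, h2, rfl⟩
    rw [T.disjoint hw h2]; rfl
  obtain ⟨c, hc⟩ := Submodule.mem_span_singleton.mp (hle h)
  exact ⟨c, hc.symm⟩

theorem mem_epsSpan_succ {p : ℕ} {w : Fin n → ℤ} {r : R} (h : r ∈ epsSpan T ε p w)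
    (h0 : w ∈ T.carrier p → r = 0) : r ∈ epsSpan T ε (p + 1) w := by
  by_cases hr : r = 0
  · rw [hr]; exact zero_mem _
  obtain ⟨m, h1, h2⟩ := exists_of_mem_epsSpan h hr
  obtain ⟨c, rfl⟩ := exists_smul_of_mem_epsSpan h h2
  refine Submodule.smul_mem _ _ (pow_mem_epsSpan T ε ?_ h2)
  rcases h1.lt_or_eq with h3 | h3
  · exact h3
  · exact absurd (h0 (h3 ▸ h2)) hr

theorem mul_mem_epsSpan {p q : ℕ} {v w : Fin n → ℤ} {r s : R} (hr : r ∈ epsSpan T ε p v)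
    (hs : s ∈ epsSpan T ε q w) : r * s ∈ epsSpan T ε (p + q) (v + w) := by
  by_cases hr0 : r = 0
  · rw [hr0, zero_mul]; exact zero_mem _
  by_cases hs0 : s = 0
  · rw [hs0, mul_zero]; exact zero_mem _
  obtain ⟨m, h1, h2⟩ := exists_of_mem_epsSpan hr hr0
  obtain ⟨m', h1', h2'⟩ := exists_of_mem_epsSpan hs hs0
  obtain ⟨c, rfl⟩ := exists_smul_of_mem_epsSpan hr h2
  obtain ⟨c', rfl⟩ := exists_smul_of_mem_epsSpan hs h2'
  rw [smul_mul_smul_comm, ← pow_add]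
  exact Submodule.smul_mem _ _ (pow_mem_epsSpan T ε (add_le_add h1 h1') (T.add_mem h2 h2'))

variable (T ε) in
/-- The polynomials whose coefficient at `x^s` is a combination of those `ε^m`, `m ≥ p`, such that
`s - u` has order `m`. -/
def filt (p : ℕ) (u : Fin n → ℤ) : Submodule ℂ (MvPolynomial (Fin n) R) where
  carrier := {f | ∀ s, coeff s f ∈ epsSpan T ε p (expo s - u)}
  zero_mem' s := by simp
  add_mem' hf hg s := by rw [coeff_add]; exact add_mem (hf s) (hg s)
  smul_mem' c f hf s := by rw [coeff_smul]; exact Submodule.smul_mem _ _ (hf s)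

theorem filt_mono {p q : ℕ} (h : p ≤ q) {u : Fin n → ℤ} : filt T ε q u ≤ filt T ε p u :=
  fun _ hf s => epsSpan_mono T ε h _ (hf s)

theorem mul_mem_filt {p q : ℕ} {u v : Fin n → ℤ} {f g : MvPolynomial (Fin n) R}
    (hf : f ∈ filt T ε p u) (hg : g ∈ filt T ε q v) : f * g ∈ filt T ε (p + q) (u + v) := by
  classical
  intro s
  rw [coeff_mul]
  refine Submodule.sum_mem _ fun x hx => ?_
  have : expo s - (u + v) = (expo x.1 - u) + (expo x.2 - v) := by
    rw [← Finset.HasAntidiagonal.mem_antidiagonal.mp hx, expo_add]; abel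
  rw [this]
  exact mul_mem_epsSpan (hf _) (hg _)

theorem mul_mem_filt' {p q r : ℕ} {u v w : Fin n → ℤ} {f g : MvPolynomial (Fin n) R}
    (hf : f ∈ filt T ε p u) (hg : g ∈ filt T ε q v) (hr : r = p + q) (hw : w = u + v) :
    f * g ∈ filt T ε r w := by
  subst hr hw
  exact mul_mem_filt hf hg

theorem monomial_mem_filt {p : ℕ} {u : Fin n → ℤ} {s : Fin n →₀ ℕ} {r : R}
    (h : r ∈ epsSpan T ε p (expo s - u)) : monomial s r ∈ filt T ε p u := by
  classical
  intro t
  rw [coeff_monomial]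
  split_ifs with hst
  · rw [← hst]; exact h
  · exact zero_mem _

theorem X_mem_filt (a : Fin n) : (X a : MvPolynomial (Fin n) R) ∈ filt T ε 0 (unitWeight a) := by
  refine monomial_mem_filt ?_
  rw [expo_single, sub_self]
  exact one_mem_epsSpan T ε

theorem C_mul_mem_filt (c : ℂ) {p : ℕ} {u : Fin n → ℤ} {f : MvPolynomial (Fin n) R}
    (hf : f ∈ filt T ε p u) : C (algebraMap ℂ R c) * f ∈ filt T ε p u := by
  have : C (algebraMap ℂ R c) * f = c • f := by
    rw [Algebra.smul_def, MvPolynomial.algebraMap_apply]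
  rw [this]
  exact Submodule.smul_mem _ _ hf

theorem pderiv_mem_filt (d : Fin n) {p : ℕ} {u : Fin n → ℤ} {f : MvPolynomial (Fin n) R}
    (hf : f ∈ filt T ε p u) : pderiv d f ∈ filt T ε p (u - unitWeight d) := by
  intro s
  rw [coeff_pderiv]
  have : expo s - (u - unitWeight d) = expo (s + Finsupp.single d 1) - u := by
    rw [expo_add, expo_single]; abel
  rw [this]
  have h2 := Submodule.smul_mem _ ((s d : ℂ) + 1) (hf (s + Finsupp.single d 1))
  rw [Algebra.smul_def] at h2
  rw [mul_comm]
  simpa using h2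

theorem derivation_mem_filt {D : Derivation R (MvPolynomial (Fin n) R) (MvPolynomial (Fin n) R)}
    {p q : ℕ} {u v : Fin n → ℤ} {f : MvPolynomial (Fin n) R}
    (hD : ∀ e, D (X e) ∈ filt T ε q (v + unitWeight e)) (hf : f ∈ filt T ε p u) :
    D f ∈ filt T ε (p + q) (u + v) := by
  rw [derivation_eq_sum]
  refine Submodule.sum_mem _ fun e _ => ?_
  exact mul_mem_filt' (pderiv_mem_filt e hf) (hD e) rfl (by abel)

theorem zcoeff_mem {p : ℕ} {u w : Fin n → ℤ} {f : MvPolynomial (Fin n) R}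
    (hf : f ∈ filt T ε p u) : zcoeff (w + u) f ∈ epsSpan T ε p w := by
  by_cases h : 0 ≤ w + u
  · rw [← expo_toExpo h, zcoeff_expo]
    have := hf (toExpo (w + u))
    rwa [expo_toExpo h, add_sub_cancel_right] at this
  · rw [zcoeff_of_not_nonneg h]; exact zero_mem _

theorem zcoeff_eq_zero {p m : ℕ} {u w : Fin n → ℤ} {f : MvPolynomial (Fin n) R}
    (hf : f ∈ filt T ε p u) (hw : w ∈ T.carrier m) (hm : m < p) : zcoeff (w + u) f = 0 :=
  eq_zero_of_mem_epsSpan (zcoeff_mem hf) hw hm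

theorem mem_filt_succ {p : ℕ} {u : Fin n → ℤ} {f : MvPolynomial (Fin n) R}
    (hf : f ∈ filt T ε p u) (h : ∀ w ∈ T.carrier p, zcoeff (w + u) f = 0) :
    f ∈ filt T ε (p + 1) u := by
  intro s
  refine mem_epsSpan_succ (hf s) fun hw => ?_
  have := h _ hw
  rwa [sub_add_cancel, zcoeff_expo] at this

/-- A box contains finitely many integral weights, and each has at most one order. -/
theorem exists_order_bound (T : OrderedWeights n) (b : ℤ) :
    ∃ K, ∀ m, K ≤ m → ∀ w ∈ T.carrier m, ¬ ∀ i, |w i| ≤ b := by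
  have hfin : (Set.Icc (fun _ => -b) (fun _ => b) : Set (Fin n → ℤ)).Finite := Set.finite_Icc _ _
  have h : ∀ w : Fin n → ℤ, ∃ K, ∀ m, K ≤ m → w ∉ T.carrier m := by
    intro w
    by_cases hw : ∃ m, w ∈ T.carrier m
    · obtain ⟨m, hm⟩ := hw
      refine ⟨m + 1, fun m' hm' h' => ?_⟩
      have := T.disjoint hm h'
      omega
    · exact ⟨0, fun m _ hm => hw ⟨m, hm⟩⟩
  choose K hK using h
  refine ⟨hfin.toFinset.sup K, fun m hm w hw hb => ?_⟩
  refine hK w m (le_trans (Finset.le_sup (f := K) ?_) hm) hw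
  rw [Set.Finite.mem_toFinset, Set.mem_Icc]
  exact ⟨fun i => (abs_le.mp (hb i)).1, fun i => (abs_le.mp (hb i)).2⟩

theorem sum_expo_eq {p : ℕ} {u : Fin n → ℤ} {f : MvPolynomial (Fin n) R} (hf : f ∈ filt T ε p u)
    {s : Fin n →₀ ℕ} (hs : coeff s f ≠ 0) : ∑ i, expo s i = ∑ i, u i := by
  obtain ⟨m, _, hw⟩ := exists_of_mem_epsSpan (hf s) hs
  have := T.sum_eq_zero hw
  simp only [Pi.sub_apply, Finset.sum_sub_distrib] at this
  omega

/-- In bounded degree the filtration is finite. -/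
theorem filt_eq_zero {b : ℤ} {K : ℕ}
    (hK : ∀ m, K ≤ m → ∀ w ∈ T.carrier m, ¬ ∀ i, |w i| ≤ b) {p : ℕ} (hp : K ≤ p)
    {u : Fin n → ℤ} (hu : 0 ≤ u) (hub : ∑ i, u i ≤ b) {f : MvPolynomial (Fin n) R}
    (hf : f ∈ filt T ε p u) : f = 0 := by
  ext s
  rw [coeff_zero]
  by_contra hs
  obtain ⟨m, hm, hw⟩ := exists_of_mem_epsSpan (hf s) hs
  refine hK m (hp.trans hm) _ hw fun i => ?_
  exact abs_le_of_sum_le (expo_nonneg s) hu ((sum_expo_eq hf hs).trans_le hub) hub i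

end Filtration

/-! ### Biderivations of the polynomial ring -/

section Brackets

open MvPolynomial

variable {n : ℕ} {R : Type*} [CommRing R]

/-- The derivation `g ↦ ∑ P_ab ∂_a f ∂_b g`. -/
noncomputable def ham (P : Fin n → Fin n → MvPolynomial (Fin n) R) (f : MvPolynomial (Fin n) R) :
    Derivation R (MvPolynomial (Fin n) R) (MvPolynomial (Fin n) R) :=
  mkDerivation R fun b => ∑ a, pderiv a f * P a b

/-- The biderivation with `{x_a, x_b} = P_ab`. -/
noncomputable def br (P : Fin n → Fin n → MvPolynomial (Fin n) R) (f g : MvPolynomial (Fin n) R) :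
    MvPolynomial (Fin n) R := ham P f g

variable (P Q : Fin n → Fin n → MvPolynomial (Fin n) R)

theorem br_X_right (f : MvPolynomial (Fin n) R) (b : Fin n) :
    br P f (X b) = ∑ a, pderiv a f * P a b := by
  rw [br, ham, mkDerivation_X]

theorem br_eq (f g : MvPolynomial (Fin n) R) :
    br P f g = ∑ b, pderiv b g * ∑ a, pderiv a f * P a b := by
  rw [br, derivation_eq_sum]
  exact Finset.sum_congr rfl fun b _ => congrArg _ (br_X_right P f b)

theorem br_X_left (a : Fin n) (g : MvPolynomial (Fin n) R) :
    br P (X a) g = ∑ b, pderiv b g * P a b := by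
  classical
  rw [br_eq]
  refine Finset.sum_congr rfl fun b _ => ?_
  simp [pderiv_X, Pi.single_apply]

theorem br_X_X (a b : Fin n) : br P (X a) (X b) = P a b := by
  classical
  rw [br_X_left]
  simp [pderiv_X, Pi.single_apply]

theorem br_add (f g : MvPolynomial (Fin n) R) : br (P + Q) f g = br P f g + br Q f g := by
  simp only [br_eq, Pi.add_apply, mul_add, Finset.sum_add_distrib]

theorem br_sub (f g : MvPolynomial (Fin n) R) : br (P - Q) f g = br P f g - br Q f g := by
  simp only [br_eq, Pi.sub_apply, mul_sub, Finset.sum_sub_distrib]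

theorem br_add_right (f g h : MvPolynomial (Fin n) R) : br P f (g + h) = br P f g + br P f h :=
  map_add _ _ _

theorem br_sub_right (f g h : MvPolynomial (Fin n) R) : br P f (g - h) = br P f g - br P f h :=
  map_sub _ _ _

theorem br_neg_right (f g : MvPolynomial (Fin n) R) : br P f (-g) = -br P f g :=
  map_neg _ _

theorem br_C_mul_right (c : R) (f g : MvPolynomial (Fin n) R) :
    br P f (C c * g) = C c * br P f g := by
  rw [← smul_eq_C_mul, ← smul_eq_C_mul]; exact Derivation.map_smul _ c g

theorem br_mul_right (f g h : MvPolynomial (Fin n) R) :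
    br P f (g * h) = g * br P f h + h * br P f g :=
  (ham P f).leibniz g h

theorem br_smul_right (c : R) (f g : MvPolynomial (Fin n) R) : br P f (c • g) = c • br P f g :=
  Derivation.map_smul _ c g

theorem br_add_left (f g h : MvPolynomial (Fin n) R) : br P (f + g) h = br P f h + br P g h := by
  simp only [br_eq, map_add, add_mul, mul_add, Finset.sum_add_distrib]

theorem br_smul_left (c : R) (f g : MvPolynomial (Fin n) R) : br P (c • f) g = c • br P f g := by
  simp only [br_eq, Derivation.map_smul, smul_mul_assoc, ← Finset.smul_sum, mul_smul_comm]

variable {P Q}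

theorem br_swap (hP : ∀ a b, P a b = -P b a) (f g : MvPolynomial (Fin n) R) :
    br P f g = -br P g f := by
  rw [br_eq, br_eq]
  simp only [Finset.mul_sum]
  rw [Finset.sum_comm, ← Finset.sum_neg_distrib]
  refine Finset.sum_congr rfl fun a _ => ?_
  rw [← Finset.sum_neg_distrib]
  refine Finset.sum_congr rfl fun b _ => ?_
  rw [hP a b]; ring

variable (P) in
/-- The Jacobiator. -/
noncomputable def jac (f g h : MvPolynomial (Fin n) R) : MvPolynomial (Fin n) R :=
  br P f (br P g h) + br P g (br P h f) + br P h (br P f g)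

theorem jac_cyclic (f g h : MvPolynomial (Fin n) R) : jac P f g h = jac P g h f := by
  simp only [jac]; abel

theorem jac_swap (hP : ∀ a b, P a b = -P b a) (f g h : MvPolynomial (Fin n) R) :
    jac P f g h = -jac P g f h := by
  simp only [jac]
  rw [br_swap hP g h, br_swap hP h f, br_swap hP f g, br_neg_right, br_neg_right, br_neg_right]
  abel

/-- In its last argument the Jacobiator is the commutator of two Hamiltonian derivations minus the
Hamiltonian derivation of the bracket. -/
theorem exists_jac_derivation (hP : ∀ a b, P a b = -P b a) (f g : MvPolynomial (Fin n) R) :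
    ∃ D : Derivation R (MvPolynomial (Fin n) R) (MvPolynomial (Fin n) R), ∀ h, jac P f g h = D h := by
  refine ⟨⁅ham P f, ham P g⁆ - ham P (br P f g), fun h => ?_⟩
  rw [Derivation.sub_apply, Derivation.commutator_apply]
  change jac P f g h = br P f (br P g h) - br P g (br P f h) - br P (br P f g) h
  rw [jac, br_swap hP h f, br_swap hP h (br P f g), br_neg_right]
  abel

theorem jac_eq_sum (hP : ∀ a b, P a b = -P b a) (f g h : MvPolynomial (Fin n) R) :
    jac P f g h = ∑ e, pderiv e h * jac P f g (X e) := by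
  obtain ⟨D, hD⟩ := exists_jac_derivation hP f g
  simp only [hD]
  exact derivation_eq_sum D h

/-- By cyclic symmetry the Jacobiator is a derivation in each argument, so the variables decide. -/
theorem jac_eq_zero (hP : ∀ a b, P a b = -P b a)
    (h0 : ∀ a b c, jac P (X a) (X b) (X c) = 0) (f g h : MvPolynomial (Fin n) R) :
    jac P f g h = 0 := by
  have h1 : ∀ a b h, jac P (X a) (X b) h = 0 := fun a b h => by
    rw [jac_eq_sum hP]; simp [h0]
  have h2 : ∀ a g h, jac P (X a) g h = 0 := fun a g h => by
    rw [jac_cyclic, jac_cyclic, jac_eq_sum hP]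
    refine Finset.sum_eq_zero fun e _ => ?_
    rw [jac_cyclic, h1, mul_zero]
  rw [jac_eq_sum hP]
  refine Finset.sum_eq_zero fun e _ => ?_
  rw [jac_cyclic, jac_cyclic, h2, mul_zero]

/-- The Jacobiator is a cocycle. -/
theorem jac_cocycle (hP : ∀ a b, P a b = -P b a) (a b c d : MvPolynomial (Fin n) R) :
    br P a (jac P b c d) - br P b (jac P a c d) + br P c (jac P a b d) - br P d (jac P a b c) =
    jac P (br P a b) c d - jac P (br P a c) b d + jac P (br P a d) b c + jac P (br P b c) a d
      - jac P (br P b d) a c + jac P (br P c d) a b := by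
  -- Only skew symmetry and additivity enter; the Jacobi identity is not assumed, and the nested
  -- brackets cancel formally.
  have s := br_swap hP
  simp only [jac, s c a, s d a, s d b, br_add_right, br_neg_right, s (br P a b) c,
    s (br P a c) b, s (br P a d) b, s (br P b c) a, s (br P b d) a, s (br P c d) a,
    s (br P c d) (br P a b), s (br P b d) (br P a c), s (br P b c) (br P a d)]
  abel

/-- A skew biderivation satisfying the Jacobi identity on the variables is a Poisson bracket. -/
noncomputable def poissonOfMatrix [IsDomain R] [CharZero R]
    (P : Fin n → Fin n → MvPolynomial (Fin n) R) (hP : ∀ a b, P a b = -P b a)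
    (hj : ∀ a b c, jac P (X a) (X b) (X c) = 0) :
    PoissonBracket R (MvPolynomial (Fin n) R) where
  bracket := LinearMap.mk₂ R (br P) (br_add_left P) (br_smul_left P) (br_add_right P)
    (br_smul_right P)
  bracket_self f := self_eq_neg.mp (br_swap hP f f)
  jacobi f g h := jac_eq_zero hP hj f g h
  leibniz f g h := by
    rw [LinearMap.mk₂_apply, LinearMap.mk₂_apply, LinearMap.mk₂_apply, br_mul_right]
    ring

/-- The matrix of brackets of the variables. -/
noncomputable def PoissonBracket.matrix (B : PoissonBracket R (MvPolynomial (Fin n) R))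
    (a b : Fin n) : MvPolynomial (Fin n) R := B.bracket (X a) (X b)

theorem PoissonBracket.swap {A : Type*} [CommRing A] [Algebra R A] (B : PoissonBracket R A)
    (f g : A) : B.bracket f g = -B.bracket g f := by
  have := B.bracket_self (f + g)
  simp only [map_add, LinearMap.add_apply, B.bracket_self, zero_add, add_zero] at this
  exact eq_neg_of_add_eq_zero_right this

theorem PoissonBracket.eq_sum (B : PoissonBracket R (MvPolynomial (Fin n) R))
    (f g : MvPolynomial (Fin n) R) :
    B.bracket f g = ∑ b, pderiv b g * B.bracket f (X b) :=
  derivation_eq_sum (Derivation.mk' (B.bracket f) fun g h => by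
    rw [B.leibniz, smul_eq_mul, smul_eq_mul]; ring) g

theorem PoissonBracket.eq_br (B : PoissonBracket R (MvPolynomial (Fin n) R))
    (f g : MvPolynomial (Fin n) R) : B.bracket f g = br B.matrix f g := by
  rw [B.eq_sum, br_eq]
  refine Finset.sum_congr rfl fun b _ => congrArg _ ?_
  rw [B.swap, B.eq_sum, ← Finset.sum_neg_distrib]
  refine Finset.sum_congr rfl fun a _ => ?_
  rw [PoissonBracket.matrix, B.swap (X a)]; ring

theorem PoissonBracket.jac_eq_zero (B : PoissonBracket R (MvPolynomial (Fin n) R))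
    (f g h : MvPolynomial (Fin n) R) : jac B.matrix f g h = 0 := by
  simp only [jac, ← B.eq_br]
  exact B.jacobi f g h

end Brackets

/-! ### Filtered brackets -/

section Filtered

open MvPolynomial

variable {n : ℕ} {R : Type*} [CommRing R] [Algebra ℂ R] {T : OrderedWeights n} {ε : R}

/-- Orders add; the weights lost to `∂_a` and `∂_b` are restored by `P a b`. -/
theorem br_mem_filt {P : Fin n → Fin n → MvPolynomial (Fin n) R} {p q r m : ℕ}
    {u v w : Fin n → ℤ}
    (hP : ∀ a b, P a b ∈ filt T ε r (unitWeight a + unitWeight b))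
    {f g : MvPolynomial (Fin n) R} (hf : f ∈ filt T ε p u) (hg : g ∈ filt T ε q v)
    (hm : m = p + q + r) (hw : w = u + v) : br P f g ∈ filt T ε m w := by
  have hD : ∀ e, ham P f (X e) ∈ filt T ε (p + r) (u + unitWeight e) := by
    intro e
    change br P f (X e) ∈ _
    rw [br_X_right]
    refine Submodule.sum_mem _ fun a _ => ?_
    exact mul_mem_filt' (pderiv_mem_filt a hf) (hP a e) rfl (by abel)
  have := derivation_mem_filt hD hg
  rw [hm, hw, show p + q + r = q + (p + r) by ring, add_comm u v]
  exact this

/-- The matrix of brackets of the variables of the toric Poisson structure. -/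
noncomputable def toricMatrix (R : Type*) [CommRing R] [Algebra ℂ R]
    (lam : Matrix (Fin n) (Fin n) ℂ) (a b : Fin n) : MvPolynomial (Fin n) R :=
  C (algebraMap ℂ R (lam a b)) * X a * X b

/-- The pairing of `lam` with an integral weight, as an element of `R`. -/
noncomputable def pairing (R : Type*) [CommRing R] [Algebra ℂ R]
    (lam : Matrix (Fin n) (Fin n) ℂ) (w : Fin n → ℤ) (a : Fin n) : R :=
  algebraMap ℂ R (lam.mulVec (fun k => (w k : ℂ)) a)

variable {lam : Matrix (Fin n) (Fin n) ℂ}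

theorem pairing_add (v w : Fin n → ℤ) (a : Fin n) :
    pairing R lam (v + w) a = pairing R lam v a + pairing R lam w a := by
  rw [pairing, pairing, pairing, ← map_add, ← Pi.add_apply, ← Matrix.mulVec_add]
  congr 3
  ext k; simp

theorem pairing_unitWeight (a b : Fin n) :
    pairing R lam (unitWeight b) a = algebraMap ℂ R (lam a b) := by
  rw [pairing]
  congr 1
  simp [Matrix.mulVec, dotProduct, unitWeight, Pi.single_apply]

theorem toricMatrix_mem (a b : Fin n) :
    toricMatrix R lam a b ∈ filt T ε 0 (unitWeight a + unitWeight b) := by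
  rw [toricMatrix, mul_assoc]
  exact C_mul_mem_filt _ (mul_mem_filt' (X_mem_filt a) (X_mem_filt b) (zero_add 0).symm rfl)

theorem toricMatrix_swap (halt : lam.transpose = -lam) (a b : Fin n) :
    toricMatrix R lam a b = -toricMatrix R lam b a := by
  have : lam a b = -lam b a := by simpa using congrFun (congrFun halt b) a
  rw [toricMatrix, toricMatrix, this, map_neg, map_neg]; ring

theorem br_toric (a : Fin n) (f : MvPolynomial (Fin n) R) :
    br (toricMatrix R lam) (X a) f =
      X a * ∑ b, C (algebraMap ℂ R (lam a b)) * (X b * pderiv b f) := by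
  rw [br_X_left, Finset.mul_sum]
  refine Finset.sum_congr rfl fun b _ => ?_
  rw [toricMatrix]; ring

/-- The Hamiltonian field of `x_a` is `x_a` times a combination of Euler fields, so it acts on `x^w`
by the scalar `(λw)_a`. This is what turns the toric differential into an exterior product. -/
theorem zcoeff_br_toric (w : Fin n → ℤ) (a : Fin n) (f : MvPolynomial (Fin n) R) :
    zcoeff (w + unitWeight a) (br (toricMatrix R lam) (X a) f) =
      pairing R lam w a * zcoeff w f := by
  rw [br_toric, zcoeff_X_mul, add_sub_cancel_right, map_sum]
  simp only [← smul_eq_C_mul, map_smul, zcoeff_X_mul_pderiv, smul_eq_mul, pairing, Matrix.mulVec,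
    dotProduct, map_sum, map_mul, Finset.sum_mul, map_intCast, mul_assoc]

theorem jac_toric (halt : lam.transpose = -lam) (a b c : Fin n) :
    jac (toricMatrix R lam) (X a) (X b) (X c) = 0 := by
  have h : ∀ a b, lam a b = -lam b a := fun a b => by
    simpa using congrFun (congrFun halt b) a
  have hbr : ∀ a b c : Fin n, br (toricMatrix R lam) (X a) (toricMatrix R lam b c) =
      C (algebraMap ℂ R (lam b c)) * (C (algebraMap ℂ R (lam a b)) + C (algebraMap ℂ R (lam a c))) *
        (X a * X b * X c) := by
    intro a b c
    conv_lhs => rw [toricMatrix, mul_assoc, br_C_mul_right, br_mul_right, br_X_X, br_X_X]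
    simp only [toricMatrix]
    ring
  rw [jac, br_X_X, br_X_X, br_X_X, hbr, hbr, hbr, h b a, h c a, h c b]
  simp only [map_neg]
  ring

variable (T ε lam) in
/-- The skew matrices which agree with the toric one to order zero. -/
structure IsNearToric (P : Fin n → Fin n → MvPolynomial (Fin n) R) : Prop where
  swap : ∀ a b, P a b = -P b a
  sub_mem : ∀ a b, P a b - toricMatrix R lam a b ∈ filt T ε 1 (unitWeight a + unitWeight b)

theorem IsNearToric.mem {P : Fin n → Fin n → MvPolynomial (Fin n) R}
    (hP : IsNearToric T ε lam P) (a b : Fin n) :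
    P a b ∈ filt T ε 0 (unitWeight a + unitWeight b) := by
  have := add_mem (filt_mono zero_le_one (hP.sub_mem a b)) (toricMatrix_mem (lam := lam) a b)
  rwa [sub_add_cancel] at this

theorem isNearToric_toric (halt : lam.transpose = -lam) :
    IsNearToric T ε lam (toricMatrix R lam) :=
  ⟨toricMatrix_swap halt, fun a b => by rw [sub_self]; exact zero_mem _⟩

theorem IsNearToric.add {P Q : Fin n → Fin n → MvPolynomial (Fin n) R}
    (hP : IsNearToric T ε lam P) (hQs : ∀ a b, Q a b = -Q b a)
    (hQ : ∀ a b, Q a b ∈ filt T ε 1 (unitWeight a + unitWeight b)) :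
    IsNearToric T ε lam (P + Q) :=
  ⟨fun a b => by simp only [Pi.add_apply]; rw [hP.swap, hQs, neg_add],
    fun a b => by
      have := add_mem (hP.sub_mem a b) (hQ a b)
      rwa [sub_add_eq_add_sub] at this⟩

theorem IsNearToric.br_sub_mem {P : Fin n → Fin n → MvPolynomial (Fin n) R}
    (hP : IsNearToric T ε lam P) {p : ℕ} {u v : Fin n → ℤ} {f g : MvPolynomial (Fin n) R}
    {q m : ℕ} {w : Fin n → ℤ} (hf : f ∈ filt T ε q v)
    (hg : g ∈ filt T ε p u) (hm : m = q + p + 1) (hw : w = v + u) :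
    br P f g - br (toricMatrix R lam) f g ∈ filt T ε m w := by
  rw [← br_sub]
  exact br_mem_filt hP.sub_mem hf hg hm hw

/-- The leading term of the bracket of a variable with a polynomial. -/
theorem IsNearToric.zcoeff_br {P : Fin n → Fin n → MvPolynomial (Fin n) R}
    (hP : IsNearToric T ε lam P) {m : ℕ} {u W w : Fin n → ℤ} {f : MvPolynomial (Fin n) R}
    (hf : f ∈ filt T ε m u) (hW : W ∈ T.carrier m) (a : Fin n) (hw : w = W + u + unitWeight a) :
    zcoeff w (br P (X a) f) =
      (pairing R lam W a + pairing R lam u a) * zcoeff (W + u) f := by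
  have h1 := hP.br_sub_mem (X_mem_filt a) hf (show m + 1 = 0 + m + 1 by ring) rfl
  have h2 := zcoeff_eq_zero h1 hW (Nat.lt_succ_self m)
  rw [map_sub, show W + (unitWeight a + u) = W + u + unitWeight a by abel, zcoeff_br_toric,
    pairing_add] at h2
  rw [hw]
  exact sub_eq_zero.mp h2

/-- The leading term of the bracket with a perturbation of order `m`. -/
theorem zcoeff_br_of_mem {P Q : Fin n → Fin n → MvPolynomial (Fin n) R}
    (hP : IsNearToric T ε lam P) {m : ℕ} {W w : Fin n → ℤ}
    (hQ : ∀ a b, Q a b ∈ filt T ε m (unitWeight a + unitWeight b))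
    (hW : W ∈ T.carrier m) (a b c : Fin n)
    (hw : w = W + (unitWeight b + unitWeight c) + unitWeight a) :
    zcoeff w (br Q (X a) (P b c)) = algebraMap ℂ R (lam b c) *
      (zcoeff (W + (unitWeight a + unitWeight b)) (Q a b) +
        zcoeff (W + (unitWeight a + unitWeight c)) (Q a c)) := by
  have h1 : br Q (X a) (P b c) - br Q (X a) (toricMatrix R lam b c) ∈
      filt T ε (m + 1) (unitWeight a + (unitWeight b + unitWeight c)) := by
    rw [← br_sub_right]
    exact br_mem_filt hQ (X_mem_filt a) (hP.sub_mem b c) (by ring) rfl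
  have h2 := zcoeff_eq_zero h1 hW (Nat.lt_succ_self m)
  rw [map_sub, sub_eq_zero] at h2
  rw [hw, show W + (unitWeight b + unitWeight c) + unitWeight a =
    W + (unitWeight a + (unitWeight b + unitWeight c)) by abel, h2, toricMatrix, mul_assoc,
    br_C_mul_right, br_mul_right, br_X_X, br_X_X, ← smul_eq_C_mul, map_smul, map_add,
    zcoeff_X_mul, zcoeff_X_mul, smul_eq_mul, add_comm (zcoeff _ (Q a b))]
  congr 4 <;> abel

/-- The leading term of the change of the Jacobiator is the toric differential of the
perturbation. -/
theorem zcoeff_jac_add (halt : lam.transpose = -lam)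
    {P Q : Fin n → Fin n → MvPolynomial (Fin n) R} (hP : IsNearToric T ε lam P)
    (hQs : ∀ a b, Q a b = -Q b a) {m : ℕ} (hm : 1 ≤ m)
    (hQ : ∀ a b, Q a b ∈ filt T ε m (unitWeight a + unitWeight b)) {W : Fin n → ℤ}
    (hW : W ∈ T.carrier m) (a b c : Fin n) :
    zcoeff (W + (unitWeight a + unitWeight b + unitWeight c))
      (jac (P + Q) (X a) (X b) (X c) - jac P (X a) (X b) (X c)) =
    pairing R lam W a * zcoeff (W + (unitWeight b + unitWeight c)) (Q b c) +
    pairing R lam W b * zcoeff (W + (unitWeight c + unitWeight a)) (Q c a) +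
    pairing R lam W c * zcoeff (W + (unitWeight a + unitWeight b)) (Q a b) := by
  have hPQ : IsNearToric T ε lam (P + Q) := hP.add hQs fun a b => filt_mono hm (hQ a b)
  have hj : jac (P + Q) (X a) (X b) (X c) - jac P (X a) (X b) (X c) =
      (br (P + Q) (X a) (Q b c) + br Q (X a) (P b c)) +
      (br (P + Q) (X b) (Q c a) + br Q (X b) (P c a)) +
      (br (P + Q) (X c) (Q a b) + br Q (X c) (P a b)) := by
    simp only [jac, br_X_X, br_add, Pi.add_apply, br_add_right]
    abel
  have hl : ∀ a b, lam a b = -lam b a := fun a b => by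
    simpa using congrFun (congrFun halt b) a
  have hq : ∀ a b, zcoeff (W + (unitWeight a + unitWeight b)) (Q a b) =
      -zcoeff (W + (unitWeight b + unitWeight a)) (Q b a) := fun a b => by
    rw [hQs a b, map_neg, add_comm (unitWeight a)]
  rw [hj]
  simp only [map_add]
  rw [hPQ.zcoeff_br (hQ b c) hW a (by abel), hPQ.zcoeff_br (hQ c a) hW b (by abel),
    hPQ.zcoeff_br (hQ a b) hW c (by abel), zcoeff_br_of_mem hP hQ hW a b c (by abel),
    zcoeff_br_of_mem hP hQ hW b c a (by abel), zcoeff_br_of_mem hP hQ hW c a b (by abel)]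
  -- The shift of the weight by `e_b + e_c` adds entries of `λ` to `λW`. In the cyclic sum they
  -- cancel against the terms from the brackets of `Q` with the toric matrix.
  simp only [pairing_add, pairing_unitWeight]
  rw [hq a c, hq b a, hq c b, hl a c, hl b a, hl c b]
  simp only [map_neg]
  ring

theorem jac_sub_mem {P Q : Fin n → Fin n → MvPolynomial (Fin n) R} (hP : IsNearToric T ε lam P)
    {m : ℕ} (hQ : ∀ a b, Q a b ∈ filt T ε m (unitWeight a + unitWeight b)) (a b c : Fin n) :
    jac (P + Q) (X a) (X b) (X c) - jac P (X a) (X b) (X c) ∈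
      filt T ε m (unitWeight a + unitWeight b + unitWeight c) := by
  have hPQ : ∀ a b, (P + Q) a b ∈ filt T ε 0 (unitWeight a + unitWeight b) := fun a b =>
    add_mem (hP.mem a b) (filt_mono (Nat.zero_le m) (hQ a b))
  have hj : jac (P + Q) (X a) (X b) (X c) - jac P (X a) (X b) (X c) =
      (br (P + Q) (X a) (Q b c) + br Q (X a) (P b c)) +
      (br (P + Q) (X b) (Q c a) + br Q (X b) (P c a)) +
      (br (P + Q) (X c) (Q a b) + br Q (X c) (P a b)) := by
    simp only [jac, br_X_X, br_add, Pi.add_apply, br_add_right]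
    abel
  have key : ∀ a b c, br (P + Q) (X a) (Q b c) + br Q (X a) (P b c) ∈
      filt T ε m (unitWeight a + unitWeight b + unitWeight c) := fun a b c =>
    add_mem (br_mem_filt hPQ (X_mem_filt a) (hQ b c) (by ring) (by abel))
      (br_mem_filt hQ (X_mem_filt a) (hP.mem b c) (by ring) (by abel))
  rw [hj]
  refine add_mem (add_mem (key a b c) ?_) ?_
  · rw [show unitWeight a + unitWeight b + unitWeight c =
      unitWeight b + unitWeight c + unitWeight a by abel]
    exact key b c a
  · rw [show unitWeight a + unitWeight b + unitWeight c =
      unitWeight c + unitWeight a + unitWeight b by abel]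
    exact key c a b

theorem derivation_C_mul_X_mul_X {R : Type*} [CommRing R]
    (D : Derivation R (MvPolynomial (Fin n) R) (MvPolynomial (Fin n) R)) (r : R) (a b : Fin n) :
    D (C r * (X a * X b)) = C r * (X a * D (X b) + X b * D (X a)) := by
  rw [← smul_eq_C_mul, ← smul_eq_C_mul, Derivation.map_smul, Derivation.leibniz]
  rfl

/-- The leading term of the Jacobiator of a product of variables. -/
theorem zcoeff_jac_bracket {P : Fin n → Fin n → MvPolynomial (Fin n) R}
    (hP : IsNearToric T ε lam P) {m : ℕ} {W w : Fin n → ℤ} (hW : W ∈ T.carrier m)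
    (hJ : ∀ a b c, jac P (X a) (X b) (X c) ∈
      filt T ε m (unitWeight a + unitWeight b + unitWeight c)) (a b c d : Fin n)
    (hw : w = W + (unitWeight a + unitWeight b + unitWeight c + unitWeight d)) :
    zcoeff w (jac P (br P (X a) (X b)) (X c) (X d)) = algebraMap ℂ R (lam a b) *
      (zcoeff (W + (unitWeight a + unitWeight c + unitWeight d)) (jac P (X a) (X c) (X d)) +
        zcoeff (W + (unitWeight b + unitWeight c + unitWeight d)) (jac P (X b) (X c) (X d))) := by
  obtain ⟨D, hD⟩ := exists_jac_derivation hP.swap (X c) (X d)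
  have hDX : ∀ e, D (X e) ∈ filt T ε m (unitWeight c + unitWeight d + unitWeight e) := fun e => by
    rw [← hD]; exact hJ c d e
  have h1 : D (P a b) - D (toricMatrix R lam a b) ∈
      filt T ε (1 + m) (unitWeight a + unitWeight b + (unitWeight c + unitWeight d)) := by
    rw [← map_sub]
    exact derivation_mem_filt hDX (hP.sub_mem a b)
  have h2 := zcoeff_eq_zero h1 hW (by omega)
  rw [map_sub, sub_eq_zero] at h2
  rw [jac_cyclic, br_X_X, hD, hw, show W + (unitWeight a + unitWeight b + unitWeight c +
    unitWeight d) = W + (unitWeight a + unitWeight b + (unitWeight c + unitWeight d)) by abel, h2,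
    toricMatrix, mul_assoc, derivation_C_mul_X_mul_X, ← smul_eq_C_mul, map_smul,
    map_add, smul_eq_mul, zcoeff_X_mul, zcoeff_X_mul, ← hD, ← hD,
    jac_cyclic (X a), jac_cyclic (X b)]
  rw [show W + (unitWeight a + unitWeight b + (unitWeight c + unitWeight d)) - unitWeight a =
      W + (unitWeight b + unitWeight c + unitWeight d) by abel,
    show W + (unitWeight a + unitWeight b + (unitWeight c + unitWeight d)) - unitWeight b =
      W + (unitWeight a + unitWeight c + unitWeight d) by abel, add_comm (zcoeff _ _)]

/-- The leading term of a Jacobiator is closed for the toric differential. -/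
theorem zcoeff_jac_cocycle (halt : lam.transpose = -lam)
    {P : Fin n → Fin n → MvPolynomial (Fin n) R}
    (hP : IsNearToric T ε lam P) {m : ℕ} {W : Fin n → ℤ} (hW : W ∈ T.carrier m)
    (hJ : ∀ a b c, jac P (X a) (X b) (X c) ∈
      filt T ε m (unitWeight a + unitWeight b + unitWeight c)) {t : Fin n → Fin n → Fin n → R}
    (ht : ∀ a b c, t a b c =
      zcoeff (W + (unitWeight a + unitWeight b + unitWeight c)) (jac P (X a) (X b) (X c)))
    (a b c d : Fin n) :
    pairing R lam W a * t b c d - pairing R lam W b * t a c d + pairing R lam W c * t a b d -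
      pairing R lam W d * t a b c = 0 := by
  have hl : ∀ a b, lam a b = -lam b a := fun a b => by
    simpa using congrFun (congrFun halt b) a
  have ht1 : ∀ a b c, t a b c = -t b a c := fun a b c => by
    rw [ht, ht, jac_swap hP.swap, map_neg, add_comm (unitWeight a)]
  have ht2 : ∀ a b c, t a b c = t b c a := fun a b c => by
    rw [ht, ht, jac_cyclic]
    congr 2; abel
  -- Both sides of the cocycle identity have explicit leading terms. The entries of `λ` from the
  -- shifted weights on the left cancel the right side, and only `λW` remains.
  have h := congrArg (zcoeff (W + (unitWeight a + unitWeight b + unitWeight c + unitWeight d)))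
    (jac_cocycle hP.swap (X a) (X b) (X c) (X d))
  simp only [map_add, map_sub] at h
  rw [hP.zcoeff_br (hJ b c d) hW a (by abel), hP.zcoeff_br (hJ a c d) hW b (by abel),
    hP.zcoeff_br (hJ a b d) hW c (by abel), hP.zcoeff_br (hJ a b c) hW d (by abel),
    zcoeff_jac_bracket hP hW hJ a b c d (by abel), zcoeff_jac_bracket hP hW hJ a c b d (by abel),
    zcoeff_jac_bracket hP hW hJ a d b c (by abel), zcoeff_jac_bracket hP hW hJ b c a d (by abel),
    zcoeff_jac_bracket hP hW hJ b d a c (by abel),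
    zcoeff_jac_bracket hP hW hJ c d a b (by abel)] at h
  simp only [← ht, pairing_add, pairing_unitWeight] at h
  rw [hl b a, hl c a, hl d a, hl c b, hl d b, hl d c, ht1 c b d, ht2 d b c, ht1 c a d, ht1 b a d,
    ht2 d a c, ht1 b a c, ht2 d a b, ht2 c a b] at h
  simp only [map_neg] at h
  linear_combination h

end Filtered

/-! ### Existence of a Poisson bracket with given terms of first order -/

section Existence

open MvPolynomial

variable {n : ℕ} {R : Type*} [CommRing R] [Algebra ℂ R] {T : OrderedWeights n} {ε : R}
  {lam : Matrix (Fin n) (Fin n) ℂ}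

/-- The homogeneous polynomial of degree `d` with coefficient `f w` at the weight `w + u`. -/
noncomputable def polyOf (d : ℕ) (u : Fin n → ℤ) (f : (Fin n → ℤ) → R) : MvPolynomial (Fin n) R :=
  ∑ s ∈ Finset.finsuppAntidiag Finset.univ d, monomial s (f (expo s - u))

theorem polyOf_mem_filt {d p : ℕ} {u : Fin n → ℤ} {f : (Fin n → ℤ) → R}
    (hf : ∀ w, f w ∈ epsSpan T ε p w) : polyOf d u f ∈ filt T ε p u :=
  Submodule.sum_mem _ fun _ _ => monomial_mem_filt (hf _)

theorem zcoeff_polyOf {R : Type*} [CommRing R] {d : ℕ} {u w : Fin n → ℤ} {f : (Fin n → ℤ) → R} (h : 0 ≤ w + u)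
    (hd : ∑ i, (w + u) i = d) : zcoeff (w + u) (polyOf d u f) = f w := by
  classical
  rw [← expo_toExpo h, zcoeff_expo, polyOf, coeff_sum]
  rw [Finset.sum_eq_single (toExpo (w + u))]
  · rw [coeff_monomial, if_pos rfl, expo_toExpo h, add_sub_cancel_right]
  · intro s _ hs
    rw [coeff_monomial, if_neg hs]
  · intro hs
    refine absurd ?_ hs
    rw [Finset.mem_finsuppAntidiag]
    refine ⟨?_, Finset.subset_univ _⟩
    rw [← expo_toExpo h] at hd
    have : ((∑ i, toExpo (w + u) i : ℕ) : ℤ) = d := by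
      rw [← hd]; push_cast; rfl
    exact_mod_cast this

theorem eq_zero_of_eq_neg {r : R} (h : r = -r) : r = 0 := by
  have h2 : (2 : ℂ) • r = 0 := by
    rw [two_smul]
    nth_rewrite 2 [h]
    exact add_neg_cancel r
  have := congrArg (fun x => (2 : ℂ)⁻¹ • x) h2
  simpa [smul_smul] using this

/-- A nonzero trivector coefficient on distinct variables provides the two conditions under which a
weight of order at least two is acyclic. -/
theorem neg_one_le_of_three {W : Fin n → ℤ} {a b c : Fin n} (hab : a ≠ b) (hac : a ≠ c)
    (hbc : b ≠ c) (h : 0 ≤ W + (unitWeight a + unitWeight b + unitWeight c)) :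
    (∀ i, -1 ≤ W i) ∧ (Finset.univ.filter fun i => W i = -1).card ≤ 3 := by
  classical
  have key : ∀ i, -1 ≤ W i ∧ (W i = -1 → i = a ∨ i = b ∨ i = c) := by
    intro i
    have hi := h i
    simp only [Pi.zero_apply, Pi.add_apply, unitWeight, Pi.single_apply] at hi
    constructor
    · split_ifs at hi <;> simp_all <;> omega
    · intro hW
      by_contra! hne
      simp [hne, hW] at hi
  refine ⟨fun i => (key i).1, ?_⟩
  have hsub : (Finset.univ.filter fun i => W i = -1) ⊆ {a, b, c} := by
    intro i hi
    have := (key i).2 (Finset.mem_filter.mp hi).2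
    simpa using this
  exact (Finset.card_le_card hsub).trans Finset.card_le_three

/-- Contraction with `k` keeps exponents nonnegative because `W k` is not `-1`, hence is at least
`0`. -/
theorem nonneg_of_add_unitWeight {W v : Fin n → ℤ} (hv : 0 ≤ v) (hW : ∀ i, -1 ≤ W i) {k : Fin n}
    (hk : W k ≠ -1) (h : 0 ≤ W + (unitWeight k + v)) : 0 ≤ W + v := by
  intro i
  by_cases hik : i = k
  · subst hik
    have h1 := hW i
    have h2 := hv i
    simp only [Pi.zero_apply, Pi.add_apply] at h2 ⊢
    omega
  · have := h i
    simpa [unitWeight, hik] using this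

variable (lam) in
/-- The toric differential has no kernel on vectors supported where `W` equals `-1`. -/
def IsAcyclicWeight (W : Fin n → ℤ) : Prop :=
  (∀ a, -1 ≤ W a) → (Finset.univ.filter fun a => W a = -1).card ≤ 3 →
    ∃ k, W k ≠ -1 ∧ lam.mulVec (fun a => (W a : ℂ)) k ≠ 0

/-- Contract with an index `k` at which `λW` does not vanish, `q_ab = -t_kab / (λW)_k`; closedness
with first index `k` says that `q` is a primitive of `-t`. -/
theorem exists_primitive_of_cocycle {W : Fin n → ℤ} (hW : IsAcyclicWeight lam W)
    (E : Submodule ℂ R) {t : Fin n → Fin n → Fin n → R} (hE : ∀ a b c, t a b c ∈ E)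
    (ht1 : ∀ a b c, t a b c = -t b a c) (ht2 : ∀ a b c, t a b c = t b c a)
    (hpos : ∀ a b c, t a b c ≠ 0 → 0 ≤ W + (unitWeight a + unitWeight b + unitWeight c))
    (hco : ∀ a b c d, pairing R lam W a * t b c d - pairing R lam W b * t a c d +
      pairing R lam W c * t a b d - pairing R lam W d * t a b c = 0) :
    ∃ q : Fin n → Fin n → R, (∀ a b, q a b = -q b a) ∧ (∀ a b, q a b ∈ E) ∧
      (∀ a b, q a b ≠ 0 → 0 ≤ W + (unitWeight a + unitWeight b)) ∧
      ∀ a b c, pairing R lam W a * q b c + pairing R lam W b * q c a + pairing R lam W c * q a b =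
        -t a b c := by
  by_cases h0 : ∀ a b c, t a b c = 0
  · exact ⟨fun _ _ => 0, by simp, by simp, by simp, by simp [h0]⟩
  push Not at h0
  obtain ⟨a₀, b₀, c₀, hne⟩ := h0
  have hdiag : ∀ a b, t a a b = 0 := fun a b => eq_zero_of_eq_neg (ht1 a a b)
  have hab : a₀ ≠ b₀ := by rintro rfl; exact hne (hdiag _ _)
  have hbc : b₀ ≠ c₀ := by rintro rfl; rw [ht2] at hne; exact hne (hdiag _ _)
  have hac : a₀ ≠ c₀ := by rintro rfl; rw [ht2, ht2] at hne; exact hne (hdiag _ _)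
  obtain ⟨hge, hcard⟩ := neg_one_le_of_three hab hac hbc (hpos _ _ _ hne)
  obtain ⟨k, hk, hak⟩ := hW hge hcard
  set x := lam.mulVec (fun a => (W a : ℂ)) k with hx
  refine ⟨fun a b => -(x⁻¹ • t k a b), fun a b => ?_, fun a b => ?_, fun a b h => ?_,
    fun a b c => ?_⟩
  · change -(x⁻¹ • t k a b) = - -(x⁻¹ • t k b a)
    rw [ht2 k a b, ht1 a b k, ← ht2 k b a, smul_neg]
  · exact neg_mem (Submodule.smul_mem _ _ (hE _ _ _))
  · refine nonneg_of_add_unitWeight (add_nonneg (unitWeight_nonneg a) (unitWeight_nonneg b)) hge hk ?_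
    rw [← add_assoc (unitWeight k)]
    refine hpos _ _ _ fun h' => h ?_
    change -(x⁻¹ • t k a b) = 0
    rw [h', smul_zero, neg_zero]
  · have h := hco k a b c
    have hpk : pairing R lam W k = algebraMap ℂ R x := rfl
    have hinv : algebraMap ℂ R x⁻¹ * algebraMap ℂ R x = 1 := by
      rw [← map_mul, inv_mul_cancel₀ hak, map_one]
    rw [hpk] at h
    have h3 : t k c a = -t k a c := by rw [ht2 k c a, ht1 c a k, ← ht2 k a c]
    simp only [Algebra.smul_def, h3]
    linear_combination algebraMap ℂ R x⁻¹ * h - t a b c * hinv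

/-- The leading part of the Jacobiator at each weight of order `m` is closed. A primitive of its
negative is chosen weight by weight, and assembled into a quadratic correction `Q`. -/
theorem exists_jacobi_step (halt : lam.transpose = -lam)
    {P : Fin n → Fin n → MvPolynomial (Fin n) R} (hP : IsNearToric T ε lam P) {m : ℕ} (hm : 1 ≤ m)
    (hacy : ∀ W ∈ T.carrier m, IsAcyclicWeight lam W)
    (hJ : ∀ a b c, jac P (X a) (X b) (X c) ∈
      filt T ε m (unitWeight a + unitWeight b + unitWeight c)) :
    ∃ Q : Fin n → Fin n → MvPolynomial (Fin n) R, (∀ a b, Q a b = -Q b a) ∧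
      (∀ a b, Q a b ∈ filt T ε m (unitWeight a + unitWeight b)) ∧
      ∀ a b c, jac (P + Q) (X a) (X b) (X c) ∈
        filt T ε (m + 1) (unitWeight a + unitWeight b + unitWeight c) := by
  classical
  have hq : ∀ W : Fin n → ℤ, ∃ q : Fin n → Fin n → R, W ∈ T.carrier m →
      (∀ a b, q a b = -q b a) ∧ (∀ a b, q a b ∈ epsSpan T ε m W) ∧
      (∀ a b, q a b ≠ 0 → 0 ≤ W + (unitWeight a + unitWeight b)) ∧
      ∀ a b c, pairing R lam W a * q b c + pairing R lam W b * q c a + pairing R lam W c * q a b =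
        -zcoeff (W + (unitWeight a + unitWeight b + unitWeight c))
          (jac P (X a) (X b) (X c)) := by
    intro W
    by_cases hW : W ∈ T.carrier m
    · obtain ⟨q, hq⟩ := exists_primitive_of_cocycle (hacy W hW) (epsSpan T ε m W)
        (t := fun a b c => zcoeff (W + (unitWeight a + unitWeight b + unitWeight c))
          (jac P (X a) (X b) (X c))) (fun a b c => zcoeff_mem (hJ a b c))
        (fun a b c => by rw [jac_swap hP.swap, map_neg, add_comm (unitWeight a)])
        (fun a b c => by
          rw [jac_cyclic]
          congr 2; abel)
        (fun a b c h => nonneg_of_zcoeff_ne_zero h)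
        (zcoeff_jac_cocycle halt hP hW hJ fun _ _ _ => rfl)
      exact ⟨q, fun _ => hq⟩
    · exact ⟨fun _ _ => 0, fun h => absurd h hW⟩
  choose q hq using hq
  set f : Fin n → Fin n → (Fin n → ℤ) → R :=
    fun a b W => if W ∈ T.carrier m then q W a b else 0 with hf
  set Q : Fin n → Fin n → MvPolynomial (Fin n) R :=
    fun a b => polyOf 2 (unitWeight a + unitWeight b) (f a b) with hQ
  have hQmem : ∀ a b, Q a b ∈ filt T ε m (unitWeight a + unitWeight b) := by
    intro a b
    refine polyOf_mem_filt fun w => ?_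
    simp only [hf]
    split_ifs with hw
    · exact (hq w hw).2.1 a b
    · exact zero_mem _
  have hQs : ∀ a b, Q a b = -Q b a := by
    intro a b
    simp only [hQ, polyOf]
    rw [← Finset.sum_neg_distrib]
    refine Finset.sum_congr rfl fun s _ => ?_
    rw [← map_neg, add_comm (unitWeight a)]
    congr 1
    simp only [hf]
    split_ifs with hw
    · exact (hq _ hw).1 a b
    · simp
  have hz : ∀ W ∈ T.carrier m, ∀ a b,
      zcoeff (W + (unitWeight a + unitWeight b)) (Q a b) = q W a b := by
    intro W hW a b
    by_cases h : 0 ≤ W + (unitWeight a + unitWeight b)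
    · rw [hQ, zcoeff_polyOf h, hf]
      · simp [hW]
      · simp only [Pi.add_apply, Finset.sum_add_distrib, T.sum_eq_zero hW, sum_unitWeight]
        norm_num
    · rw [zcoeff_of_not_nonneg h]
      by_contra hne
      exact h ((hq W hW).2.2.1 a b (Ne.symm hne))
  refine ⟨Q, hQs, hQmem, fun a b c => ?_⟩
  refine mem_filt_succ ?_ fun W hW => ?_
  · have := add_mem (jac_sub_mem hP hQmem a b c) (hJ a b c)
    rwa [sub_add_cancel] at this
  · have h := zcoeff_jac_add halt hP hQs hm hQmem hW a b c
    rw [hz W hW, hz W hW, hz W hW, (hq W hW).2.2.2, map_sub] at h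
    linear_combination h

theorem exists_jacobi (halt : lam.transpose = -lam)
    {P : Fin n → Fin n → MvPolynomial (Fin n) R} (hP : IsNearToric T ε lam P)
    (hacy : ∀ m, 2 ≤ m → ∀ W ∈ T.carrier m, IsAcyclicWeight lam W)
    (hJ : ∀ a b c, jac P (X a) (X b) (X c) ∈
      filt T ε 2 (unitWeight a + unitWeight b + unitWeight c)) :
    ∃ P' : Fin n → Fin n → MvPolynomial (Fin n) R, IsNearToric T ε lam P' ∧
      (∀ a b, P' a b - P a b ∈ filt T ε 2 (unitWeight a + unitWeight b)) ∧
      ∀ a b c, jac P' (X a) (X b) (X c) = 0 := by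
  have key : ∀ k, ∃ P' : Fin n → Fin n → MvPolynomial (Fin n) R, IsNearToric T ε lam P' ∧
      (∀ a b, P' a b - P a b ∈ filt T ε 2 (unitWeight a + unitWeight b)) ∧
      ∀ a b c, jac P' (X a) (X b) (X c) ∈
        filt T ε (2 + k) (unitWeight a + unitWeight b + unitWeight c) := by
    intro k
    induction k with
    | zero => exact ⟨P, hP, fun a b => by rw [sub_self]; exact zero_mem _, hJ⟩
    | succ k ih =>
      obtain ⟨P', h1, h2, h3⟩ := ih
      obtain ⟨Q, hQs, hQ, hQJ⟩ := exists_jacobi_step halt h1 (by omega) (hacy _ (by omega)) h3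
      refine ⟨P' + Q, h1.add hQs fun a b => filt_mono (by omega) (hQ a b), fun a b => ?_, hQJ⟩
      have := add_mem (h2 a b) (filt_mono (show 2 ≤ 2 + k by omega) (hQ a b))
      rwa [sub_add_eq_add_sub] at this
  -- Jacobiators of variables are homogeneous of degree three, so one of sufficiently high order is
  -- zero.
  obtain ⟨K, hK⟩ := exists_order_bound T 3
  obtain ⟨P', h1, h2, h3⟩ := key K
  refine ⟨P', h1, h2, fun a b c => filt_eq_zero hK (by omega) ?_ ?_ (h3 a b c)⟩
  · exact add_nonneg (add_nonneg (unitWeight_nonneg a) (unitWeight_nonneg b)) (unitWeight_nonneg c)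
  · simp only [Pi.add_apply, Finset.sum_add_distrib, sum_unitWeight]
    norm_num

end Existence

/-! ### Filtered automorphisms and uniqueness -/

section Uniqueness

open MvPolynomial

variable {n : ℕ} {R : Type*} [CommRing R] [Algebra ℂ R] {T : OrderedWeights n} {ε : R}
  {lam : Matrix (Fin n) (Fin n) ℂ}

/-- Writing `φ = id + δ` on two monomials, `φ(fg) - fg = δf δg + δf g + f δg`, so the order estimate
passes from the variables to products. -/
theorem algHom_monomial_sub_mem {φ : MvPolynomial (Fin n) R →ₐ[R] MvPolynomial (Fin n) R} {m : ℕ}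
    (hφ : ∀ a, φ (X a) - X a ∈ filt T ε m (unitWeight a)) (s : Fin n →₀ ℕ) :
    φ (monomial s 1) - monomial s 1 ∈ filt T ε m (expo s) := by
  have hmon : ∀ s : Fin n →₀ ℕ, (monomial s 1 : MvPolynomial (Fin n) R) ∈ filt T ε 0 (expo s) :=
    fun s => monomial_mem_filt (by rw [sub_self]; exact one_mem_epsSpan T ε)
  have hadd : ∀ s t : Fin n →₀ ℕ, φ (monomial s 1) - monomial s 1 ∈ filt T ε m (expo s) →
      φ (monomial t 1) - monomial t 1 ∈ filt T ε m (expo t) →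
      φ (monomial (s + t) 1) - monomial (s + t) 1 ∈ filt T ε m (expo (s + t)) := by
    intro s t hs ht
    have h1 : (monomial (s + t) 1 : MvPolynomial (Fin n) R) = monomial s 1 * monomial t 1 := by
      rw [monomial_mul, one_mul]
    have h2 : φ (monomial (s + t) 1) - monomial (s + t) 1 =
        (φ (monomial s 1) - monomial s 1) * (φ (monomial t 1) - monomial t 1) +
        (φ (monomial s 1) - monomial s 1) * monomial t 1 +
        monomial s 1 * (φ (monomial t 1) - monomial t 1) := by
      rw [h1, map_mul]; ring
    rw [h2, expo_add]
    exact add_mem (add_mem (filt_mono (Nat.le_add_right m m) (mul_mem_filt hs ht))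
      (mul_mem_filt' hs (hmon t) (add_zero m).symm rfl))
      (mul_mem_filt' (hmon s) ht (zero_add m).symm rfl)
  have hzero : φ (monomial 0 1) - monomial 0 1 ∈ filt T ε m (expo (0 : Fin n →₀ ℕ)) := by
    rw [show (monomial 0 1 : MvPolynomial (Fin n) R) = 1 from rfl, map_one, sub_self]
    exact zero_mem _
  induction s using Finsupp.induction_linear with
  | zero => exact hzero
  | add s t hs ht => exact hadd s t hs ht
  | single a k =>
    induction k with
    | zero => rw [Finsupp.single_zero]; exact hzero
    | succ k ih =>
      rw [Finsupp.single_add]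
      refine hadd _ _ ih ?_
      rw [expo_single]
      exact hφ a

theorem algHom_sub_mem {φ : MvPolynomial (Fin n) R →ₐ[R] MvPolynomial (Fin n) R} {m p r : ℕ}
    (hφ : ∀ a, φ (X a) - X a ∈ filt T ε m (unitWeight a)) {u : Fin n → ℤ}
    {f : MvPolynomial (Fin n) R} (hf : f ∈ filt T ε p u) (hr : r = p + m) :
    φ f - f ∈ filt T ε r u := by
  subst hr
  have h1 : φ f - f =
      ∑ s ∈ f.support, C (coeff s f) * (φ (monomial s 1) - monomial s 1) := by
    conv_lhs => rw [f.as_sum]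
    rw [map_sum, ← Finset.sum_sub_distrib]
    refine Finset.sum_congr rfl fun s _ => ?_
    rw [mul_sub, C_mul_monomial, mul_one, ← smul_eq_C_mul, ← map_smul, smul_monomial,
      smul_eq_mul, mul_one]
  rw [h1]
  refine Submodule.sum_mem _ fun s _ => ?_
  refine mul_mem_filt' (u := u - expo s) ?_ (algHom_monomial_sub_mem hφ s) rfl (by abel)
  rw [← monomial_zero']
  refine monomial_mem_filt ?_
  rw [expo_zero, zero_sub, neg_sub]
  exact hf s

theorem algHom_mem {φ : MvPolynomial (Fin n) R →ₐ[R] MvPolynomial (Fin n) R}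
    (hφ : ∀ a, φ (X a) - X a ∈ filt T ε 0 (unitWeight a)) {p : ℕ} {u : Fin n → ℤ}
    {f : MvPolynomial (Fin n) R} (hf : f ∈ filt T ε p u) : φ f ∈ filt T ε p u := by
  have := add_mem (algHom_sub_mem hφ hf rfl) hf
  rwa [sub_add_cancel] at this

/-- The linear substitution with matrix `g`. -/
noncomputable def linearSubst {R : Type*} [CommRing R] (g : Matrix (Fin n) (Fin n) R) :
    MvPolynomial (Fin n) R →ₐ[R] MvPolynomial (Fin n) R :=
  aeval fun a => ∑ d, C (g a d) * X d

theorem linearSubst_X {R : Type*} [CommRing R] (g : Matrix (Fin n) (Fin n) R) (a : Fin n) :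
    linearSubst g (X a) = ∑ d, C (g a d) * X d := by
  rw [linearSubst, aeval_X]

theorem linearSubst_comp {R : Type*} [CommRing R] {g h : Matrix (Fin n) (Fin n) R}
    (hgh : h * g = 1) : (linearSubst g).comp (linearSubst h) = AlgHom.id R _ := by
  refine MvPolynomial.algHom_ext fun a => ?_
  rw [AlgHom.comp_apply, linearSubst_X, map_sum]
  have : ∀ d ∈ Finset.univ, linearSubst g (C (h a d) * X d) =
      ∑ e, C (h a d * g d e) * X e := by
    intro d _
    rw [← smul_eq_C_mul, map_smul, linearSubst_X, smul_eq_C_mul, Finset.mul_sum]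
    exact Finset.sum_congr rfl fun e _ => by rw [C_mul, mul_assoc]
  rw [Finset.sum_congr rfl this, Finset.sum_comm]
  have h2 : ∀ e ∈ Finset.univ, ∑ d, C (h a d * g d e) * X e =
      (C ((1 : Matrix (Fin n) (Fin n) R) a e) * X e : MvPolynomial (Fin n) R) := by
    intro e _
    rw [← Finset.sum_mul, ← map_sum, ← hgh, Matrix.mul_apply]
  rw [Finset.sum_congr rfl h2]
  simp [Matrix.one_apply]

/-- The automorphism given by an invertible linear substitution. -/
noncomputable def linearEquiv {R : Type*} [CommRing R] (g h : Matrix (Fin n) (Fin n) R)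
    (hgh : g * h = 1) (hhg : h * g = 1) :
    MvPolynomial (Fin n) R ≃ₐ[R] MvPolynomial (Fin n) R :=
  AlgEquiv.ofAlgHom (linearSubst g) (linearSubst h) (linearSubst_comp hhg) (linearSubst_comp hgh)

theorem sum_C_mul_X_mem {N : Fin n → R} {m : ℕ} {a : Fin n}
    (hN : ∀ d, N d ∈ epsSpan T ε m (unitWeight d - unitWeight a)) :
    ∑ d, C (N d) * X d ∈ filt T ε m (unitWeight a) := by
  refine Submodule.sum_mem _ fun d _ => ?_
  rw [C_mul_X_eq_monomial]
  refine monomial_mem_filt ?_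
  rw [expo_single]
  exact hN d

/-- The entries of `N ^ k` have order at least `k`, while differences of unit weights are bounded.
So `N` is nilpotent, and the geometric series inverts `1 + N` within the filtration. -/
theorem exists_inverse_of_epsSpan {N : Matrix (Fin n) (Fin n) R} {m : ℕ} (hm : 1 ≤ m)
    (hN : ∀ a d, N a d ∈ epsSpan T ε m (unitWeight d - unitWeight a)) :
    ∃ h : Matrix (Fin n) (Fin n) R, (1 + N) * h = 1 ∧ h * (1 + N) = 1 ∧
      ∀ a d, (h - 1) a d ∈ epsSpan T ε 1 (unitWeight d - unitWeight a) := by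
  have hmul : ∀ (A B : Matrix (Fin n) (Fin n) R) (p q : ℕ),
      (∀ a d, A a d ∈ epsSpan T ε p (unitWeight d - unitWeight a)) →
      (∀ a d, B a d ∈ epsSpan T ε q (unitWeight d - unitWeight a)) →
      ∀ a d, (A * B) a d ∈ epsSpan T ε (p + q) (unitWeight d - unitWeight a) := by
    intro A B p q hA hB a d
    rw [Matrix.mul_apply]
    refine Submodule.sum_mem _ fun e _ => ?_
    have := mul_mem_epsSpan (hA a e) (hB e d)
    rwa [show unitWeight e - unitWeight a + (unitWeight d - unitWeight e) =
      unitWeight d - unitWeight a by abel] at this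
  have hneg : ∀ a d, (-N) a d ∈ epsSpan T ε 1 (unitWeight d - unitWeight a) := fun a d =>
    neg_mem (epsSpan_mono T ε hm _ (hN a d))
  have hpow : ∀ k, ∀ a d, ((-N) ^ k) a d ∈ epsSpan T ε k (unitWeight d - unitWeight a) := by
    intro k
    induction k with
    | zero =>
      intro a d
      rw [pow_zero, Matrix.one_apply]
      split_ifs with h
      · rw [h, sub_self]; exact one_mem_epsSpan T ε
      · exact zero_mem _
    | succ k ih =>
      rw [pow_succ]
      exact hmul _ _ _ _ ih hneg
  obtain ⟨K, hK⟩ := exists_order_bound T 1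
  have hzero : (-N) ^ K = 0 := by
    ext a d
    rw [Matrix.zero_apply]
    by_contra hne
    obtain ⟨k, hk, hw⟩ := exists_of_mem_epsSpan (hpow K a d) hne
    refine hK k hk _ hw fun i => ?_
    exact abs_le_of_sum_le (unitWeight_nonneg d) (unitWeight_nonneg a) (sum_unitWeight d).le
      (sum_unitWeight a).le i
  set h := ∑ i ∈ Finset.range K, (-N) ^ i with hh
  have h1 : (1 + N) * h = 1 := by
    have := mul_neg_geom_sum (-N) K
    rwa [hzero, sub_zero, sub_neg_eq_add] at this
  have h2 : h * (1 + N) = 1 := by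
    have := geom_sum_mul_neg (-N) K
    rwa [hzero, sub_zero, sub_neg_eq_add] at this
  refine ⟨h, h1, h2, fun a d => ?_⟩
  have h3 : h - 1 = -N * h := by
    rw [add_mul, one_mul] at h1
    rw [← h1]; noncomm_ring
  rw [h3]
  refine hmul _ _ 1 0 hneg (fun a d => ?_) a d
  rw [hh, Matrix.sum_apply]
  exact Submodule.sum_mem _ fun i _ => epsSpan_mono T ε (Nat.zero_le i) _ (hpow i a d)

theorem exists_unipotent_equiv {N : Matrix (Fin n) (Fin n) R} {m : ℕ} (hm : 1 ≤ m)
    (hN : ∀ a d, N a d ∈ epsSpan T ε m (unitWeight d - unitWeight a)) :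
    ∃ φ : MvPolynomial (Fin n) R ≃ₐ[R] MvPolynomial (Fin n) R,
      (∀ a, φ (X a) = X a + ∑ d, C (N a d) * X d) ∧
      ∀ a, φ.symm (X a) - X a ∈ filt T ε 1 (unitWeight a) := by
  obtain ⟨h, h1, h2, h3⟩ := exists_inverse_of_epsSpan hm hN
  have hX : ∀ (M : Matrix (Fin n) (Fin n) R) a,
      linearSubst (1 + M) (X a) = X a + ∑ d, C (M a d) * X d := by
    intro M a
    rw [linearSubst_X]
    simp [Matrix.one_apply, add_mul, Finset.sum_add_distrib]
  refine ⟨linearEquiv (1 + N) h h1 h2, fun a => hX N a, fun a => ?_⟩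
  change linearSubst h (X a) - X a ∈ _
  rw [show h = 1 + (h - 1) by abel, hX, add_sub_cancel_left]
  exact sum_C_mul_X_mem (h3 a)

/-- Transport of a Poisson bracket along an automorphism. -/
def PoissonBracket.conj {R A : Type*} [CommRing R] [CommRing A] [Algebra R A]
    (B : PoissonBracket R A) (φ : A ≃ₐ[R] A) : PoissonBracket R A where
  bracket := LinearMap.mk₂ R (fun f g => φ (B.bracket (φ.symm f) (φ.symm g)))
    (by intro f f' g; simp) (by intro c f g; simp) (by intro f g g'; simp) (by intro c f g; simp)
  bracket_self f := by simp [B.bracket_self]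
  jacobi f g h := by
    simp only [LinearMap.mk₂_apply, AlgEquiv.symm_apply_apply]
    rw [← map_add, ← map_add, B.jacobi, map_zero]
  leibniz f g h := by simp [B.leibniz]

theorem PoissonBracket.conj_bracket {R A : Type*} [CommRing R] [CommRing A] [Algebra R A]
    (B : PoissonBracket R A) (φ : A ≃ₐ[R] A) (f g : A) :
    (B.conj φ).bracket f g = φ (B.bracket (φ.symm f) (φ.symm g)) := rfl

theorem intertwines_conj {R A : Type*} [CommRing R] [CommRing A] [Algebra R A]
    (B : PoissonBracket R A) (φ : A ≃ₐ[R] A) : Intertwines φ B (B.conj φ) := by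
  intro f g
  rw [B.conj_bracket, φ.symm_apply_apply, φ.symm_apply_apply]

theorem neg_one_le_of_two {W : Fin n → ℤ} {a b : Fin n} (hab : a ≠ b)
    (h : 0 ≤ W + (unitWeight a + unitWeight b)) :
    (∀ i, -1 ≤ W i) ∧ (Finset.univ.filter fun i => W i = -1).card ≤ 3 := by
  classical
  have key : ∀ i, -1 ≤ W i ∧ (W i = -1 → i = a ∨ i = b) := by
    intro i
    have hi := h i
    simp only [Pi.zero_apply, Pi.add_apply, unitWeight, Pi.single_apply] at hi
    constructor
    · split_ifs at hi <;> simp_all <;> omega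
    · intro hW
      by_contra! hne
      simp [hne, hW] at hi
  refine ⟨fun i => (key i).1, ?_⟩
  have hsub : (Finset.univ.filter fun i => W i = -1) ⊆ {a, b} := by
    intro i hi
    have := (key i).2 (Finset.mem_filter.mp hi).2
    simpa using this
  exact (Finset.card_le_card hsub).trans (Finset.card_le_two.trans (by norm_num))

/-- The contraction of `exists_primitive_of_cocycle` one degree lower: `v_a = -q_ka / (λW)_k`. -/
theorem exists_vector_of_cocycle {W : Fin n → ℤ} (hW : IsAcyclicWeight lam W)
    (E : Submodule ℂ R) {q : Fin n → Fin n → R} (hE : ∀ a b, q a b ∈ E)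
    (hs : ∀ a b, q a b = -q b a)
    (hpos : ∀ a b, q a b ≠ 0 → 0 ≤ W + (unitWeight a + unitWeight b))
    (hco : ∀ a b c, pairing R lam W a * q b c + pairing R lam W b * q c a +
      pairing R lam W c * q a b = 0) :
    ∃ v : Fin n → R, (∀ a, v a ∈ E) ∧ (∀ a, v a ≠ 0 → 0 ≤ W + unitWeight a) ∧
      ∀ a b, pairing R lam W a * v b - pairing R lam W b * v a = -q a b := by
  by_cases h0 : ∀ a b, q a b = 0
  · exact ⟨fun _ => 0, by simp, by simp, by simp [h0]⟩
  push Not at h0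
  obtain ⟨a₀, b₀, hne⟩ := h0
  have hab : a₀ ≠ b₀ := by rintro rfl; exact hne (eq_zero_of_eq_neg (hs _ _))
  obtain ⟨hge, hcard⟩ := neg_one_le_of_two hab (hpos _ _ hne)
  obtain ⟨k, hk, hak⟩ := hW hge hcard
  set x := lam.mulVec (fun a => (W a : ℂ)) k with hx
  refine ⟨fun a => -(x⁻¹ • q k a), fun a => ?_, fun a h => ?_, fun a b => ?_⟩
  · exact neg_mem (Submodule.smul_mem _ _ (hE _ _))
  · refine nonneg_of_add_unitWeight (unitWeight_nonneg a) hge hk ?_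
    refine hpos _ _ fun h' => h ?_
    change -(x⁻¹ • q k a) = 0
    rw [h', smul_zero, neg_zero]
  · have h := hco k a b
    have hpk : pairing R lam W k = algebraMap ℂ R x := rfl
    have hinv : algebraMap ℂ R x⁻¹ * algebraMap ℂ R x = 1 := by
      rw [← map_mul, inv_mul_cancel₀ hak, map_one]
    rw [hpk, hs b k] at h
    simp only [Algebra.smul_def]
    linear_combination algebraMap ℂ R x⁻¹ * h - q a b * hinv

end Uniqueness

/-! ### Intertwining brackets that agree to first order -/

section UniquenessStep

open MvPolynomial

variable {n : ℕ} {R : Type*} [CommRing R] [Algebra ℂ R] {T : OrderedWeights n} {ε : R}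
  {lam : Matrix (Fin n) (Fin n) ℂ}

theorem exists_eq_unitWeight {w : Fin n → ℤ} (h : 0 ≤ w) (hs : ∑ i, w i = 1) :
    ∃ d, w = unitWeight d := by
  have hne : ∃ d, w d ≠ 0 := by
    by_contra! h0
    simp [h0] at hs
  obtain ⟨d, hd⟩ := hne
  have hd1 : 1 ≤ w d := by
    have : 0 ≤ w d := h d
    omega
  refine ⟨d, ?_⟩
  rw [← Finset.add_sum_erase _ _ (Finset.mem_univ d)] at hs
  have hnn : ∀ i ∈ Finset.univ.erase d, 0 ≤ w i := fun i _ => h i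
  have h0 : ∑ i ∈ Finset.univ.erase d, w i = 0 := by
    have := Finset.sum_nonneg hnn
    omega
  rw [Finset.sum_eq_zero_iff_of_nonneg hnn] at h0
  ext i
  by_cases hi : i = d
  · subst hi
    rw [Finset.sum_eq_zero h0] at hs
    simp only [unitWeight, Pi.single_eq_same]
    omega
  · rw [h0 i (by simp [hi])]
    simp [unitWeight, hi]

theorem zcoeff_sum_C_mul_X {R : Type*} [CommRing R] (N : Fin n → R) (d : Fin n) :
    zcoeff (unitWeight d) (∑ e, C (N e) * X e) = N d := by
  classical
  rw [← expo_single, zcoeff_expo, coeff_sum, Finset.sum_eq_single d]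
  · rw [coeff_C_mul, coeff_X, if_pos rfl, mul_one]
  · intro e _ he
    rw [coeff_C_mul, coeff_X, if_neg, mul_zero]
    exact fun h => he (Finsupp.single_left_injective one_ne_zero h)
  · simp

theorem IsNearToric.conj {P : PoissonBracket R (MvPolynomial (Fin n) R)}
    (hP : IsNearToric T ε lam P.matrix)
    {φ : MvPolynomial (Fin n) R ≃ₐ[R] MvPolynomial (Fin n) R}
    (hφ : ∀ a, φ (X a) - X a ∈ filt T ε 1 (unitWeight a))
    (hψ : ∀ a, φ.symm (X a) - X a ∈ filt T ε 1 (unitWeight a)) :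
    IsNearToric T ε lam (P.conj φ).matrix := by
  refine ⟨fun a b => (P.conj φ).swap _ _, fun a b => ?_⟩
  have h1 : br P.matrix (φ.symm (X a)) (φ.symm (X b)) - P.matrix a b ∈
      filt T ε 1 (unitWeight a + unitWeight b) := by
    have h2 : br P.matrix (φ.symm (X a)) (φ.symm (X b)) - P.matrix a b =
        br P.matrix (X a) (φ.symm (X b) - X b) + br P.matrix (φ.symm (X a) - X a) (X b) +
        br P.matrix (φ.symm (X a) - X a) (φ.symm (X b) - X b) := by
      rw [← br_X_X P.matrix a b]
      conv_lhs => rw [← add_sub_cancel (X a) (φ.symm (X a)), ← add_sub_cancel (X b) (φ.symm (X b))]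
      simp only [br_add_left, br_add_right]
      ring
    rw [h2]
    exact add_mem (add_mem (br_mem_filt hP.mem (X_mem_filt a) (hψ b) (by ring) rfl)
      (br_mem_filt hP.mem (hψ a) (X_mem_filt b) (by ring) rfl))
      (filt_mono one_le_two (br_mem_filt hP.mem (hψ a) (hψ b) (by ring) rfl))
  have h3 : (P.conj φ).matrix a b - toricMatrix R lam a b =
      φ (br P.matrix (φ.symm (X a)) (φ.symm (X b)) - P.matrix a b) +
      (φ (P.matrix a b) - P.matrix a b) + (P.matrix a b - toricMatrix R lam a b) := by
    rw [PoissonBracket.matrix, P.conj_bracket, P.eq_br, map_sub]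
    ring
  rw [h3]
  have hφ0 : ∀ a, φ.toAlgHom (X a) - X a ∈ filt T ε 0 (unitWeight a) := fun a =>
    filt_mono zero_le_one (hφ a)
  exact add_mem (add_mem (algHom_mem hφ0 h1)
    (algHom_sub_mem (φ := φ.toAlgHom) hφ (hP.mem a b) (by ring))) (hP.sub_mem a b)

/-- Both Jacobiators vanish, so the leading part of `P' - P` is closed and is, up to sign, the
differential of a vector field `v`. Weights have sum zero, so `v` is linear, and the substitution
`x_a ↦ x_a + η_a` with leading part `v` moves `P` to `P'` up to order `m`. -/
theorem exists_conj_step (halt : lam.transpose = -lam)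
    {P P' : PoissonBracket R (MvPolynomial (Fin n) R)} (hP : IsNearToric T ε lam P.matrix)
    {m : ℕ} (hm : 1 ≤ m) (hacy : ∀ W ∈ T.carrier m, IsAcyclicWeight lam W)
    (hD : ∀ a b, P'.matrix a b - P.matrix a b ∈ filt T ε m (unitWeight a + unitWeight b)) :
    ∃ φ : MvPolynomial (Fin n) R ≃ₐ[R] MvPolynomial (Fin n) R,
      (∀ a, φ (X a) - X a ∈ filt T ε 1 (unitWeight a)) ∧
      IsNearToric T ε lam (P.conj φ).matrix ∧
      ∀ a b, P'.matrix a b - (P.conj φ).matrix a b ∈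
        filt T ε (m + 1) (unitWeight a + unitWeight b) := by
  classical
  set Q : Fin n → Fin n → MvPolynomial (Fin n) R := fun a b => P'.matrix a b - P.matrix a b with hQ
  have hQs : ∀ a b, Q a b = -Q b a := by
    intro a b
    simp only [hQ, PoissonBracket.matrix]
    rw [P'.swap, P.swap]; ring
  have hPQ : P.matrix + Q = P'.matrix := by
    ext1 a; ext1 b
    exact add_sub_cancel _ _
  have hv : ∀ W : Fin n → ℤ, ∃ v : Fin n → R, W ∈ T.carrier m →
      (∀ a, v a ∈ epsSpan T ε m W) ∧ (∀ a, v a ≠ 0 → 0 ≤ W + unitWeight a) ∧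
      ∀ a b, pairing R lam W a * v b - pairing R lam W b * v a =
        -zcoeff (W + (unitWeight a + unitWeight b)) (Q a b) := by
    intro W
    by_cases hW : W ∈ T.carrier m
    · obtain ⟨v, hv⟩ := exists_vector_of_cocycle (hacy W hW) (epsSpan T ε m W)
        (q := fun a b => zcoeff (W + (unitWeight a + unitWeight b)) (Q a b))
        (fun a b => zcoeff_mem (hD a b))
        (fun a b => by rw [hQs, map_neg, add_comm (unitWeight a)])
        (fun a b h => nonneg_of_zcoeff_ne_zero h)
        (fun a b c => by
          have := zcoeff_jac_add halt hP hQs hm hD hW a b c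
          rw [hPQ, P.jac_eq_zero, P'.jac_eq_zero, sub_zero, map_zero] at this
          exact this.symm)
      exact ⟨v, fun _ => hv⟩
    · exact ⟨fun _ => 0, fun h => absurd h hW⟩
  choose v hv using hv
  set N : Matrix (Fin n) (Fin n) R := fun a d =>
    if unitWeight d - unitWeight a ∈ T.carrier m then v (unitWeight d - unitWeight a) a else 0
    with hN
  have hNmem : ∀ a d, N a d ∈ epsSpan T ε m (unitWeight d - unitWeight a) := by
    intro a d
    simp only [hN]
    split_ifs with h
    · exact (hv _ h).1 a
    · exact zero_mem _
  obtain ⟨φ, hφX, hψ⟩ := exists_unipotent_equiv hm hNmem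
  set η : Fin n → MvPolynomial (Fin n) R := fun a => ∑ d, C (N a d) * X d with hη
  have hηmem : ∀ a, η a ∈ filt T ε m (unitWeight a) := fun a => sum_C_mul_X_mem (hNmem a)
  have hηz : ∀ W ∈ T.carrier m, ∀ a, zcoeff (W + unitWeight a) (η a) = v W a := by
    intro W hW a
    by_cases h : 0 ≤ W + unitWeight a
    · obtain ⟨d, hd⟩ := exists_eq_unitWeight h (by
        simp only [Pi.add_apply, Finset.sum_add_distrib, T.sum_eq_zero hW, sum_unitWeight,
          zero_add])
      have hWd : unitWeight d - unitWeight a = W := by rw [← hd, add_sub_cancel_right]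
      rw [hd, hη, zcoeff_sum_C_mul_X]
      simp only [hN, hWd, if_pos hW]
    · rw [zcoeff_of_not_nonneg h]
      by_contra hne
      exact h ((hv W hW).2.1 a (Ne.symm hne))
  have hφm : ∀ a, φ (X a) - X a ∈ filt T ε m (unitWeight a) := fun a => by
    rw [hφX, add_sub_cancel_left]; exact hηmem a
  have hφ1 : ∀ a, φ (X a) - X a ∈ filt T ε 1 (unitWeight a) := fun a => filt_mono hm (hφm a)
  have hP'' := hP.conj hφ1 hψ
  refine ⟨φ, hφ1, hP'', fun a b => ?_⟩
  set M := (P.conj φ).matrix with hM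
  have hbr : φ (P.matrix a b) = br M (X a + η a) (X b + η b) := by
    have := intertwines_conj P φ (X a) (X b)
    rw [(P.conj φ).eq_br, hφX, hφX] at this
    exact this
  have hφt : φ (toricMatrix R lam a b) =
      C (algebraMap ℂ R (lam a b)) * (X a + η a) * (X b + η b) := by
    rw [toricMatrix, map_mul, map_mul, hφX, hφX]
    congr 2
    exact φ.commutes _
  -- These terms are quadratic in `η`, or combine `η` with the nontoric part of `P`; as `m ≥ 1`,
  -- their order exceeds `m`.
  have hA : (φ (P.matrix a b - toricMatrix R lam a b) - (P.matrix a b - toricMatrix R lam a b)) +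
      C (algebraMap ℂ R (lam a b)) * (η a * η b) - br M (η a) (η b) ∈
      filt T ε (m + 1) (unitWeight a + unitWeight b) :=
    sub_mem (add_mem (algHom_sub_mem (φ := φ.toAlgHom) hφm (hP.sub_mem a b) (add_comm _ _))
      (C_mul_mem_filt _ (filt_mono (by omega) (mul_mem_filt (hηmem a) (hηmem b)))))
      (filt_mono (by omega) (br_mem_filt hP''.mem (hηmem a) (hηmem b) rfl rfl))
  -- These terms are linear in `η` or in `Q`. Each has order `m`, and at that order they cancel by
  -- the choice of `v`.
  have hB : Q a b - C (algebraMap ℂ R (lam a b)) * (X a * η b + X b * η a) - br M (X b) (η a) +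
      br M (X a) (η b) ∈ filt T ε (m + 1) (unitWeight a + unitWeight b) := by
    refine mem_filt_succ ?_ fun W hW => ?_
    · refine add_mem (sub_mem (sub_mem (hD a b) (C_mul_mem_filt _ (add_mem ?_ ?_))) ?_) ?_
      · exact mul_mem_filt' (X_mem_filt a) (hηmem b) (zero_add m).symm rfl
      · exact mul_mem_filt' (X_mem_filt b) (hηmem a) (zero_add m).symm (add_comm _ _)
      · exact br_mem_filt hP''.mem (X_mem_filt b) (hηmem a) (by ring) (add_comm _ _)
      · exact br_mem_filt hP''.mem (X_mem_filt a) (hηmem b) (by ring) rfl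
    · rw [map_add, map_sub, map_sub, ← smul_eq_C_mul, map_smul, map_add, zcoeff_X_mul,
        zcoeff_X_mul, hP''.zcoeff_br (hηmem a) hW b (by abel),
        hP''.zcoeff_br (hηmem b) hW a (by abel),
        show W + (unitWeight a + unitWeight b) - unitWeight a = W + unitWeight b by abel,
        show W + (unitWeight a + unitWeight b) - unitWeight b = W + unitWeight a by abel,
        hηz W hW, hηz W hW, pairing_unitWeight, pairing_unitWeight, smul_eq_mul]
      have hl : lam b a = -lam a b := by simpa using congrFun (congrFun halt a) b
      have := (hv W hW).2.2 a b
      rw [hl, map_neg]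
      linear_combination this
  have hfinal : P'.matrix a b - M a b =
      (Q a b - C (algebraMap ℂ R (lam a b)) * (X a * η b + X b * η a) - br M (X b) (η a) +
        br M (X a) (η b)) -
      ((φ (P.matrix a b - toricMatrix R lam a b) - (P.matrix a b - toricMatrix R lam a b)) +
        C (algebraMap ℂ R (lam a b)) * (η a * η b) - br M (η a) (η b)) := by
    rw [map_sub, hφt, hbr, br_swap hP''.swap (X b) (η a)]
    simp only [br_add_left, br_add_right, br_X_X, toricMatrix, hQ]
    ring
  rw [hfinal]
  exact sub_mem hB hA

/-- Two filtered Poisson brackets which agree to first order are intertwined by a filtered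
unipotent automorphism. -/
theorem exists_filtered_intertwiner (halt : lam.transpose = -lam)
    (hacy : ∀ m, 2 ≤ m → ∀ W ∈ T.carrier m, IsAcyclicWeight lam W)
    {P P' : PoissonBracket R (MvPolynomial (Fin n) R)} (hP : IsNearToric T ε lam P.matrix)
    (hD : ∀ a b, P'.matrix a b - P.matrix a b ∈ filt T ε 2 (unitWeight a + unitWeight b)) :
    ∃ φ : MvPolynomial (Fin n) R ≃ₐ[R] MvPolynomial (Fin n) R,
      (∀ a, φ (X a) - X a ∈ filt T ε 1 (unitWeight a)) ∧ Intertwines φ P P' := by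
  -- Brackets of two variables are quadratic. The induction is on the number `k` of orders left
  -- below this bound.
  obtain ⟨K, hK⟩ := exists_order_bound T 2
  suffices key : ∀ k m, 2 ≤ m → K ≤ m + k →
      ∀ P : PoissonBracket R (MvPolynomial (Fin n) R), IsNearToric T ε lam P.matrix →
      (∀ a b, P'.matrix a b - P.matrix a b ∈ filt T ε m (unitWeight a + unitWeight b)) →
      ∃ φ : MvPolynomial (Fin n) R ≃ₐ[R] MvPolynomial (Fin n) R,
        (∀ a, φ (X a) - X a ∈ filt T ε 1 (unitWeight a)) ∧ Intertwines φ P P' from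
    key K 2 le_rfl (by omega) P hP hD
  intro k
  induction k with
  | zero =>
    intro m _ hKm P _ hD
    have heq : P'.matrix = P.matrix := by
      ext1 a; ext1 b
      refine sub_eq_zero.mp (filt_eq_zero hK (by omega) ?_ ?_ (hD a b))
      · exact add_nonneg (unitWeight_nonneg a) (unitWeight_nonneg b)
      · simp only [Pi.add_apply, Finset.sum_add_distrib, sum_unitWeight]
        norm_num
    refine ⟨AlgEquiv.refl, fun a => ?_, fun f g => ?_⟩
    · rw [AlgEquiv.coe_refl, id, sub_self]; exact zero_mem _
    · rw [P.eq_br, P'.eq_br, heq]; rfl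
  | succ k ih =>
    intro m hm hKm P hP hD
    obtain ⟨φ, h1, h2, h3⟩ := exists_conj_step halt hP (by omega) (hacy m hm) hD
    obtain ⟨φ', h1', h2'⟩ := ih (m + 1) (by omega) (by omega) (P.conj φ) h2 h3
    refine ⟨φ.trans φ', fun a => ?_, fun f g => ?_⟩
    · have h4 : (φ.trans φ') (X a) - X a =
          φ' (φ (X a) - X a) + (φ' (X a) - X a) := by
        rw [AlgEquiv.trans_apply, map_sub]; ring
      rw [h4]
      exact add_mem (algHom_mem (φ := φ'.toAlgHom) (fun a => filt_mono zero_le_one (h1' a)) (h1 a))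
        (h1' a)
    · rw [AlgEquiv.trans_apply, AlgEquiv.trans_apply, AlgEquiv.trans_apply, ← h2',
        intertwines_conj P φ f g]

end UniquenessStep

/-! ### Brackets of the deformed form -/

section Deformed

open MvPolynomial

variable {n : ℕ} {R : Type*} [CommRing R] [Algebra ℂ R] {lam β : Matrix (Fin n) (Fin n) ℂ}
  {G : SimpleGraph (Fin n)}

/-- The weights `Θ_m` of a forest of smoothable edges. -/
def thetaWeights (hβ : IsBiresidueMatrix lam β) (hG : G.IsAcyclic)
    (hb : ∀ i j, G.Adj i j → β i j ≠ 0) : OrderedWeights n where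
  carrier := Theta β G
  zero_mem := by rw [Theta_zero]; rfl
  add_mem := Theta_add_mem
  sum_eq_zero := sum_eq_zero_of_mem_Theta hβ
  disjoint := Theta_disjoint hβ hG hb

theorem isAcyclicWeight_of_mem_Theta (hβ : IsBiresidueMatrix lam β) (hG : G.IsAcyclic)
    (hsm : ∀ i j, G.Adj i j → IsSmoothableEdge β i j) {m : ℕ} (hm : 2 ≤ m) {W : Fin n → ℤ}
    (hW : W ∈ Theta β G m) : IsAcyclicWeight lam W :=
  exists_mulVec_ne_zero_of_mem_Theta hβ hG hsm hm hW

theorem coeff_C_mul_X_mul_X {R : Type*} [CommRing R] (s : Fin n →₀ ℕ) (r : R) (k l : Fin n) :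
    coeff s (C r * X k * X l) =
      if Finsupp.single k 1 + Finsupp.single l 1 = s then r else 0 := by
  classical
  rw [C_mul_X_eq_monomial, X, monomial_mul, coeff_monomial, mul_one]

theorem single_add_single_injective {k l k' l' : Fin n} (h : k ≤ l) (h' : k' ≤ l')
    (heq : (Finsupp.single k' 1 + Finsupp.single l' 1 : Fin n →₀ ℕ) =
      Finsupp.single k 1 + Finsupp.single l 1) : k' = k ∧ l' = l := by
  rcases (Finsupp.single_add_single_eq_single_add_single one_ne_zero one_ne_zero).mp heq with
    h1 | ⟨_, h1, h2⟩ | ⟨h1, _⟩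
  · exact h1
  · subst h1 h2
    exact ⟨le_antisymm h' h, le_antisymm h h'⟩
  · exact absurd h1 (by norm_num)

theorem exists_single_add_single {s : Fin n →₀ ℕ} (hs : ∑ i, expo s i = 2) :
    ∃ k l, k ≤ l ∧ s = Finsupp.single k 1 + Finsupp.single l 1 := by
  have hne : ∃ k, s k ≠ 0 := by
    by_contra! h0
    simp [expo, h0] at hs
  obtain ⟨k, hk⟩ := hne
  have hle : Finsupp.single k 1 ≤ s := by
    rw [Finsupp.single_le_iff]; omega
  have hsplit : s = Finsupp.single k 1 + (s - Finsupp.single k 1) := (add_tsub_cancel_of_le hle).symm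
  have hsum : ∑ i, expo (s - Finsupp.single k 1) i = 1 := by
    rw [hsplit, expo_add, expo_single] at hs
    simp only [Pi.add_apply, Finset.sum_add_distrib, sum_unitWeight] at hs
    omega
  obtain ⟨l, hl⟩ := exists_eq_unitWeight (expo_nonneg _) hsum
  rw [← expo_single] at hl
  rw [expo_injective hl] at hsplit
  rcases le_total k l with h | h
  · exact ⟨k, l, h, hsplit⟩
  · exact ⟨l, k, h, by rw [hsplit, add_comm]⟩

open Classical in
/-- The part of order `m` of the deformed bracket of two variables. -/
noncomputable def quadTerm (R : Type*) [CommRing R] [Algebra ℂ R]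
    (β : Matrix (Fin n) (Fin n) ℂ) (G : SimpleGraph (Fin n)) (m : ℕ)
    (c : Fin n → Fin n → ℂ) (a b : Fin n) : MvPolynomial (Fin n) R :=
  ∑ k, ∑ l, if k ≤ l ∧ quadWeight a b k l ∈ Theta β G m then
    C (algebraMap ℂ R (c k l)) * X k * X l else 0

open Classical in
theorem coeff_quadTerm (m : ℕ) (c : Fin n → Fin n → ℂ) (a b : Fin n) {k l : Fin n} (h : k ≤ l) :
    coeff (Finsupp.single k 1 + Finsupp.single l 1) (quadTerm R β G m c a b) =
      if quadWeight a b k l ∈ Theta β G m then algebraMap ℂ R (c k l) else 0 := by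
  have h1 : ∀ k' l', coeff (Finsupp.single k 1 + Finsupp.single l 1)
      (if k' ≤ l' ∧ quadWeight a b k' l' ∈ Theta β G m then
        (C (algebraMap ℂ R (c k' l')) * X k' * X l' : MvPolynomial (Fin n) R) else 0) =
      if k' = k then if l' = l then
        (if quadWeight a b k l ∈ Theta β G m then algebraMap ℂ R (c k l) else 0) else 0 else 0 := by
    intro k' l'
    by_cases hkl : k' = k ∧ l' = l
    · obtain ⟨rfl, rfl⟩ := hkl
      simp only [h, true_and, if_true]
      split_ifs
      · rw [coeff_C_mul_X_mul_X, if_pos rfl]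
      · exact coeff_zero _
    · have h2 : (if k' = k then if l' = l then
        (if quadWeight a b k l ∈ Theta β G m then algebraMap ℂ R (c k l) else 0)
          else 0 else 0) = 0 := by
        split_ifs <;> simp_all
      rw [h2]
      split_ifs with h3
      · rw [coeff_C_mul_X_mul_X, if_neg]
        exact fun h4 => hkl (single_add_single_injective h h3.1 h4)
      · exact coeff_zero _
  rw [quadTerm]
  simp only [coeff_sum, h1]
  simp

theorem expo_quad (a b k l : Fin n) :
    expo (Finsupp.single k 1 + Finsupp.single l 1) - (unitWeight a + unitWeight b) =
      quadWeight a b k l := by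
  rw [expo_add, expo_single, expo_single, quadWeight]; abel

theorem C_mul_quadTerm_mem {T : OrderedWeights n} {ε r : R} {p m : ℕ}
    (hr : ∀ w ∈ Theta β G m, r ∈ epsSpan T ε p w) (c : Fin n → Fin n → ℂ) (a b : Fin n) :
    C r * quadTerm R β G m c a b ∈ filt T ε p (unitWeight a + unitWeight b) := by
  classical
  rw [quadTerm, Finset.mul_sum]
  refine Submodule.sum_mem _ fun k _ => ?_
  rw [Finset.mul_sum]
  refine Submodule.sum_mem _ fun l _ => ?_
  split_ifs with h
  · have hC : (C r : MvPolynomial (Fin n) R) ∈ filt T ε p (-quadWeight a b k l) := by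
      rw [← monomial_zero']
      refine monomial_mem_filt ?_
      rw [expo_zero, zero_sub, neg_neg]
      exact hr _ h.2
    refine mul_mem_filt' (q := 0) hC (v := unitWeight k + unitWeight l) ?_ (add_zero p).symm ?_
    · rw [mul_assoc]
      exact C_mul_mem_filt _ (mul_mem_filt' (X_mem_filt k) (X_mem_filt l) (zero_add 0).symm rfl)
    · rw [quadWeight]; abel
  · rw [mul_zero]; exact zero_mem _

open Classical in
/-- The value of `γ` at the edge whose smoothable weight is `w`. -/
noncomputable def leadValue (β : Matrix (Fin n) (Fin n) ℂ) (G : SimpleGraph (Fin n))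
    (γ : Sym2 (Fin n) → ℂ) (w : Fin n → ℤ) : ℂ :=
  if h : ∃ e : Fin n × Fin n, G.Adj e.1 e.2 ∧ IsSmoothableWeight β e.1 e.2 w then
    γ s(h.choose.1, h.choose.2) else 0

/-- The entries equal to `-1` mark exactly the endpoints. -/
theorem IsSmoothableWeight.edge_unique {i j i' j' : Fin n} {w : Fin n → ℤ}
    (h : IsSmoothableWeight β i j w) (h' : IsSmoothableWeight β i' j' w) :
    s(i, j) = s(i', j') := by
  have key : ∀ k, w k = -1 → k = i' ∨ k = j' := by
    intro k hk
    by_contra! hne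
    have := h'.nonneg hne.1 hne.2
    omega
  have hij := h.1
  rcases key i h.2.1 with h1 | h1 <;> rcases key j h.2.2.1 with h2 | h2
  · exact absurd (h1.trans h2.symm) hij
  · rw [h1, h2]
  · rw [h1, h2, Sym2.eq_swap]
  · exact absurd (h1.trans h2.symm) hij

theorem leadValue_eq (γ : Sym2 (Fin n) → ℂ) {i j : Fin n} {w : Fin n → ℤ} (hij : G.Adj i j)
    (hw : IsSmoothableWeight β i j w) : leadValue β G γ w = γ s(i, j) := by
  have h : ∃ e : Fin n × Fin n, G.Adj e.1 e.2 ∧ IsSmoothableWeight β e.1 e.2 w :=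
    ⟨(i, j), hij, hw⟩
  rw [leadValue, dif_pos h, h.choose_spec.2.edge_unique hw]

variable (R) in
/-- The part of first order of the deformed bracket of two variables. -/
noncomputable def leadTerm (β : Matrix (Fin n) (Fin n) ℂ) (G : SimpleGraph (Fin n))
    (γ : Sym2 (Fin n) → ℂ) (a b : Fin n) : MvPolynomial (Fin n) R :=
  quadTerm R β G 1 (fun k l => leadValue β G γ (quadWeight a b k l)) a b

variable {T : OrderedWeights n} {ε ε' : R}

/-- The bracket carries `ε` and the filtration carries `ε'`. This covers `ε = ε'` over `ℂ[X]` and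
`ε' = 1` over `ℂ`. -/
theorem pow_mem_epsSpan' (hT : T.carrier = Theta β G) {m p : ℕ}
    (hε : ∃ z : ℂ, ε ^ m = z • ε' ^ m) (hp : p ≤ m) {w : Fin n → ℤ} (hw : w ∈ Theta β G m) :
    ε ^ m ∈ epsSpan T ε' p w := by
  obtain ⟨z, hz⟩ := hε
  rw [hz]
  exact Submodule.smul_mem _ _ (pow_mem_epsSpan T ε' hp (hT ▸ hw))

/-- The constants `γ` determine the bracket modulo order two, since only the summand `m = 1` has
order one. -/
theorem IsDeformedBracket.sub_mem (hT : T.carrier = Theta β G) {N : ℕ} (hN : 1 ≤ N)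
    {c : Fin n → Fin n → Fin n → Fin n → ℂ} {γ : Sym2 (Fin n) → ℂ}
    (hc : HasLeadingCoeffs β G γ c) {P : PoissonBracket R (MvPolynomial (Fin n) R)}
    (hP : IsDeformedBracket lam β G N c ε P) (hε : ∀ m, ∃ z : ℂ, ε ^ m = z • ε' ^ m)
    {a b : Fin n} (hab : a < b) :
    P.matrix a b - toricMatrix R lam a b - C ε * leadTerm R β G γ a b ∈
      filt T ε' 2 (unitWeight a + unitWeight b) := by
  classical
  have h1 : P.matrix a b = toricMatrix R lam a b +
      ∑ m ∈ Finset.Icc 1 N, C (ε ^ m) * quadTerm R β G m (c b a) a b := hP a b hab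
  have h2 : leadTerm R β G γ a b = quadTerm R β G 1 (c b a) a b := by
    rw [leadTerm, quadTerm, quadTerm]
    refine Finset.sum_congr rfl fun k _ => Finset.sum_congr rfl fun l _ => ?_
    split_ifs with h
    · obtain ⟨i, j, hij, hw⟩ := mem_Theta_one.mp h.2
      rw [leadValue_eq γ hij hw, hc i j _ hij hw a b k l hab h.1 rfl]
    · rfl
  rw [h1, ← Finset.add_sum_erase _ _ (Finset.mem_Icc.mpr ⟨le_rfl, hN⟩), pow_one, h2,
    add_sub_cancel_left, add_sub_cancel_left]
  refine Submodule.sum_mem _ fun m hm => ?_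
  rw [Finset.mem_erase, Finset.mem_Icc] at hm
  exact C_mul_quadTerm_mem (fun w hw => pow_mem_epsSpan' hT (hε m) (by omega) hw) _ _ _

theorem leadTerm_mem (hT : T.carrier = Theta β G) (hε : ∃ z : ℂ, ε = z • ε')
    (γ : Sym2 (Fin n) → ℂ) (a b : Fin n) :
    C ε * leadTerm R β G γ a b ∈ filt T ε' 1 (unitWeight a + unitWeight b) := by
  have h : ∃ z : ℂ, ε ^ 1 = z • ε' ^ 1 := by simpa using hε
  refine C_mul_quadTerm_mem (fun w hw => ?_) _ _ _
  have := pow_mem_epsSpan' hT h le_rfl hw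
  rwa [pow_one] at this

theorem mem_filt_of_lt {D : Fin n → Fin n → MvPolynomial (Fin n) R}
    (hD : ∀ a b, D a b = -D b a) {p : ℕ}
    (h : ∀ a b, a < b → D a b ∈ filt T ε p (unitWeight a + unitWeight b)) (a b : Fin n) :
    D a b ∈ filt T ε p (unitWeight a + unitWeight b) := by
  rcases lt_trichotomy a b with hab | rfl | hab
  · exact h a b hab
  · have : D a a = 0 := by
      ext s
      rw [coeff_zero]
      have h1 := congrArg (coeff s) (hD a a)
      rw [coeff_neg] at h1
      exact eq_zero_of_eq_neg h1
    rw [this]; exact zero_mem _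
  · rw [hD, add_comm (unitWeight a)]; exact neg_mem (h b a hab)

theorem IsDeformedBracket.isNearToric (halt : lam.transpose = -lam)
    (hT : T.carrier = Theta β G) {N : ℕ} (hN : 1 ≤ N)
    {c : Fin n → Fin n → Fin n → Fin n → ℂ} {γ : Sym2 (Fin n) → ℂ}
    (hc : HasLeadingCoeffs β G γ c) {P : PoissonBracket R (MvPolynomial (Fin n) R)}
    (hP : IsDeformedBracket lam β G N c ε P) (hε : ∀ m, ∃ z : ℂ, ε ^ m = z • ε' ^ m) :
    IsNearToric T ε' lam P.matrix := by
  refine ⟨fun a b => P.swap _ _, mem_filt_of_lt (fun a b => ?_) fun a b hab => ?_⟩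
  · rw [toricMatrix_swap halt, PoissonBracket.matrix, P.swap, PoissonBracket.matrix]; ring
  · have h1 := filt_mono one_le_two (hP.sub_mem hT hN hc hε hab)
    have h2 := leadTerm_mem (R := R) hT (by simpa using hε 1) γ a b
    have := add_mem h1 h2
    rwa [sub_add_cancel] at this

/-! ### Extraction of coefficients -/

/-- At a given weight a coefficient is a complex multiple of a single power of `ε`, and that
multiple is the constant sought. Orders are bounded by `K`; the choice `N = K + 1` ensures `1 ≤ N`.
-/
theorem exists_quad_coeffs (hT : T.carrier = Theta β G) {f : Fin n → Fin n → MvPolynomial (Fin n) R}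
    (hf : ∀ a b, f a b ∈ filt T ε 1 (unitWeight a + unitWeight b)) :
    ∃ (N : ℕ) (c : Fin n → Fin n → Fin n → Fin n → ℂ), 1 ≤ N ∧
      (∀ a b k l m, quadWeight a b k l ∈ Theta β G m →
        coeff (Finsupp.single k 1 + Finsupp.single l 1) (f a b) = c b a k l • ε ^ m) ∧
      ∀ a b, f a b = ∑ m ∈ Finset.Icc 1 N, C (ε ^ m) * quadTerm R β G m (c b a) a b := by
  classical
  have hmem : ∀ a b k l, coeff (Finsupp.single k 1 + Finsupp.single l 1) (f a b) ∈
      epsSpan T ε 1 (quadWeight a b k l) := fun a b k l => by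
    rw [← expo_quad]; exact hf a b _
  have hex : ∀ b a k l, ∃ z : ℂ, ∀ m, quadWeight a b k l ∈ Theta β G m →
      coeff (Finsupp.single k 1 + Finsupp.single l 1) (f a b) = z • ε ^ m := by
    intro b a k l
    by_cases h : ∃ m, quadWeight a b k l ∈ T.carrier m
    · obtain ⟨m, hm⟩ := h
      obtain ⟨z, hz⟩ := exists_smul_of_mem_epsSpan (hmem a b k l) hm
      refine ⟨z, fun m' hm' => ?_⟩
      rw [T.disjoint (hT ▸ hm' : _ ∈ T.carrier m') hm]
      exact hz
    · exact ⟨0, fun m hm => absurd ⟨m, hT ▸ hm⟩ h⟩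
  choose c hc using hex
  obtain ⟨K, hK⟩ := exists_order_bound T 2
  refine ⟨K + 1, c, by omega, fun a b k l m h => hc b a k l m h, fun a b => ?_⟩
  have hR : ∑ m ∈ Finset.Icc 1 (K + 1), C (ε ^ m) * quadTerm R β G m (c b a) a b ∈
      filt T ε 1 (unitWeight a + unitWeight b) := by
    refine Submodule.sum_mem _ fun m hm => ?_
    exact C_mul_quadTerm_mem (fun w hw => pow_mem_epsSpan T ε (Finset.mem_Icc.mp hm).1 (hT ▸ hw))
      _ _ _
  rw [← sub_eq_zero]
  ext s
  rw [coeff_zero]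
  by_contra hne
  have hs := sum_expo_eq (sub_mem (hf a b) hR) hne
  simp only [Pi.add_apply, Finset.sum_add_distrib, sum_unitWeight] at hs
  obtain ⟨k, l, hkl, rfl⟩ := exists_single_add_single (hs.trans (by norm_num))
  refine hne ?_
  rw [coeff_sub, coeff_sum, sub_eq_zero]
  simp only [coeff_C_mul, coeff_quadTerm _ _ _ _ hkl]
  by_cases h0 : coeff (Finsupp.single k 1 + Finsupp.single l 1) (f a b) = 0
  · rw [h0]
    symm
    refine Finset.sum_eq_zero fun m _ => ?_
    split_ifs with h
    · rw [mul_comm, ← Algebra.smul_def, ← hc b a k l m h, h0]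
    · rw [mul_zero]
  · obtain ⟨m, h1, hm⟩ := exists_of_mem_epsSpan (hmem a b k l) h0
    have hmK : m < K := by
      by_contra! hKm
      refine hK m hKm _ hm fun i => ?_
      rw [← expo_quad]
      refine abs_le_of_sum_le (expo_nonneg _)
        (add_nonneg (unitWeight_nonneg a) (unitWeight_nonneg b)) ?_ ?_ i
      · rw [hs]; norm_num
      · simp only [Pi.add_apply, Finset.sum_add_distrib, sum_unitWeight]
        norm_num
    rw [Finset.sum_eq_single m]
    · rw [if_pos (hT ▸ hm), mul_comm, ← Algebra.smul_def]
      exact hc b a k l m (hT ▸ hm)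
    · intro m' _ hne'
      rw [if_neg, mul_zero]
      exact fun h' => hne' (T.disjoint (hT ▸ h' : _ ∈ T.carrier m') hm)
    · intro hn
      exact absurd (Finset.mem_Icc.mpr ⟨h1, by omega⟩) hn

theorem exists_linear_coeffs (hT : T.carrier = Theta β G) {f : Fin n → MvPolynomial (Fin n) R}
    (hf : ∀ a, f a ∈ filt T ε 1 (unitWeight a)) :
    ∃ (M : ℕ) (α : Matrix (Fin n) (Fin n) ℂ), ∀ a, f a =
      ∑ m ∈ Finset.Icc 1 M, C (ε ^ m) * ∑ d,
        open Classical in if unitWeight d - unitWeight a ∈ Theta β G m then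
          C (algebraMap ℂ R (α a d)) * X d else 0 := by
  classical
  have hmem : ∀ a d, coeff (Finsupp.single d 1) (f a) ∈
      epsSpan T ε 1 (unitWeight d - unitWeight a) := fun a d => by
    rw [← expo_single]; exact hf a _
  have hex : ∀ a d, ∃ z : ℂ, ∀ m, unitWeight d - unitWeight a ∈ Theta β G m →
      coeff (Finsupp.single d 1) (f a) = z • ε ^ m := by
    intro a d
    by_cases h : ∃ m, unitWeight d - unitWeight a ∈ T.carrier m
    · obtain ⟨m, hm⟩ := h
      obtain ⟨z, hz⟩ := exists_smul_of_mem_epsSpan (hmem a d) hm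
      refine ⟨z, fun m' hm' => ?_⟩
      rw [T.disjoint (hT ▸ hm' : _ ∈ T.carrier m') hm]
      exact hz
    · exact ⟨0, fun m hm => absurd ⟨m, hT ▸ hm⟩ h⟩
  choose α hα using hex
  obtain ⟨K, hK⟩ := exists_order_bound T 1
  refine ⟨K, α, fun a => ?_⟩
  have hterm : ∀ m, (∑ d, if unitWeight d - unitWeight a ∈ Theta β G m then
      (C (algebraMap ℂ R (α a d)) * X d : MvPolynomial (Fin n) R) else 0) =
      ∑ d, C (if unitWeight d - unitWeight a ∈ Theta β G m then algebraMap ℂ R (α a d) else 0) *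
        X d := by
    intro m
    refine Finset.sum_congr rfl fun d _ => ?_
    split_ifs
    · rfl
    · rw [map_zero, zero_mul]
  simp only [hterm]
  have hR : ∑ m ∈ Finset.Icc 1 K, C (ε ^ m) * ∑ d,
      C (if unitWeight d - unitWeight a ∈ Theta β G m then algebraMap ℂ R (α a d) else 0) * X d ∈
      filt T ε 1 (unitWeight a) := by
    refine Submodule.sum_mem _ fun m hm => ?_
    rw [Finset.mul_sum]
    simp only [← mul_assoc, ← map_mul]
    refine sum_C_mul_X_mem fun d => ?_
    split_ifs with h
    · rw [mul_comm, ← Algebra.smul_def]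
      exact Submodule.smul_mem _ _ (pow_mem_epsSpan T ε (Finset.mem_Icc.mp hm).1 (hT ▸ h))
    · rw [mul_zero]; exact zero_mem _
  rw [← sub_eq_zero]
  ext s
  rw [coeff_zero]
  by_contra hne
  have hs := sum_expo_eq (sub_mem (hf a) hR) hne
  rw [sum_unitWeight] at hs
  obtain ⟨d, hd⟩ := exists_eq_unitWeight (expo_nonneg s) hs
  rw [← expo_single] at hd
  rw [expo_injective hd] at hne
  refine hne ?_
  have hlin : ∀ (N : Fin n → R), coeff (Finsupp.single d 1) (∑ e, C (N e) * X e) = N d := fun N => by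
    rw [← zcoeff_expo, expo_single, zcoeff_sum_C_mul_X]
  rw [coeff_sub, coeff_sum, sub_eq_zero]
  simp only [coeff_C_mul, hlin]
  by_cases h0 : coeff (Finsupp.single d 1) (f a) = 0
  · rw [h0]
    symm
    refine Finset.sum_eq_zero fun m _ => ?_
    split_ifs with h
    · rw [mul_comm, ← Algebra.smul_def, ← hα a d m h, h0]
    · rw [mul_zero]
  · obtain ⟨m, h1, hm⟩ := exists_of_mem_epsSpan (hmem a d) h0
    have hmK : m < K := by
      by_contra! hKm
      refine hK m hKm _ hm fun i => ?_
      exact abs_le_of_sum_le (unitWeight_nonneg d) (unitWeight_nonneg a) (sum_unitWeight d).le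
        (sum_unitWeight a).le i
    rw [Finset.sum_eq_single m]
    · rw [if_pos (hT ▸ hm), mul_comm, ← Algebra.smul_def]
      exact hα a d m (hT ▸ hm)
    · intro m' _ hne'
      rw [if_neg, mul_zero]
      exact fun h' => hne' (T.disjoint (hT ▸ h' : _ ∈ T.carrier m') hm)
    · intro hn
      exact absurd (Finset.mem_Icc.mpr ⟨h1, by omega⟩) hn

end Deformed

/-! ### First order terms and the bracket extending them -/

section ExistenceConcrete

open MvPolynomial

variable {n : ℕ} {R : Type*} [CommRing R] [Algebra ℂ R] {lam β : Matrix (Fin n) (Fin n) ℂ}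
  {G : SimpleGraph (Fin n)} {T : OrderedWeights n} {ε : R}

theorem pairing_eq_zero (hβ : IsBiresidueMatrix lam β) {i j a : Fin n} {w : Fin n → ℤ}
    (h : IsSmoothableWeight β i j w) (hi : a ≠ i) (hj : a ≠ j) : pairing R lam w a = 0 := by
  rw [pairing, h.mulVec_eq hβ, edgeVector_eq_zero hi hj, map_zero]

theorem IsSmoothableWeight.eq_or_eq {i j b c : Fin n} {w : Fin n → ℤ}
    (h : IsSmoothableWeight β i j w) (hpos : 0 ≤ w + (unitWeight b + unitWeight c)) :
    (i = b ∨ i = c) ∧ (j = b ∨ j = c) := by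
  have key : ∀ k, w k = -1 → k = b ∨ k = c := by
    intro k hk
    by_contra! hne
    have := hpos k
    simp [unitWeight, hne, hk] at this
  exact ⟨key i h.2.1, key j h.2.2.1⟩

/-- The terms of first order satisfy the Jacobi identity to first order. -/
theorem cyclic_sum_eq_zero (hβ : IsBiresidueMatrix lam β) {i j : Fin n} {w : Fin n → ℤ}
    (h : IsSmoothableWeight β i j w) {q : Fin n → Fin n → R} (hq : ∀ a b, q a b = -q b a)
    (hpos : ∀ a b, q a b ≠ 0 → 0 ≤ w + (unitWeight a + unitWeight b)) (a b c : Fin n) :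
    pairing R lam w a * q b c + pairing R lam w b * q c a + pairing R lam w c * q a b = 0 := by
  have hdiag : ∀ a, q a a = 0 := fun a => eq_zero_of_eq_neg (hq a a)
  -- If `q b c` is nonzero then `{b, c} = {i, j}`, so `a` is off the edge, where `λw` vanishes.
  have key : ∀ a b c, a ≠ b → a ≠ c → pairing R lam w a * q b c = 0 := by
    intro a b c hab hac
    by_cases h0 : q b c = 0
    · rw [h0, mul_zero]
    · obtain ⟨h1, h2⟩ := h.eq_or_eq (hpos b c h0)
      rw [pairing_eq_zero hβ h (fun h' => ?_) (fun h' => ?_), zero_mul]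
      · rcases h1 with h1 | h1
        · exact hab (h'.trans h1)
        · exact hac (h'.trans h1)
      · rcases h2 with h2 | h2
        · exact hab (h'.trans h2)
        · exact hac (h'.trans h2)
  by_cases hab : a = b
  · subst hab
    rw [hdiag, hq c a]; ring
  by_cases hbc : b = c
  · subst hbc
    rw [hdiag, hq b a]; ring
  by_cases hac : a = c
  · subst hac
    rw [hdiag, hq b a]; ring
  rw [key a b c hab hac, key b c a hbc (Ne.symm hab), key c a b (Ne.symm hac) (Ne.symm hbc)]
  ring

/-- The toric bracket plus the prescribed first order terms satisfies the Jacobi identity modulo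
order two, and from order two on nothing obstructs. -/
theorem exists_deformed_matrix (halt : lam.transpose = -lam) (hβ : IsBiresidueMatrix lam β)
    (hG : G.IsAcyclic) (hsm : ∀ i j, G.Adj i j → IsSmoothableEdge β i j)
    (hT : T.carrier = Theta β G) (γ : Sym2 (Fin n) → ℂ) (ε : R) :
    ∃ P : Fin n → Fin n → MvPolynomial (Fin n) R, IsNearToric T ε lam P ∧
      (∀ a b, a < b → P a b - toricMatrix R lam a b - C ε * leadTerm R β G γ a b ∈
        filt T ε 2 (unitWeight a + unitWeight b)) ∧
      ∀ a b c, jac P (X a) (X b) (X c) = 0 := by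
  set Q : Fin n → Fin n → MvPolynomial (Fin n) R := fun a b =>
    if a < b then C ε * leadTerm R β G γ a b
    else if b < a then -(C ε * leadTerm R β G γ b a) else 0 with hQ
  have hQs : ∀ a b, Q a b = -Q b a := by
    intro a b
    simp only [hQ]
    rcases lt_trichotomy a b with h | rfl | h
    · simp [h, h.not_gt]
    · simp
    · simp [h, h.not_gt]
  have hQlt : ∀ a b, a < b → Q a b = C ε * leadTerm R β G γ a b := fun a b h => by simp [hQ, h]
  have hQmem : ∀ a b, Q a b ∈ filt T ε 1 (unitWeight a + unitWeight b) :=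
    mem_filt_of_lt hQs fun a b h => by
      rw [hQlt a b h]
      exact leadTerm_mem hT ⟨1, by rw [one_smul]⟩ γ a b
  have htor : IsNearToric T ε lam (toricMatrix R lam) := isNearToric_toric halt
  have hJ : ∀ a b c, jac (toricMatrix R lam + Q) (X a) (X b) (X c) ∈
      filt T ε 2 (unitWeight a + unitWeight b + unitWeight c) := by
    intro a b c
    refine mem_filt_succ (p := 1) ?_ fun W hW => ?_
    · have := jac_sub_mem htor hQmem a b c
      rwa [jac_toric halt, sub_zero] at this
    · have h := zcoeff_jac_add halt htor hQs le_rfl hQmem hW a b c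
      rw [jac_toric halt, sub_zero] at h
      rw [h]
      obtain ⟨i, j, _, hw⟩ := mem_Theta_one.mp (hT ▸ hW : W ∈ Theta β G 1)
      exact cyclic_sum_eq_zero hβ hw
        (q := fun a b => zcoeff (W + (unitWeight a + unitWeight b)) (Q a b))
        (fun a b => by rw [hQs, map_neg, add_comm (unitWeight a)])
        (fun a b h => nonneg_of_zcoeff_ne_zero h) a b c
  obtain ⟨P, h1, h2, h3⟩ := exists_jacobi halt (htor.add hQs hQmem)
    (fun m hm W hW => isAcyclicWeight_of_mem_Theta hβ hG hsm hm (hT ▸ hW)) hJ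
  refine ⟨P, h1, fun a b hab => ?_, h3⟩
  have := h2 a b
  rwa [Pi.add_apply, Pi.add_apply, hQlt a b hab, ← sub_sub] at this

/-! ### Specialization of the parameter -/

theorem map_br {R S : Type*} [CommRing R] [CommRing S] (φ : R →+* S) (P : Fin n → Fin n → MvPolynomial (Fin n) R)
    (f g : MvPolynomial (Fin n) R) :
    map φ (br P f g) = br (fun a b => map φ (P a b)) (map φ f) (map φ g) := by
  simp only [br_eq, map_sum, map_mul, pderiv_map]

theorem map_jac {R S : Type*} [CommRing R] [CommRing S] (φ : R →+* S)
    (P : Fin n → Fin n → MvPolynomial (Fin n) R) (f g h : MvPolynomial (Fin n) R) :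
    map φ (jac P f g h) = jac (fun a b => map φ (P a b)) (map φ f) (map φ g) (map φ h) := by
  simp only [jac, map_add, map_br]

theorem map_eval_toricMatrix (x : ℂ) (a b : Fin n) :
    map (Polynomial.evalRingHom x) (toricMatrix ℂ[X] lam a b) = toricMatrix ℂ lam a b := by
  simp [toricMatrix]

theorem map_eval_quadTerm (x : ℂ) (m : ℕ) (c : Fin n → Fin n → ℂ) (a b : Fin n) :
    map (Polynomial.evalRingHom x) (quadTerm ℂ[X] β G m c a b) = quadTerm ℂ β G m c a b := by
  simp only [quadTerm, map_sum, apply_ite (map (Polynomial.evalRingHom x)), map_zero, map_mul,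
    map_C, map_X]
  simp

theorem poissonOfMatrix_matrix {R : Type*} [CommRing R] [IsDomain R] [CharZero R]
    (P : Fin n → Fin n → MvPolynomial (Fin n) R) (hP : ∀ a b, P a b = -P b a)
    (hj : ∀ a b c, jac P (X a) (X b) (X c) = 0) : (poissonOfMatrix P hP hj).matrix = P := by
  ext1 a; ext1 b
  exact br_X_X P a b

theorem coeff_epsCoeff (m : ℕ) (f : MvPolynomial (Fin n) ℂ[X]) (s : Fin n →₀ ℕ) :
    coeff s (epsCoeff m f) = (coeff s f).coeff m := by
  classical
  rw [epsCoeff, coeff_sum]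
  simp only [coeff_monomial]
  rw [Finset.sum_ite_eq']
  split_ifs with h
  · rfl
  · rw [notMem_support_iff.mp h, Polynomial.coeff_zero]

theorem epsCoeff_zero_eq_map (f : MvPolynomial (Fin n) ℂ[X]) :
    epsCoeff 0 f = map (Polynomial.evalRingHom 0) f := by
  ext s
  rw [coeff_epsCoeff, coeff_map, Polynomial.coe_evalRingHom, Polynomial.coeff_zero_eq_eval_zero]

theorem mem_smoothableFiltration {p : ℕ} {f : MvPolynomial (Fin n) ℂ} :
    f ∈ smoothableFiltration β G p ↔ ∀ s, coeff s f ≠ 0 →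
      ∃ m, p ≤ m ∧ ∃ θ ∈ Theta β G m, ∀ i, θ i ≤ (s i : ℤ) := by
  classical
  constructor
  · intro hf
    induction hf using Submodule.span_induction with
    | mem f h =>
      obtain ⟨t, ht, rfl⟩ := h
      intro s hs
      rw [coeff_monomial] at hs
      split_ifs at hs with h
      · rwa [← h]
      · exact absurd rfl hs
    | zero => intro s hs; exact absurd (coeff_zero s) hs
    | add f g _ _ hf hg =>
      intro s hs
      by_cases h : coeff s f = 0
      · refine hg s fun h' => hs ?_
        rw [coeff_add, h, h', add_zero]
      · exact hf s h
    | smul r f _ hf =>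
      intro s hs
      refine hf s fun h' => hs ?_
      rw [coeff_smul, h', smul_zero]
  · intro h
    rw [f.as_sum]
    refine Submodule.sum_mem _ fun s hs => ?_
    rw [← mul_one (coeff s f), ← smul_eq_mul, ← smul_monomial]
    exact Submodule.smul_mem _ _ (Submodule.subset_span ⟨s, h s (mem_support_iff.mp hs), rfl⟩)

/-- A monomial `x^r` with factor `ε^m` in `{x^s, x^t}` has `r - s - t ∈ Θ_m`. Added to the weights
in `Θ` that bound `s` and `t`, this bounds `r` by a weight of order at least `p + q + m`. -/
theorem br_filtered (hT : T.carrier = Theta β G)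
    {P : Fin n → Fin n → MvPolynomial (Fin n) ℂ[X]}
    (hP : IsNearToric T (Polynomial.X : ℂ[X]) lam P) {p q m : ℕ} {f g : MvPolynomial (Fin n) ℂ}
    (hf : f ∈ smoothableFiltration β G p) (hg : g ∈ smoothableFiltration β G q) :
    epsCoeff m (br P (map Polynomial.C f) (map Polynomial.C g)) ∈
      smoothableFiltration β G (p + q + m) := by
  classical
  have hadd : ∀ f g : MvPolynomial (Fin n) ℂ[X],
      epsCoeff m (f + g) = epsCoeff m f + epsCoeff m g := by
    intro f g; ext s; simp [coeff_epsCoeff]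
  have hzero : epsCoeff m (0 : MvPolynomial (Fin n) ℂ[X]) = 0 := by
    ext s; simp [coeff_epsCoeff]
  have hsmul : ∀ (r : ℂ) (f : MvPolynomial (Fin n) ℂ[X]),
      epsCoeff m (Polynomial.C r • f) = r • epsCoeff m f := by
    intro r f; ext s; simp [coeff_epsCoeff]
  induction hf using Submodule.span_induction with
  | zero => simp only [map_zero, br_eq, zero_mul, Finset.sum_const_zero, mul_zero, hzero]; exact zero_mem _
  | add f f' _ _ hf hf' => rw [map_add, br_add_left, hadd]; exact add_mem hf hf'
  | smul r f _ hf =>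
    rw [smul_eq_C_mul, map_mul, map_C, ← smul_eq_C_mul, br_smul_left, hsmul]
    exact Submodule.smul_mem _ _ hf
  | mem f h =>
    obtain ⟨s, ⟨m₁, hm₁, θ₁, hθ₁, hs⟩, rfl⟩ := h
    induction hg using Submodule.span_induction with
    | zero => simp only [map_zero, br_eq, zero_mul, Finset.sum_const_zero, hzero]; exact zero_mem _
    | add f f' _ _ hf hf' => rw [map_add, br_add_right, hadd]; exact add_mem hf hf'
    | smul r f _ hf =>
      rw [smul_eq_C_mul, map_mul, map_C, ← smul_eq_C_mul, br_smul_right, hsmul]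
      exact Submodule.smul_mem _ _ hf
    | mem g h =>
      obtain ⟨t, ⟨m₂, hm₂, θ₂, hθ₂, ht⟩, rfl⟩ := h
      rw [map_monomial, map_monomial, map_one, mem_smoothableFiltration]
      intro r hr
      rw [coeff_epsCoeff] at hr
      have hmon : ∀ s : Fin n →₀ ℕ, (monomial s 1 : MvPolynomial (Fin n) ℂ[X]) ∈
          filt T (Polynomial.X : ℂ[X]) 0 (expo s) :=
        fun s => monomial_mem_filt (by rw [sub_self]; exact one_mem_epsSpan T _)
      have hmem := br_mem_filt hP.mem (hmon s) (hmon t) (by ring : 0 = 0 + 0 + 0) rfl r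
      have hne : coeff r (br P (monomial s 1) (monomial t 1)) ≠ 0 := by
        intro h0; rw [h0, Polynomial.coeff_zero] at hr; exact hr rfl
      obtain ⟨m', _, hw⟩ := exists_of_mem_epsSpan hmem hne
      obtain ⟨z, hz⟩ := exists_smul_of_mem_epsSpan hmem hw
      have hmm : m = m' := by
        by_contra hmm
        rw [hz, Polynomial.coeff_smul, Polynomial.coeff_X_pow, if_neg hmm, smul_zero] at hr
        exact hr rfl
      subst hmm
      rw [hT] at hw
      refine ⟨m₁ + m₂ + m, by omega, _, Theta_add_mem (Theta_add_mem hθ₁ hθ₂) hw, fun i => ?_⟩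
      have h1 := hs i
      have h2 := ht i
      simp only [Pi.add_apply, Pi.sub_apply, expo]
      omega

end ExistenceConcrete

/-! ### Diagonal scalings and the change of parameters -/

section Scaling

open MvPolynomial

variable {n : ℕ} {lam β : Matrix (Fin n) (Fin n) ℂ} {G : SimpleGraph (Fin n)}
  {T : OrderedWeights n} {ε : ℂ}

/-- The diagonal automorphism `x_a ↦ exp (τ_a) x_a`. -/
noncomputable def scaling (τ : Fin n → ℂ) :
    MvPolynomial (Fin n) ℂ ≃ₐ[ℂ] MvPolynomial (Fin n) ℂ :=
  linearEquiv (Matrix.diagonal fun a => Complex.exp (τ a))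
    (Matrix.diagonal fun a => Complex.exp (-τ a))
    (by simp [← Complex.exp_add])
    (by simp [← Complex.exp_add])

theorem linearSubst_diagonal_X (t : Fin n → ℂ) (a : Fin n) :
    linearSubst (Matrix.diagonal t) (X a) = C (t a) * X a := by
  rw [linearSubst_X, Finset.sum_eq_single a]
  · rw [Matrix.diagonal_apply_eq]
  · intro d _ hd
    rw [Matrix.diagonal_apply_ne' _ hd, map_zero, zero_mul]
  · simp

theorem scaling_X (τ : Fin n → ℂ) (a : Fin n) :
    scaling τ (X a) = C (Complex.exp (τ a)) * X a :=
  linearSubst_diagonal_X _ a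

theorem scaling_symm_X (τ : Fin n → ℂ) (a : Fin n) :
    (scaling τ).symm (X a) = C (Complex.exp (-τ a)) * X a :=
  linearSubst_diagonal_X _ a

theorem scaling_C (τ : Fin n → ℂ) (c : ℂ) : scaling τ (C c) = C c :=
  (scaling τ).commutes c

theorem exists_scaling_monomial (τ : Fin n → ℂ) (s : Fin n →₀ ℕ) :
    ∃ z : ℂ, scaling τ (monomial s 1) = C z * monomial s 1 := by
  induction s using Finsupp.induction_linear with
  | zero => exact ⟨1, by rw [monomial_zero', scaling_C, map_one, mul_one]⟩
  | add s t hs ht =>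
    obtain ⟨y, hy⟩ := hs
    obtain ⟨z, hz⟩ := ht
    refine ⟨y * z, ?_⟩
    rw [← mul_one (1 : ℂ), ← monomial_mul, map_mul, hy, hz, map_mul]
    ring
  | single a k =>
    refine ⟨Complex.exp (τ a) ^ k, ?_⟩
    rw [← X_pow_eq_monomial, map_pow, scaling_X, mul_pow, map_pow]

theorem scaling_mem_filt (τ : Fin n → ℂ) {p : ℕ} {u : Fin n → ℤ} {f : MvPolynomial (Fin n) ℂ}
    (hf : f ∈ filt T ε p u) : scaling τ f ∈ filt T ε p u := by
  rw [f.as_sum, map_sum]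
  refine Submodule.sum_mem _ fun s _ => ?_
  obtain ⟨z, hz⟩ := exists_scaling_monomial τ s
  rw [← mul_one (coeff s f), ← C_mul_monomial, map_mul, scaling_C, hz, mul_left_comm,
    C_mul_monomial, mul_one]
  exact C_mul_mem_filt z (monomial_mem_filt (hf s))

theorem conj_scaling_matrix (P : PoissonBracket ℂ (MvPolynomial (Fin n) ℂ)) (τ : Fin n → ℂ)
    (a b : Fin n) : (P.conj (scaling τ)).matrix a b =
      C (Complex.exp (-τ a) * Complex.exp (-τ b)) * scaling τ (P.matrix a b) := by
  rw [PoissonBracket.matrix, P.conj_bracket, scaling_symm_X, scaling_symm_X, ← smul_eq_C_mul,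
    ← smul_eq_C_mul, map_smul, map_smul, map_smul, LinearMap.smul_apply, map_smul, smul_smul,
    smul_eq_C_mul, mul_comm (Complex.exp (-τ b)), PoissonBracket.matrix]

theorem scaling_toricMatrix (τ : Fin n → ℂ) (a b : Fin n) :
    C (Complex.exp (-τ a) * Complex.exp (-τ b)) * scaling τ (toricMatrix ℂ lam a b) =
      toricMatrix ℂ lam a b := by
  have h : ∀ a, (C (Complex.exp (-τ a)) * C (Complex.exp (τ a)) : MvPolynomial (Fin n) ℂ) = 1 :=
    fun a => by rw [← map_mul, ← Complex.exp_add, neg_add_cancel, Complex.exp_zero, map_one]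
  rw [toricMatrix, map_mul C, map_mul (scaling τ), map_mul (scaling τ), scaling_C, scaling_X,
    scaling_X]
  linear_combination (C (algebraMap ℂ ℂ (lam a b)) * X a * X b) *
    (C (Complex.exp (-τ b)) * C (Complex.exp (τ b)) * h a + h b)

theorem sum_mul_quadWeight (τ : Fin n → ℂ) (a b k l : Fin n) :
    ∑ i, τ i * quadWeight a b k l i = -τ a - τ b + τ k + τ l := by
  have h : ∀ a, ∑ i, τ i * (unitWeight a i : ℂ) = τ a := fun a => by
    simp [unitWeight, Pi.single_apply]
  simp only [quadWeight, Pi.add_apply, Pi.sub_apply, Pi.neg_apply, Int.cast_add, Int.cast_sub,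
    Int.cast_neg, mul_add, mul_sub, mul_neg, Finset.sum_add_distrib, Finset.sum_sub_distrib,
    Finset.sum_neg_distrib, h]

/-- Conjugation by the scaling multiplies the part of weight `w` of a bracket by `exp (∑ τ_a w_a)`.
-/
theorem scaling_leadTerm {τ : Fin n → ℂ} {γ γ' : Sym2 (Fin n) → ℂ} {ε ε' : ℂ}
    (hτ : ∀ i j w, G.Adj i j → IsSmoothableWeight β i j w →
      ε * γ s(i, j) * Complex.exp (∑ a, τ a * w a) = ε' * γ' s(i, j)) (a b : Fin n) :
    C (Complex.exp (-τ a) * Complex.exp (-τ b)) * scaling τ (C ε * leadTerm ℂ β G γ a b) =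
      C ε' * leadTerm ℂ β G γ' a b := by
  classical
  simp only [leadTerm, quadTerm, map_mul, map_sum, Finset.mul_sum, scaling_C]
  refine Finset.sum_congr rfl fun k _ => Finset.sum_congr rfl fun l _ => ?_
  split_ifs with h
  · obtain ⟨i, j, hij, hw⟩ := mem_Theta_one.mp h.2
    have h1 := hτ i j _ hij hw
    rw [sum_mul_quadWeight, sub_eq_add_neg, Complex.exp_add, Complex.exp_add, Complex.exp_add] at h1
    have h2 := congrArg (C (σ := Fin n)) h1
    simp only [map_mul] at h2
    rw [leadValue_eq γ hij hw, leadValue_eq γ' hij hw, map_mul, map_mul, scaling_C, scaling_X,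
      scaling_X]
    simp only [Algebra.algebraMap_self, RingHom.id_apply]
    linear_combination X k * X l * h2
  · simp

/-- Deformed brackets with different parameters are related by a scaling, up to order two. -/
theorem exists_scaling (halt : lam.transpose = -lam) (hβ : IsBiresidueMatrix lam β)
    (hG : G.IsAcyclic) (hb : ∀ i j, G.Adj i j → β i j ≠ 0) (hT : T.carrier = Theta β G)
    {γ γ' : Sym2 (Fin n) → ℂ} (hγ : ∀ e ∈ G.edgeSet, γ e ≠ 0) (hγ' : ∀ e ∈ G.edgeSet, γ' e ≠ 0)
    {ε ε' : ℂ} (hε : ε ≠ 0) (hε' : ε' ≠ 0) {N N' : ℕ}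
    {c c' : Fin n → Fin n → Fin n → Fin n → ℂ}
    {P P' : PoissonBracket ℂ (MvPolynomial (Fin n) ℂ)} (hN : 1 ≤ N) (hN' : 1 ≤ N')
    (hc : HasLeadingCoeffs β G γ c) (hc' : HasLeadingCoeffs β G γ' c')
    (hP : IsDeformedBracket lam β G N c ε P) (hP' : IsDeformedBracket lam β G N' c' ε' P') :
    ∃ τ : Fin n → ℂ, IsNearToric T (1 : ℂ) lam (P.conj (scaling τ)).matrix ∧
      ∀ a b, P'.matrix a b - (P.conj (scaling τ)).matrix a b ∈
        filt T (1 : ℂ) 2 (unitWeight a + unitWeight b) := by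
  -- Linear independence of the smoothable weights allows all ratios of first order constants to be
  -- matched by one `τ`.
  obtain ⟨τ, hτ⟩ := exists_dual_smoothableWeight hβ hG hb fun e =>
    Complex.log (ε' * γ' e / (ε * γ e))
  have hτ' : ∀ i j w, G.Adj i j → IsSmoothableWeight β i j w →
      ε * γ s(i, j) * Complex.exp (∑ a, τ a * w a) = ε' * γ' s(i, j) := by
    intro i j w hij hw
    have h1 : ε * γ s(i, j) ≠ 0 := mul_ne_zero hε (hγ _ hij)
    have h2 : ε' * γ' s(i, j) ≠ 0 := mul_ne_zero hε' (hγ' _ hij)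
    rw [hτ i j w hij hw, Complex.exp_log (div_ne_zero h2 h1), mul_div_cancel₀ _ h1]
  -- The two brackets have different parameters, so both are measured in the filtration with
  -- parameter `1`.
  have hpow : ∀ (x : ℂ) (m : ℕ), ∃ z : ℂ, x ^ m = z • (1 : ℂ) ^ m := fun x m => ⟨x ^ m, by simp⟩
  refine ⟨τ, ⟨fun a b => (P.conj (scaling τ)).swap _ _, fun a b => ?_⟩,
    mem_filt_of_lt (fun a b => ?_) fun a b hab => ?_⟩
  · have h := C_mul_mem_filt (Complex.exp (-τ a) * Complex.exp (-τ b)) (scaling_mem_filt τ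
      ((hP.isNearToric halt hT hN hc (hpow ε)).sub_mem a b))
    rwa [Algebra.algebraMap_self, RingHom.id_apply, map_sub, mul_sub, scaling_toricMatrix,
      ← conj_scaling_matrix] at h
  · rw [PoissonBracket.matrix, P'.swap, PoissonBracket.matrix, (P.conj _).swap,
      PoissonBracket.matrix, PoissonBracket.matrix]
    ring
  · have h := C_mul_mem_filt (Complex.exp (-τ a) * Complex.exp (-τ b)) (scaling_mem_filt τ
      (hP.sub_mem hT hN hc (hpow ε) hab))
    rw [Algebra.algebraMap_self, RingHom.id_apply, map_sub, map_sub, mul_sub, mul_sub,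
      scaling_toricMatrix, scaling_leadTerm hτ', ← conj_scaling_matrix] at h
    have h' := sub_mem (hP'.sub_mem hT hN' hc' (hpow ε') hab) h
    rwa [sub_sub_sub_cancel_right, sub_sub_sub_cancel_right] at h'

theorem isFilteredLinear_of_mem (hT : T.carrier = Theta β G)
    {φ : MvPolynomial (Fin n) ℂ ≃ₐ[ℂ] MvPolynomial (Fin n) ℂ}
    (hφ : ∀ a, φ (X a) ∈ filt T ε 0 (unitWeight a)) : IsFilteredLinear β G φ := by
  refine ⟨fun a d => coeff (Finsupp.single d 1) (φ (X a)), fun a => ?_, fun a d h => ?_⟩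
  · have hlin : ∀ (N : Fin n → ℂ) d, coeff (Finsupp.single d 1) (∑ e, C (N e) * X e) = N d :=
      fun N d => by rw [← zcoeff_expo, expo_single, zcoeff_sum_C_mul_X]
    have hR : ∑ d, C (coeff (Finsupp.single d 1) (φ (X a))) * X d ∈ filt T ε 0 (unitWeight a) :=
      sum_C_mul_X_mem fun d => by rw [← expo_single d]; exact hφ a _
    rw [← sub_eq_zero]
    ext s
    rw [coeff_zero]
    by_contra hne
    have hs := sum_expo_eq (sub_mem (hφ a) hR) hne
    rw [sum_unitWeight] at hs
    obtain ⟨d, hd⟩ := exists_eq_unitWeight (expo_nonneg s) hs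
    rw [← expo_single] at hd
    rw [expo_injective hd, coeff_sub, hlin, sub_self] at hne
    exact hne rfl
  · obtain ⟨m, _, hm⟩ := exists_of_mem_epsSpan (hφ a _) h
    rw [expo_single, hT] at hm
    exact ⟨m, hm⟩

end Scaling

/-! ### Assembly of the main theorem -/

section Main

open MvPolynomial

variable {n : ℕ} {lam β : Matrix (Fin n) (Fin n) ℂ} {G : SimpleGraph (Fin n)}
  {T : OrderedWeights n}

theorem isFilteredUnipotent_of_mem (hT : T.carrier = Theta β G)
    {φ : MvPolynomial (Fin n) ℂ[X] ≃ₐ[ℂ[X]] MvPolynomial (Fin n) ℂ[X]}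
    (hφ : ∀ a, φ (X a) - X a ∈ filt T (Polynomial.X : ℂ[X]) 1 (unitWeight a)) :
    IsFilteredUnipotent β G φ := by
  obtain ⟨M, α, h⟩ := exists_linear_coeffs hT hφ
  exact ⟨M, α, fun a => sub_eq_iff_eq_add'.mp (h a)⟩

theorem toricPoisson_matrix (halt : lam.transpose = -lam) :
    (toricPoisson lam halt).matrix = toricMatrix ℂ lam := by
  ext1 a; ext1 b
  exact toricPoisson_X lam halt a b

theorem isFilteredDeformation_of_isNearToric (halt : lam.transpose = -lam)
    (hT : T.carrier = Theta β G) {P : PoissonBracket ℂ[X] (MvPolynomial (Fin n) ℂ[X])}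
    (hP : IsNearToric T (Polynomial.X : ℂ[X]) lam P.matrix) :
    IsFilteredDeformation (smoothableFiltration β G) (toricPoisson lam halt) P := by
  refine ⟨fun f g => ?_, fun p q m f g hf hg => ?_⟩
  · have hC : ∀ f : MvPolynomial (Fin n) ℂ,
        map (Polynomial.evalRingHom 0) (map Polynomial.C f) = f := by
      intro f; ext s; simp [coeff_map]
    have hmat : (fun a b => map (Polynomial.evalRingHom 0) (P.matrix a b)) =
        toricMatrix ℂ lam := by
      ext1 a; ext1 b
      rw [← map_eval_toricMatrix 0, ← sub_eq_zero, ← map_sub]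
      ext s
      rw [coeff_map, coeff_zero]
      by_contra h
      have hmem := hP.sub_mem a b s
      have hne : coeff s (P.matrix a b - toricMatrix ℂ[X] lam a b) ≠ 0 := by
        intro h0; rw [h0, map_zero] at h; exact h rfl
      obtain ⟨m, hm, hw⟩ := exists_of_mem_epsSpan hmem hne
      obtain ⟨z, hz⟩ := exists_smul_of_mem_epsSpan hmem hw
      rw [hz] at h
      refine h ?_
      rw [Polynomial.coe_evalRingHom, Polynomial.eval_smul, Polynomial.eval_pow,
        Polynomial.eval_X, zero_pow (by omega), smul_zero]
    rw [epsCoeff_zero_eq_map, P.eq_br, map_br, hmat, hC, hC, (toricPoisson lam halt).eq_br,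
      toricPoisson_matrix]
  · rw [P.eq_br]
    exact br_filtered hT hP hf hg

/-- The bracket is built once over `ℂ[X]`; evaluation at `ε` gives the complex brackets with the
same `N` and `c`. -/
theorem exists_deformed_family (halt : lam.transpose = -lam) (hβ : IsBiresidueMatrix lam β)
    (hG : G.IsAcyclic) (hsm : ∀ i j, G.Adj i j → IsSmoothableEdge β i j)
    (hT : T.carrier = Theta β G) (γ : Sym2 (Fin n) → ℂ) :
    ∃ (N : ℕ) (c : Fin n → Fin n → Fin n → Fin n → ℂ), 1 ≤ N ∧ HasLeadingCoeffs β G γ c ∧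
      (∃ P : PoissonBracket ℂ[X] (MvPolynomial (Fin n) ℂ[X]),
        IsDeformedBracket lam β G N c Polynomial.X P ∧
        IsFilteredDeformation (smoothableFiltration β G) (toricPoisson lam halt) P) ∧
      ∀ ε : ℂ, ∃ P : PoissonBracket ℂ (MvPolynomial (Fin n) ℂ),
        IsDeformedBracket lam β G N c ε P := by
  classical
  obtain ⟨P, hP, hlead, hj⟩ := exists_deformed_matrix halt hβ hG hsm hT γ (Polynomial.X : ℂ[X])
  obtain ⟨N, c, hN, hc, hf⟩ := exists_quad_coeffs hT hP.sub_mem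
  refine ⟨N, c, hN, ?_, ⟨poissonOfMatrix P hP.swap hj, fun a b _ => ?_,
    isFilteredDeformation_of_isNearToric halt hT ?_⟩, fun ε => ?_⟩
  · rintro i j _ hij hw a b k l hab hkl rfl
    have hΘ : quadWeight a b k l ∈ Theta β G 1 := mem_Theta_one.mpr ⟨i, j, hij, hw⟩
    -- At a weight of order one the remainder of order two has no coefficient, so the coefficient
    -- extracted from `P` is the prescribed one.
    have h1 := hlead a b hab (Finsupp.single k 1 + Finsupp.single l 1)
    rw [expo_quad] at h1
    have h2 := eq_zero_of_mem_epsSpan h1 (hT ▸ hΘ : _ ∈ T.carrier 1) one_lt_two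
    rw [coeff_sub, hc a b k l 1 hΘ, coeff_C_mul, leadTerm, coeff_quadTerm _ _ _ _ hkl, if_pos hΘ,
      leadValue_eq γ hij hw, mul_comm, ← Algebra.smul_def, pow_one, sub_eq_zero] at h2
    have h3 := congrArg (Polynomial.coeff · 1) h2
    simpa using h3
  · change br P (X a) (X b) = _
    rw [br_X_X]
    exact sub_eq_iff_eq_add'.mp (hf a b)
  · rwa [poissonOfMatrix_matrix]
  · refine ⟨poissonOfMatrix (fun a b => map (Polynomial.evalRingHom ε) (P a b))
      (fun a b => by rw [hP.swap, map_neg]) (fun a b c => ?_), fun a b _ => ?_⟩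
    · have h := map_jac (Polynomial.evalRingHom ε) P (X a) (X b) (X c)
      rw [hj, map_zero, map_X, map_X, map_X] at h
      exact h.symm
    · change br _ (X a) (X b) = _
      rw [br_X_X, sub_eq_iff_eq_add'.mp (hf a b), map_add, map_eval_toricMatrix, map_sum]
      refine congrArg₂ _ rfl (Finset.sum_congr rfl fun m _ => ?_)
      rw [map_mul, map_eval_quadTerm, map_C, map_pow, Polynomial.coe_evalRingHom,
        Polynomial.eval_X]
      rfl

end Main

end TorusDeform

theorem mainTheorem8 {n : ℕ} (lam : Matrix (Fin n) (Fin n) ℂ)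
    (halt : lam.transpose = -lam) (hnorm : ∀ i, ∑ j, lam i j = 0) (hrank : lam.rank + 1 = n)
    (β : Matrix (Fin n) (Fin n) ℂ) (hβ : IsBiresidueMatrix lam β)
    (G : SimpleGraph (Fin n)) (hsm : ∀ i j, G.Adj i j → IsSmoothableEdge β i j)
    (hG : G.IsAcyclic) :
    -- existence of the filtered deformation
    (∀ γ : Sym2 (Fin n) → ℂ, (∀ e ∈ G.edgeSet, γ e ≠ 0) →
      ∃ (N : ℕ) (c : Fin n → Fin n → Fin n → Fin n → ℂ), 1 ≤ N ∧ HasLeadingCoeffs β G γ c ∧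
        (∃ P : PoissonBracket ℂ[X] (MvPolynomial (Fin n) ℂ[X]),
          IsDeformedBracket lam β G N c Polynomial.X P ∧
          IsFilteredDeformation (smoothableFiltration β G) (toricPoisson lam halt) P) ∧
        ∀ ε : ℂ, ∃ P : PoissonBracket ℂ (MvPolynomial (Fin n) ℂ),
          IsDeformedBracket lam β G N c ε P) ∧
    -- uniqueness of the family over `ℂ[ε]`, for given constants `γ`
    (∀ γ : Sym2 (Fin n) → ℂ, (∀ e ∈ G.edgeSet, γ e ≠ 0) →
      ∀ (N N' : ℕ) (c c' : Fin n → Fin n → Fin n → Fin n → ℂ)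
        (P P' : PoissonBracket ℂ[X] (MvPolynomial (Fin n) ℂ[X])),
        1 ≤ N → 1 ≤ N' → HasLeadingCoeffs β G γ c → HasLeadingCoeffs β G γ c' →
        IsDeformedBracket lam β G N c Polynomial.X P →
        IsDeformedBracket lam β G N' c' Polynomial.X P' →
        ∃ φ : MvPolynomial (Fin n) ℂ[X] ≃ₐ[ℂ[X]] MvPolynomial (Fin n) ℂ[X],
          IsFilteredUnipotent β G φ ∧ Intertwines φ P P') ∧
    -- uniqueness for nonzero complex `ε`, and independence of `ε` and of the constants `γ`
    (∀ γ γ' : Sym2 (Fin n) → ℂ, (∀ e ∈ G.edgeSet, γ e ≠ 0) → (∀ e ∈ G.edgeSet, γ' e ≠ 0) →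
      ∀ ε ε' : ℂ, ε ≠ 0 → ε' ≠ 0 →
      ∀ (N N' : ℕ) (c c' : Fin n → Fin n → Fin n → Fin n → ℂ)
        (P P' : PoissonBracket ℂ (MvPolynomial (Fin n) ℂ)),
        1 ≤ N → 1 ≤ N' → HasLeadingCoeffs β G γ c → HasLeadingCoeffs β G γ' c' →
        IsDeformedBracket lam β G N c ε P → IsDeformedBracket lam β G N' c' ε' P' →
        ∃ φ : MvPolynomial (Fin n) ℂ ≃ₐ[ℂ] MvPolynomial (Fin n) ℂ,
          IsFilteredLinear β G φ ∧ Intertwines φ P P') := by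
  have hb : ∀ i j, G.Adj i j → β i j ≠ 0 := fun i j hij => by
    obtain ⟨w, hw⟩ := hsm i j hij
    exact hw.2.2.2.1
  have hT : (thetaWeights hβ hG hb).carrier = Theta β G := rfl
  have hacy : ∀ m, 2 ≤ m → ∀ W ∈ (thetaWeights hβ hG hb).carrier m, IsAcyclicWeight lam W :=
    fun m hm W hW => isAcyclicWeight_of_mem_Theta hβ hG hsm hm hW
  refine ⟨fun γ _ => exists_deformed_family halt hβ hG hsm hT γ, ?_, ?_⟩
  · intro γ _ N N' c c' P P' hN hN' hc hc' hP hP'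
    have hpow : ∀ m, ∃ z : ℂ, (Polynomial.X : ℂ[X]) ^ m = z • (Polynomial.X : ℂ[X]) ^ m :=
      fun m => ⟨1, (one_smul _ _).symm⟩
    obtain ⟨φ, h1, h2⟩ := exists_filtered_intertwiner halt hacy
      (hP.isNearToric halt hT hN hc hpow) (P' := P') (mem_filt_of_lt
        (fun a b => by
          rw [PoissonBracket.matrix, P'.swap, PoissonBracket.matrix, P.swap,
            PoissonBracket.matrix, PoissonBracket.matrix]
          ring)
        fun a b hab => by
          have h := sub_mem (hP'.sub_mem hT hN' hc' hpow hab) (hP.sub_mem hT hN hc hpow hab)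
          rwa [sub_sub_sub_cancel_right, sub_sub_sub_cancel_right] at h)
    exact ⟨φ, isFilteredUnipotent_of_mem hT h1, h2⟩
  · intro γ γ' hγ hγ' ε ε' hε hε' N N' c c' P P' hN hN' hc hc' hP hP'
    obtain ⟨τ, h1, h2⟩ := exists_scaling halt hβ hG hb hT hγ hγ' hε hε' hN hN' hc hc' hP hP'
    obtain ⟨φ, h3, h4⟩ := exists_filtered_intertwiner halt hacy h1 h2
    -- The scaling first matches the terms of first order, then the unipotent `φ` removes the rest;
    -- the scaling is diagonal, so the composite is still filtered.
    refine ⟨(scaling τ).trans φ, isFilteredLinear_of_mem (ε := 1) hT fun a => ?_, fun f g => ?_⟩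
    · have h5 := add_mem (filt_mono zero_le_one (h3 a)) (X_mem_filt a)
      rw [sub_add_cancel] at h5
      have h6 := C_mul_mem_filt (Complex.exp (τ a)) h5
      rwa [AlgEquiv.trans_apply, scaling_X, ← MvPolynomial.smul_eq_C_mul, map_smul,
        MvPolynomial.smul_eq_C_mul]
    · rw [AlgEquiv.trans_apply, intertwines_conj P (scaling τ) f g, h4]
      rfl
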